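/- **Setting.** Let $E=E^n=\mathbb R^n$ with its standard scalar product, let $0\le k\le n$, and let $G=O(E)\ltimes E$ be the group of euclidean motions, with $dg$ the product of the Haar measure of total mass $1$ on $O(E)$ and Lebesgue measure on $E$. A *compact PL space* is a finite union of convex polytopes in some $E^m$. A *tame pair* $(X/Y)$ consists of sets $Y\subseteq X\subseteq E^m$ such that some homeomorphism carries $X$ to a compact PL space and $Y$ to a compact PL subspace of it. A *curvature map* $\varrho$ assigns to each tame pair $(X/Y)$ a real number $\varrho(X/Y)$, depending only on the isotopy class of the pair in $E^m$, such that (i) $\varrho((X\cup X')/(Y\cup Y'))=\varrho(X/Y)+\varrho(X'/Y')$ if $X\cap X'=\emptyset$; (ii) $\varrho\big(X\times X'\,/\,X\times Y'\cup Y\times X'\big)=\varrho(X/Y)\,\varrho(X'/Y')$; (iii) $\varrho(\{x\}/\{x\})=0$ and $\varrho(\{x\}/\emptyset)=1$ for each point $x$. Let $X_1,X_2\subset E$ be compact PL spaces, each given as the union of a finite polyhedral complex, whose members are called its faces. For $X\subseteq E$ and $x,a\in E$ put $$\varrho(X,x,a)=\varrho\big(C_{r,\delta}/L_{r,\delta}\big),\qquad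 C_{r,\delta}=\{y\in X: |y-x|\le r,\ |\langle y-x,a\rangle|\le\delta\},\qquad L_{r,\delta}=\{y\in X: |y-x|\le r,\ \langle y-x,a\rangle=\delta\},$$ with $0<\delta\ll r$ small; for PL spaces $X$, $x\in X$ and almost all unit vectors $a$ this does not depend on $r,\delta$. Let $\varrho(X,x)$ be the average of $\varrho(X,x,a)$ over all unit vectors $a\in E$. For a face $F$ of $X$ let $\varrho(X,F)$ be the average of $\varrho(X\cap \mathrm{Aff}(F)^{\perp},x,a)$ over all unit vectors $a$ orthogonal to $F$, where $x$ is a relative interior point of $F$ and $\mathrm{Aff}(F)^\perp$ is the affine orthogonal complement of the affine hull of $F$ through $x$; this does not depend on $x$. An average over the unit sphere of the zero space is the value at $a=0$. For a $k$-face $F$ of $X$ let $|F|$ be its $k$-dimensional volume and $W_k(F)=|F|\,\varrho(X,F)$. For linear subspaces $U,V$ of $E$ with $\dim U+\dim V=n$ let $|U:V|=|\det(e_1,\dots,e_n)|$, where $e_1,\dots,e_n$ consists of an orthonormal basis of $U$ followed by one of $V$. **Proposition 3.6.** Let $F_1$ be a $k$-face of $X_1$ and $F_2$ an $(n-k)$-face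 of $X_2$, and let $E_1,E_2$ be the linear subspaces parallel to their affine hulls. For almost all $g\in G$ the set $F_1\cap gF_2$ has at most one point $x$. The function $g\mapsto\varrho(X_1\cap gX_2,x)$, extended by $0$ to those $g$ with $F_1\cap gF_2=\emptyset$, is integrable on $G$, and $$\int_{\{g\in G\,:\,x\in F_1\cap gF_2\}}\varrho(X_1\cap gX_2,x)\,dg=c(n,k)\,|F_1|\,|F_2|\,\varrho(X_1,F_1)\,\varrho(X_2,F_2)=c(n,k)\,W_k(F_1)\,W_{n-k}(F_2),$$ where $$c(n,k)=\int_{O(E)}|E_1:gE_2|\,dg ,$$ the integrand being integrable, and this number depends only on $n$ and $k$. -/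

import Mathlib

open MeasureTheory Filter Topology Set Module
open scoped BigOperators

noncomputable section

/-- The euclidean space `E^n`. -/
abbrev Euc (n : ℕ) : Type := EuclideanSpace ℝ (Fin n)

/-! ### Compact PL spaces, pairs, and isotopy -/

/-- A convex polytope: the convex hull of a finite set of points (possibly empty). -/
def IsPolytope {n : ℕ} (P : Set (Euc n)) : Prop :=
  ∃ s : Set (Euc n), s.Finite ∧ P = convexHull ℝ s

/-- A compact piecewise linear subspace of `E^n`: a finite union of convex polytopes. -/
def IsCompactPL {n : ℕ} (X : Set (Euc n)) : Prop :=
  ∃ T : Set (Set (Euc n)), T.Finite ∧ (∀ P ∈ T, IsPolytope P) ∧ X = ⋃₀ T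

/-- Two pairs of spaces `(X/Y)`, `(X'/Y')` are homeomorphic: there is a homeomorphism
`X → X'` that maps `Y` onto `Y'`. -/
def PairHomeomorphic {n m : ℕ} (X Y : Set (Euc n)) (X' Y' : Set (Euc m)) : Prop :=
  ∃ f : X ≃ₜ X', f '' (Subtype.val ⁻¹' Y) = Subtype.val ⁻¹' Y'

/-- The pairs `(X/Y)`, `Y ⊆ X`, of the tame class PL: those which are homeomorphic to a pair of
compact PL spaces. (The round balls in the definition of cones and links force one to allow
homeomorphic images: those cones and links are not polyhedra on the nose.) -/
def IsTamePair {n : ℕ} (X Y : Set (Euc n)) : Prop :=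
  Y ⊆ X ∧ ∃ (m : ℕ) (P Q : Set (Euc m)),
    IsCompactPL P ∧ IsCompactPL Q ∧ Q ⊆ P ∧ PairHomeomorphic X Y P Q

/-- `(X/Y)` and `(X'/Y')` are isotopic in `E^n`: a continuous one-parameter family of
homeomorphisms of `E^n` starting at the identity carries `X` to `X'` and `Y` to `Y'`. -/
def IsIsotopic {n : ℕ} (X Y X' Y' : Set (Euc n)) : Prop :=
  ∃ H : unitInterval → (Euc n ≃ₜ Euc n),
    Continuous (fun p : unitInterval × Euc n => H p.1 p.2) ∧
    (∀ y, H 0 y = y) ∧ H 1 '' X = X' ∧ H 1 '' Y = Y'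

/-- The product `A × B ⊆ E^n × E^m = E^(n+m)`. -/
def eucProd {n m : ℕ} (A : Set (Euc n)) (B : Set (Euc m)) : Set (Euc (n + m)) :=
  (EuclideanSpace.finAddEquivProd : Euc (n + m) ≃L[ℝ] Euc n × Euc m) ⁻¹' (A ×ˢ B)

/-- A curvature map `ϱ`: it assigns a real number `ϱ(X/Y)` to each isotopy class of pairs of
the tame class PL, is additive for disjoint unions and multiplicative for products of pairs,
and is normalized on singletons. (No condition is imposed on sets which are not tame pairs;
these values are never relevant.) -/
structure CurvatureMap where
  val : (n : ℕ) → Set (Euc n) → Set (Euc n) → ℝ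
  isotopy : ∀ (n : ℕ) (X Y X' Y' : Set (Euc n)), IsTamePair X Y → IsTamePair X' Y' →
    IsIsotopic X Y X' Y' → val n X Y = val n X' Y'
  add : ∀ (n : ℕ) (X Y X' Y' : Set (Euc n)), IsTamePair X Y → IsTamePair X' Y' →
    Disjoint X X' → val n (X ∪ X') (Y ∪ Y') = val n X Y + val n X' Y'
  mul : ∀ (n m : ℕ) (X Y : Set (Euc n)) (X' Y' : Set (Euc m)), IsTamePair X Y →
    IsTamePair X' Y' →
    val (n + m) (eucProd X X') (eucProd X Y' ∪ eucProd Y X') = val n X Y * val m X' Y'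
  point_self : ∀ (n : ℕ) (x : Euc n), val n {x} {x} = 0
  point_empty : ∀ (n : ℕ) (x : Euc n), val n {x} ∅ = 1

/-! ### Cones, links and the curvature at a point -/

/-- The cone of `X` at `x` in direction `a`, with parameters `r` and `δ`. -/
def coneAt {n : ℕ} (X : Set (Euc n)) (x a : Euc n) (r δ : ℝ) : Set (Euc n) :=
  {y | y ∈ X ∩ Metric.closedBall x r ∧ -δ ≤ inner ℝ (y - x) a ∧ inner ℝ (y - x) a ≤ δ}

/-- The link of `X` at `x` in direction `a`, with parameters `r` and `δ`. -/
def linkAt {n : ℕ} (X : Set (Euc n)) (x a : Euc n) (r δ : ℝ) : Set (Euc n) :=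
  {y | y ∈ X ∩ Metric.closedBall x r ∧ inner ℝ (y - x) a = δ}

/-- The average of `f` over the unit sphere of a euclidean space `V` with respect to the
surface measure. If `V = 0`, the sphere is empty, and the average is by convention the value at
the only vector `0` of `V`. -/
def sphereAverage (V : Type) [NormedAddCommGroup V] [InnerProductSpace ℝ V]
    [FiniteDimensional ℝ V] [MeasurableSpace V] [BorelSpace V] (f : V → ℝ) : ℝ :=
  if finrank ℝ V = 0 then f 0
  else ⨍ a : Metric.sphere (0 : V) 1, f a ∂((volume : Measure V).toSphere)

namespace CurvatureMap

/-- `ϱ(X,x,a) = ϱ(C(X,x,a) / L(X,x,a))`: the common value for all sufficiently small `r > 0`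
and all `δ > 0` that are sufficiently small with respect to `r`. -/
def index (ρ : CurvatureMap) {n : ℕ} (X : Set (Euc n)) (x a : Euc n) : ℝ :=
  Classical.epsilon fun v : ℝ =>
    ∀ᶠ r in 𝓝[>] (0 : ℝ), ∀ᶠ δ in 𝓝[>] (0 : ℝ),
      ρ.val n (coneAt X x a r δ) (linkAt X x a r δ) = v

/-- The curvature `ϱ(X,x)` of `X ⊆ E^n` at the point `x`: the average of `ϱ(X,x,a)` over the
unit sphere of `E^n`. -/
def atPoint (ρ : CurvatureMap) {n : ℕ} (X : Set (Euc n)) (x : Euc n) : ℝ :=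
  sphereAverage (Euc n) fun a => ρ.index X x a

/-- The affine orthogonal complement of the affine hull of `F` through the point `x`. -/
def normalSpace {n : ℕ} (F : Set (Euc n)) (x : Euc n) : Set (Euc n) :=
  {y | y - x ∈ (vectorSpan ℝ F)ᗮ}

/-- `ϱ(X,F)`: for an interior point `x` of the face `F`, the average of
`ϱ(X ∩ Aff(F)^⊥, x, a)` over the unit vectors `a` orthogonal to `F`. (The value does not
depend on the choice of the interior point.) -/
def atFace (ρ : CurvatureMap) {n : ℕ} (X F : Set (Euc n)) : ℝ :=
  let x : Euc n := Classical.epsilon fun x => x ∈ intrinsicInterior ℝ F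
  sphereAverage ((vectorSpan ℝ F)ᗮ : Submodule ℝ (Euc n)) fun a =>
    ρ.index (X ∩ normalSpace F x) x (a : Euc n)

end CurvatureMap

/-- The `k`-volume `|F|` of a subset of `E^n`: Hausdorff measure, normalized so as to agree with
Lebesgue measure on `k`-dimensional subspaces. -/
def kVolume {n : ℕ} (k : ℕ) (F : Set (Euc n)) : ℝ :=
  ((Measure.euclideanHausdorffMeasure k : Measure (Euc n)) F).toReal

/-- `W_k(F) = |F| ϱ(X,F)` for a `k`-face `F` of `X`. -/
def CurvatureMap.W (ρ : CurvatureMap) {n : ℕ} (k : ℕ) (X F : Set (Euc n)) : ℝ :=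
  kVolume k F * ρ.atFace X F

/-! ### Faces -/

/-- A finite polyhedral complex in `E^n`: finitely many nonempty convex polytopes, closed under
passing to (nonempty) faces, such that any two of them that meet do so in a common face. Its
members are the faces of the PL space that it describes. -/
structure PolyComplex (n : ℕ) where
  cells : Set (Set (Euc n))
  finite : cells.Finite
  polytope : ∀ P ∈ cells, IsPolytope P
  nonempty : ∀ P ∈ cells, P.Nonempty
  face_mem : ∀ P ∈ cells, ∀ F : Set (Euc n), F.Nonempty → IsExposed ℝ P F → F ∈ cells
  inter_face : ∀ P ∈ cells, ∀ Q ∈ cells, IsExposed ℝ P (P ∩ Q)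

/-- The compact PL space described by a polyhedral complex. -/
def PolyComplex.space {n : ℕ} (K : PolyComplex n) : Set (Euc n) := ⋃₀ K.cells

/-- `F` is a `k`-face of the PL space (with its face structure) `K`. -/
def PolyComplex.IsFace {n : ℕ} (K : PolyComplex n) (k : ℕ) (F : Set (Euc n)) : Prop :=
  F ∈ K.cells ∧ finrank ℝ (vectorSpan ℝ F) = k

/-! ### The group of motions -/

/-- The orthogonal group `O(E^n)`. -/
abbrev OGroup (n : ℕ) : Type := Matrix.orthogonalGroup (Fin n) ℝ

instance OGroup.instCompactSpace (n : ℕ) : CompactSpace (OGroup n) := by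
  suffices h : IsCompact ((Matrix.orthogonalGroup (Fin n) ℝ :
      Submonoid (Matrix (Fin n) (Fin n) ℝ)) : Set (Matrix (Fin n) (Fin n) ℝ)) from
    isCompact_iff_compactSpace.mp h
  have hK : IsCompact (Set.pi Set.univ fun _ : Fin n => Set.pi Set.univ fun _ : Fin n =>
      Set.Icc (-1 : ℝ) 1) :=
    isCompact_univ_pi fun _ => isCompact_univ_pi fun _ => isCompact_Icc
  refine hK.of_isClosed_subset ?_ ?_
  · have : ((Matrix.orthogonalGroup (Fin n) ℝ : Submonoid (Matrix (Fin n) (Fin n) ℝ)) :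
        Set (Matrix (Fin n) (Fin n) ℝ)) = {A | A * star A = 1} := by
      ext A
      exact Matrix.mem_orthogonalGroup_iff _ _
    rw [this]
    exact isClosed_eq (by fun_prop) continuous_const
  · intro A hA i _ j _
    have := entry_norm_bound_of_unitary hA i j
    rw [Real.norm_eq_abs] at this
    exact abs_le.mp this

instance OGroup.instMeasurableSpace (n : ℕ) : MeasurableSpace (OGroup n) := borel _

instance OGroup.instBorelSpace (n : ℕ) : BorelSpace (OGroup n) := ⟨rfl⟩

/-- The Haar measure on `O(E^n)`, with total mass `1`. -/
def OGroup.haar (n : ℕ) : Measure (OGroup n) := Measure.haarMeasure ⊤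

/-- The linear map of `E^n` given by an orthogonal matrix. -/
def OGroup.lin {n : ℕ} (A : OGroup n) : Euc n →ₗ[ℝ] Euc n :=
  Matrix.toEuclideanLin (A : Matrix (Fin n) (Fin n) ℝ)

/-- The euclidean motions of `E^n`; the pair `(A, t)` stands for `y ↦ A y + t`. -/
abbrev Motion (n : ℕ) : Type := OGroup n × Euc n

/-- The image `gX` of a set under a motion. -/
def Motion.image {n : ℕ} (g : Motion n) (X : Set (Euc n)) : Set (Euc n) :=
  (fun y => g.1.lin y + g.2) '' X

/-- The canonical measure on the group of motions: Haar measure times Lebesgue measure. -/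
def Motion.measure (n : ℕ) : Measure (Motion n) := (OGroup.haar n).prod volume

/-- `|U : V| = |det(e_1, …, e_n)|`, where the `e_i` form orthonormal bases of the subspaces `U`
and `V` of `E^n`, and `dim U + dim V = n` (otherwise the value is a dummy). -/
def subspaceDet {n : ℕ} (U V : Submodule ℝ (Euc n)) : ℝ :=
  if h : finrank ℝ U + finrank ℝ V = n then
    |Matrix.det (Matrix.of fun i j : Fin n =>
      (Sum.elim (fun p => (stdOrthonormalBasis ℝ U p : Euc n))
        (fun q => (stdOrthonormalBasis ℝ V q : Euc n))
        (finSumFinEquiv.symm (Fin.cast h.symm j))) i)|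
  else 0

/-- The coordinate subspace of `E^n` of the vectors whose coordinates vanish outside `I`. -/
def coordSubspace {n : ℕ} (I : Set (Fin n)) : Submodule ℝ (Euc n) :=
  Submodule.span ℝ ((fun i => EuclideanSpace.single i (1 : ℝ)) '' I)

/-- The constant `c(n,k) = ∫_{O(E)} |E^k : gE^(n-k)| dg`, defined by means of the two
complementary coordinate subspaces of dimensions `k` and `n - k`. -/
def kinematicConst (n k : ℕ) : ℝ :=
  ∫ A : OGroup n, subspaceDet (coordSubspace {i : Fin n | (i : ℕ) < k})
    ((coordSubspace {i : Fin n | k ≤ (i : ℕ)}).map A.lin) ∂(OGroup.haar n)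

/-- The integrand of the local kinematic formula: the curvature `ϱ(X₁ ∩ gX₂, x)` at the point
`x` of `F₁ ∩ gF₂`, and `0` if `F₁ ∩ gF₂` is empty. (For almost all `g` there is at most one
such point, because the dimensions of the two faces add up to `n`.) -/
def localIntegrand (ρ : CurvatureMap) {n : ℕ} (X₁ F₁ X₂ F₂ : Set (Euc n)) (g : Motion n) : ℝ :=
  ∑ᶠ x ∈ F₁ ∩ g.image F₂, ρ.atPoint (X₁ ∩ g.image X₂) x

end

/-!
The proof localizes, multiplies and averages.

*Homeomorphism invariance.* A curvature map is assumed to be invariant under isotopies only, but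
its value on a tame pair depends only on the homeomorphism type of the pair
(`CurvatureMap.val_eq_of_homeomorphic`). If `f` is a homeomorphism from `X` to `X'`, then
`X × {0}`, the graph of `f` and `{0} × X'` are isotopic in the product space, since by Tietze's
theorem shears carry the first to the second and the second to the third; and multiplying with a
point does not change the value.

*Index of a simplicial cone.* Near a relative interior point of a face, a polyhedral complex is the
product of the affine hull of the face and a simplicial fan in the orthogonal complement
(`PolyComplex.exists_isNormalFan`). For a simplicial fan with spanning vectors `u i` and a direction
`a` with `⟪u i, a⟫ ≠ 0` for all `i`, the pair of cone and link is homeomorphic to a cubical pair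
that only depends on the combinatorics of the fan and on the set of those `i` with `0 < ⟪u i, a⟫`
(`pairHomeomorphic_coneAt_cube`, `CurvatureMap.index_eq_cubeVal`). So the index is locally constant
in `a`, bounded, and invariant under linear maps that preserve these signs. The cubical pair of a
join of two complexes is the product of the cubical pairs, whence its value is a product
(`CurvatureMap.cubeVal_join`).

*Transversal intersections.* For almost every motion `g = (A, t)`, if `F₁` and `g F₂` meet, they
meet in one point, which is relatively interior to both, and `E₁ + A E₂` is the whole space
(`ae_general_position`). At this point `X₁ ∩ g X₂` is a cone over the join of the two normal fans,
and in the coordinates `a = b₁ + A b₂` with `b₁` normal to `F₁` and `b₂` normal to `F₂` its index is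
the product of the two indices (`index_inter_image`). Its curvature is therefore a function of `A`
alone, called `coordAverage` below.

*Integration.* For a fixed `A` the translations `t` for which the faces meet form a set of volume
`|E₁ : A E₂| |F₁| |F₂|` (`volume_translations`). The mean over `O(E)` of `coordAverage`, weighted
with `|E₁ : A E₂|`, is an integral of the product of the indices over the normal spaces of `F₁` and
`F₂` against a kernel. The kernel is radial in both variables: Haar measure is invariant on both
sides, and the orthogonal maps preserving the direction of a face act transitively on the spheres
of its normal space. A radial kernel integrates homogeneous functions of degree zero to multiples of
their spherical averages, and the constant is found by taking both functions to be `1`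
(`integral_sumDet_mul_coordAverage`).
-/


/-! ### Curvature maps are invariant under homeomorphisms of pairs -/

theorem IsPolytope.isCompact {n : ℕ} {P : Set (Euc n)} (hP : IsPolytope P) : IsCompact P := by
  obtain ⟨s, hs, rfl⟩ := hP
  exact hs.isCompact_convexHull ℝ

theorem IsCompactPL.isCompact {n : ℕ} {X : Set (Euc n)} (hX : IsCompactPL X) : IsCompact X := by
  obtain ⟨T, hT, hp, rfl⟩ := hX
  exact hT.isCompact_sUnion fun P hP => (hp P hP).isCompact

theorem IsTamePair.isCompact {n : ℕ} {X Y : Set (Euc n)} (h : IsTamePair X Y) : IsCompact X := by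
  obtain ⟨-, m, P, Q, hP, -, -, f, -⟩ := h
  have := isCompact_iff_compactSpace.mp hP.isCompact
  exact isCompact_iff_compactSpace.mpr f.symm.compactSpace

theorem PairHomeomorphic.symm {n m : ℕ} {X Y : Set (Euc n)} {X' Y' : Set (Euc m)}
    (h : PairHomeomorphic X Y X' Y') : PairHomeomorphic X' Y' X Y := by
  obtain ⟨f, hf⟩ := h
  refine ⟨f.symm, ?_⟩
  rw [← hf, ← image_comp]
  simp

theorem PairHomeomorphic.trans {n m l : ℕ} {X Y : Set (Euc n)} {X' Y' : Set (Euc m)}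
    {X'' Y'' : Set (Euc l)} (h : PairHomeomorphic X Y X' Y') (h' : PairHomeomorphic X' Y' X'' Y'') :
    PairHomeomorphic X Y X'' Y'' := by
  obtain ⟨f, hf⟩ := h
  obtain ⟨g, hg⟩ := h'
  refine ⟨f.trans g, ?_⟩
  rw [← hg, ← hf, image_image]
  rfl

theorem IsTamePair.of_homeomorphic {n m : ℕ} {X Y : Set (Euc n)} {X' Y' : Set (Euc m)}
    (h : IsTamePair X Y) (hY' : Y' ⊆ X') (hh : PairHomeomorphic X' Y' X Y) : IsTamePair X' Y' := by
  obtain ⟨-, l, P, Q, hP, hQ, hQP, hf⟩ := h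
  exact ⟨hY', l, P, Q, hP, hQ, hQP, hh.trans hf⟩

/-- A continuous bijection from a compact set onto a set, matching the subsets, is a
homeomorphism of pairs. -/
theorem PairHomeomorphic.of_bijOn {n m : ℕ} {X Y : Set (Euc n)} {X' Y' : Set (Euc m)}
    (hX : IsCompact X) (f : Euc n → Euc m) (hf : ContinuousOn f X) (hb : BijOn f X X')
    (hY : ∀ x ∈ X, x ∈ Y ↔ f x ∈ Y') : PairHomeomorphic X Y X' Y' := by
  have := isCompact_iff_compactSpace.mp hX
  have hc : Continuous (hb.equiv f) := by
    refine Continuous.subtype_mk ?_ _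
    exact continuousOn_iff_continuous_domRestrict.mp hf
  refine ⟨hc.homeoOfEquivCompactToT2, ?_⟩
  ext y
  constructor
  · rintro ⟨x, hx, rfl⟩
    exact (hY x x.2).1 hx
  · intro hy
    obtain ⟨x, hx, hxy⟩ := hb.surjOn y.2
    refine ⟨⟨x, hx⟩, ?_, Subtype.ext hxy⟩
    refine (hY x hx).2 ?_
    rw [hxy]
    exact hy

theorem eucProd_subset {n m : ℕ} {A A' : Set (Euc n)} {B B' : Set (Euc m)} (h : A ⊆ A')
    (h' : B ⊆ B') : eucProd A B ⊆ eucProd A' B' :=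
  preimage_mono (prod_mono h h')

/-- A singleton together with the empty set is a tame pair. -/
theorem isTamePair_singleton_empty {n : ℕ} (x : Euc n) : IsTamePair {x} (∅ : Set (Euc n)) := by
  refine ⟨empty_subset _, n, {x}, ∅, ⟨{{x}}, finite_singleton _, ?_, by simp⟩,
    ⟨∅, finite_empty, by simp, by simp⟩, empty_subset _, Homeomorph.refl _, by simp⟩
  rintro P rfl
  exact ⟨{x}, finite_singleton _, by simp⟩

/-- The graph of a continuous map over `X ⊆ E^n` is isotopic to `X × {0}`: shear. -/
theorem isIsotopic_graph {n m : ℕ} (X Y : Set (Euc n)) (F : C(Euc n, Euc m)) :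
    IsIsotopic (eucProd X ({0} : Set (Euc m))) (eucProd Y {0})
      (EuclideanSpace.finAddEquivProd ⁻¹' ((fun x => (x, F x)) '' X))
      (EuclideanSpace.finAddEquivProd ⁻¹' ((fun x => (x, F x)) '' Y)) := by
  set J : Euc (n + m) ≃L[ℝ] Euc n × Euc m := EuclideanSpace.finAddEquivProd
  let S : unitInterval → (Euc n × Euc m ≃ₜ Euc n × Euc m) := fun t =>
    { toFun := fun p => (p.1, p.2 + (t : ℝ) • F p.1)
      invFun := fun p => (p.1, p.2 - (t : ℝ) • F p.1)
      left_inv := fun p => by simp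
      right_inv := fun p => by simp
      continuous_toFun := by fun_prop
      continuous_invFun := by fun_prop }
  have key : ∀ Z : Set (Euc n), (fun y => J.symm (S 1 (J y))) '' (eucProd Z ({0} : Set (Euc m))) =
      J ⁻¹' ((fun x => (x, F x)) '' Z) := by
    intro Z
    ext y
    constructor
    · rintro ⟨y, hy, rfl⟩
      obtain ⟨h1, h2⟩ : (J y).1 ∈ Z ∧ (J y).2 = 0 := ⟨hy.1, hy.2⟩
      refine ⟨(J y).1, h1, ?_⟩
      simp [S, h2]
    · rintro ⟨x, hx, hxy⟩
      refine ⟨J.symm (x, 0), ?_, ?_⟩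
      · change J (J.symm (x, 0)) ∈ Z ×ˢ {0}
        simp [hx]
      · have : J.symm (x, F x) = y := by simp [hxy]
        simpa [S] using this
  refine ⟨fun t => J.toHomeomorph.trans ((S t).trans J.symm.toHomeomorph), ?_, ?_, key X, key Y⟩
  · change Continuous fun p : unitInterval × Euc (n + m) =>
      J.symm ((J p.2).1, (J p.2).2 + (p.1 : ℝ) • F (J p.2).1)
    fun_prop
  · intro y
    change J.symm ((J y).1, (J y).2 + ((0 : unitInterval) : ℝ) • F (J y).1) = y
    simp

/-- The mirror image of `isIsotopic_graph`. -/
theorem isIsotopic_graph' {n m : ℕ} (X Y : Set (Euc m)) (F : C(Euc m, Euc n)) :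
    IsIsotopic (eucProd ({0} : Set (Euc n)) X) (eucProd {0} Y)
      (EuclideanSpace.finAddEquivProd ⁻¹' ((fun x => (F x, x)) '' X))
      (EuclideanSpace.finAddEquivProd ⁻¹' ((fun x => (F x, x)) '' Y)) := by
  set J : Euc (n + m) ≃L[ℝ] Euc n × Euc m := EuclideanSpace.finAddEquivProd
  let S : unitInterval → (Euc n × Euc m ≃ₜ Euc n × Euc m) := fun t =>
    { toFun := fun p => (p.1 + (t : ℝ) • F p.2, p.2)
      invFun := fun p => (p.1 - (t : ℝ) • F p.2, p.2)
      left_inv := fun p => by simp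
      right_inv := fun p => by simp
      continuous_toFun := by fun_prop
      continuous_invFun := by fun_prop }
  have key : ∀ Z : Set (Euc m), (fun y => J.symm (S 1 (J y))) '' (eucProd ({0} : Set (Euc n)) Z) =
      J ⁻¹' ((fun x => (F x, x)) '' Z) := by
    intro Z
    ext y
    constructor
    · rintro ⟨y, hy, rfl⟩
      obtain ⟨h2, h1⟩ : (J y).1 = 0 ∧ (J y).2 ∈ Z := ⟨hy.1, hy.2⟩
      refine ⟨(J y).2, h1, ?_⟩
      simp [S, h2]
    · rintro ⟨x, hx, hxy⟩
      refine ⟨J.symm (0, x), ?_, ?_⟩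
      · change J (J.symm (0, x)) ∈ ({0} : Set (Euc n)) ×ˢ Z
        simp [hx]
      · have : J.symm (F x, x) = y := by simp [hxy]
        simpa [S] using this
  refine ⟨fun t => J.toHomeomorph.trans ((S t).trans J.symm.toHomeomorph), ?_, ?_, key X, key Y⟩
  · change Continuous fun p : unitInterval × Euc (n + m) =>
      J.symm ((J p.2).1 + (p.1 : ℝ) • F (J p.2).2, (J p.2).2)
    fun_prop
  · intro y
    change J.symm ((J y).1 + ((0 : unitInterval) : ℝ) • F (J y).2, (J y).2) = y
    simp

/-- A continuous map on a compact subset of `E^n` extends to all of `E^n`. -/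
theorem exists_extension_of_isCompact {n m : ℕ} {X : Set (Euc n)} (hX : IsCompact X)
    {f : X → Euc m} (hf : Continuous f) : ∃ F : C(Euc n, Euc m), ∀ x : X, F x = f x := by
  obtain ⟨F, hF⟩ := ContinuousMap.exists_restrict_eq hX.isClosed
    (⟨f, hf⟩ : C(X, Euc m))
  exact ⟨F, fun x => by simpa using DFunLike.congr_fun hF x⟩

/-- The values of a curvature map depend only on the homeomorphism type of a tame pair, not on its
embedding. Given a homeomorphism `f : X → X'`, the sets `X × {0}`, the graph of `f`, and
`{0} × X'` are isotopic in `E^(n+m)`, because `f` and its inverse extend to the ambient spaces;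
and the product with a point does not change the value. -/
theorem CurvatureMap.val_eq_of_homeomorphic (ρ : CurvatureMap) {n m : ℕ} {X Y : Set (Euc n)}
    {X' Y' : Set (Euc m)} (h : IsTamePair X Y) (hY' : Y' ⊆ X') (hh : PairHomeomorphic X Y X' Y') :
    ρ.val n X Y = ρ.val m X' Y' := by
  have h' : IsTamePair X' Y' := h.of_homeomorphic hY' hh.symm
  have hXc := h.isCompact
  have hXc' := h'.isCompact
  have hY := h.1
  obtain ⟨f, hf⟩ := hh
  have memY : ∀ x : X, (x : Euc n) ∈ Y ↔ (f x : Euc m) ∈ Y' := by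
    intro x
    have : f x ∈ f '' (Subtype.val ⁻¹' Y) ↔ f x ∈ (Subtype.val ⁻¹' Y' : Set X') := by rw [hf]
    simpa using this
  obtain ⟨F, hF⟩ := exists_extension_of_isCompact hXc (f := fun x => (f x : Euc m))
    (continuous_subtype_val.comp f.continuous)
  obtain ⟨G, hG⟩ := exists_extension_of_isCompact hXc' (f := fun x => (f.symm x : Euc n))
    (continuous_subtype_val.comp f.symm.continuous)
  set J : Euc (n + m) ≃L[ℝ] Euc n × Euc m := EuclideanSpace.finAddEquivProd with hJ
  set Γ : Set (Euc n) → Set (Euc (n + m)) := fun Z => J ⁻¹' ((fun x => (x, F x)) '' Z) with hΓ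
  have hGF : ∀ x ∈ X, G (F x) = x := by
    intro x hx
    rw [hF ⟨x, hx⟩, hG (f ⟨x, hx⟩)]
    simp
  have hgr : ∀ (Z : Set (Euc n)) (Z' : Set (Euc m)) , Z ⊆ X → Z' ⊆ X' →
      (∀ x : X, (x : Euc n) ∈ Z ↔ (f x : Euc m) ∈ Z') →
      J ⁻¹' ((fun x => (G x, x)) '' Z') = Γ Z := by
    intro Z Z' hZ hZ' hm
    refine congrArg _ ?_
    ext p
    constructor
    · rintro ⟨x', hx', rfl⟩
      have hx := hZ' hx'
      refine ⟨f.symm ⟨x', hx⟩, (hm _).2 (by simpa using hx'), ?_⟩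
      have h1 := hG ⟨x', hx⟩
      have h2 := hF (f.symm ⟨x', hx⟩)
      simp only [Homeomorph.apply_symm_apply] at h1 h2
      simp only [h1, h2]
    · rintro ⟨x, hx, rfl⟩
      refine ⟨F x, ?_, by simp [hGF x (hZ hx)]⟩
      rw [hF ⟨x, hZ hx⟩]
      exact (hm ⟨x, hZ hx⟩).1 hx
  -- the pairs `X × {0}`, the graph of `f`, and `{0} × X'` are tame
  have t1 : IsTamePair (eucProd X ({0} : Set (Euc m))) (eucProd Y {0}) := by
    refine h.of_homeomorphic (eucProd_subset hY subset_rfl) (PairHomeomorphic.symm ?_)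
    refine PairHomeomorphic.of_bijOn hXc (fun x => J.symm (x, 0)) (by fun_prop) ?_ ?_
    · refine ⟨fun x hx => ?_, fun x _ y _ hxy => ?_, fun z hz => ?_⟩
      · change J (J.symm (x, 0)) ∈ X ×ˢ {0}
        simpa using hx
      · simpa using hxy
      · obtain ⟨h1, h2⟩ : (J z).1 ∈ X ∧ (J z).2 = 0 := ⟨hz.1, hz.2⟩
        exact ⟨(J z).1, h1, by rw [← h2]; simp⟩
    · intro x _
      change _ ↔ J (J.symm (x, 0)) ∈ Y ×ˢ {0}
      simp
  have t3 : IsTamePair (eucProd ({0} : Set (Euc n)) X') (eucProd {0} Y') := by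
    refine h'.of_homeomorphic (eucProd_subset subset_rfl hY') (PairHomeomorphic.symm ?_)
    refine PairHomeomorphic.of_bijOn hXc' (fun x => J.symm (0, x)) (by fun_prop) ?_ ?_
    · refine ⟨fun x hx => ?_, fun x _ y _ hxy => ?_, fun z hz => ?_⟩
      · change J (J.symm (0, x)) ∈ ({0} : Set (Euc n)) ×ˢ X'
        simpa using hx
      · simpa using hxy
      · obtain ⟨h2, h1⟩ : (J z).1 = 0 ∧ (J z).2 ∈ X' := ⟨hz.1, hz.2⟩
        exact ⟨(J z).2, h1, by rw [← h2]; simp⟩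
    · intro x _
      change _ ↔ J (J.symm (0, x)) ∈ ({0} : Set (Euc n)) ×ˢ Y'
      simp
  have t2 : IsTamePair (Γ X) (Γ Y) := by
    refine h.of_homeomorphic (preimage_mono (image_mono hY)) (PairHomeomorphic.symm ?_)
    refine PairHomeomorphic.of_bijOn hXc (fun x => J.symm (x, F x)) (by fun_prop) ?_ ?_
    · refine ⟨fun x hx => ?_, fun x _ y _ hxy => ?_, fun z hz => ?_⟩
      · exact ⟨x, hx, by simp⟩
      · have := J.symm.injective hxy
        exact (Prod.ext_iff.1 this).1
      · obtain ⟨x, hx, hxz⟩ := hz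
        exact ⟨x, hx, by simp only at hxz ⊢; rw [hxz]; simp⟩
    · intro x _
      constructor
      · intro hx
        exact ⟨x, hx, by simp⟩
      · rintro ⟨y, hy, hxy⟩
        have : y = x := by simpa using congrArg Prod.fst hxy
        exact this ▸ hy
  have i1 := ρ.isotopy _ _ _ _ _ t1 t2 (isIsotopic_graph X Y F)
  have i3 := ρ.isotopy (n + m) _ _ (Γ X) (Γ Y) t3 t2 (by
    rw [← hgr X X' subset_rfl subset_rfl (fun x => by simp), ← hgr Y Y' hY hY' memY]
    exact isIsotopic_graph' X' Y' G)
  have m1 := ρ.mul n m X Y {0} ∅ h (isTamePair_singleton_empty 0)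
  have m3 := ρ.mul n m {0} ∅ X' Y' (isTamePair_singleton_empty 0) h'
  have e1 : eucProd X (∅ : Set (Euc m)) = ∅ := by simp [eucProd]
  have e2 : eucProd (∅ : Set (Euc n)) X' = ∅ := by simp [eucProd]
  rw [e1, empty_union, ρ.point_empty, mul_one] at m1
  rw [e2, union_empty, ρ.point_empty, one_mul] at m3
  rw [← m1, i1, ← i3, m3]

/-! ### Cubical model pairs -/

/-- The union of the coordinate orthants of `E^m` spanned by the members of `Δ`: the cone over the
abstract simplicial complex with vertices `0, …, m - 1` generated by `Δ`. -/
def coneComplex {m : ℕ} (Δ : Set (Finset (Fin m))) : Set (Euc m) :=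
  {c | (∀ i, 0 ≤ c i) ∧ ∃ σ ∈ Δ, ∀ i, c i ≠ 0 → i ∈ σ}

/-- The part of `coneComplex Δ` in the unit cube; a cubical complex. -/
def cubeSet {m : ℕ} (Δ : Set (Finset (Fin m))) : Set (Euc m) :=
  {c | c ∈ coneComplex Δ ∧ ∀ i, c i ≤ 1}

/-- The part of the outer boundary of `cubeSet Δ` where some coordinate with index in `S`
equals `1`. -/
def cubeFace {m : ℕ} (Δ : Set (Finset (Fin m))) (S : Set (Fin m)) : Set (Euc m) :=
  {c | c ∈ cubeSet Δ ∧ ∃ i ∈ S, c i = 1}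

/-- The value of a curvature map on a cubical model pair. -/
noncomputable def CurvatureMap.cubeVal (ρ : CurvatureMap) {m : ℕ} (Δ : Set (Finset (Fin m)))
    (S : Set (Fin m)) : ℝ :=
  ρ.val m (cubeSet Δ) (cubeFace Δ S)

theorem isPolytope_box {m : ℕ} (lo hi : Fin m → ℝ) (h : ∀ i, lo i ≤ hi i) :
    IsPolytope {c : Euc m | ∀ i, lo i ≤ c i ∧ c i ≤ hi i} := by
  refine ⟨(WithLp.linearEquiv 2 ℝ (Fin m → ℝ)).symm '' (Set.pi univ fun i => {lo i, hi i}),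
    (Set.Finite.pi fun i => (finite_singleton (hi i)).insert (lo i)).image _, ?_⟩
  have := LinearMap.image_convexHull (WithLp.linearEquiv 2 ℝ (Fin m → ℝ)).symm.toLinearMap
    (Set.pi univ fun i => ({lo i, hi i} : Set ℝ))
  simp only [LinearEquiv.coe_coe] at this
  rw [← this, convexHull_pi]
  ext c
  simp only [convexHull_pair, segment_eq_Icc (h _)]
  constructor
  · intro hc
    exact ⟨c.ofLp, fun i _ => hc i, rfl⟩
  · rintro ⟨d, hd, rfl⟩ i
    exact hd i (mem_univ i)

theorem isCompactPL_cubeSet {m : ℕ} (Δ : Set (Finset (Fin m))) : IsCompactPL (cubeSet Δ) := by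
  classical
  refine ⟨(fun σ : Finset (Fin m) => {c : Euc m | ∀ i, 0 ≤ c i ∧ c i ≤ if i ∈ σ then 1 else 0}) '' Δ,
    Δ.toFinite.image _, ?_, ?_⟩
  · rintro P ⟨σ, -, rfl⟩
    exact isPolytope_box _ _ fun i => by split_ifs <;> simp
  · ext c
    simp only [sUnion_image, mem_iUnion, exists_prop]
    constructor
    · rintro ⟨⟨h0, σ, hσ, hs⟩, h1⟩
      refine ⟨σ, hσ, fun i => ⟨h0 i, ?_⟩⟩
      split_ifs with hi
      · exact h1 i
      · exact le_of_eq (by_contra fun h => hi (hs i h))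
    · rintro ⟨σ, hσ, h⟩
      refine ⟨⟨fun i => (h i).1, σ, hσ, fun i hi => ?_⟩, fun i => (h i).2.trans ?_⟩
      · by_contra hn
        have := h i
        rw [if_neg hn] at this
        exact hi (le_antisymm this.2 this.1)
      · split_ifs <;> simp

theorem isCompactPL_cubeFace {m : ℕ} (Δ : Set (Finset (Fin m))) (S : Set (Fin m)) :
    IsCompactPL (cubeFace Δ S) := by
  classical
  refine ⟨(fun p : Finset (Fin m) × Fin m => {c : Euc m | ∀ i, (if i = p.2 then 1 else 0) ≤ c i ∧
      c i ≤ if i ∈ p.1 then 1 else 0}) '' {p | p.1 ∈ Δ ∧ p.2 ∈ S ∧ p.2 ∈ p.1},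
    (Set.toFinite _).image _, ?_, ?_⟩
  · rintro P ⟨⟨σ, j⟩, ⟨-, -, hj⟩, rfl⟩
    refine isPolytope_box _ _ fun i => ?_
    by_cases hij : i = j
    · subst hij; simp_all
    · simp only [if_neg hij]; split_ifs <;> simp
  · ext c
    simp only [sUnion_image, mem_iUnion, exists_prop]
    constructor
    · rintro ⟨⟨⟨h0, σ, hσ, hs⟩, h1⟩, j, hj, hcj⟩
      refine ⟨(σ, j), ⟨hσ, hj, hs j (by rw [hcj]; exact one_ne_zero)⟩, fun i => ⟨?_, ?_⟩⟩
      · split_ifs with hi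
        · rw [hi]
          exact hcj.ge
        · exact h0 i
      · dsimp only
        split_ifs with hi
        · exact h1 i
        · exact le_of_eq (by_contra fun h => hi (hs i h))
    · rintro ⟨⟨σ, j⟩, ⟨hσ, hj, hjσ⟩, h⟩
      dsimp only at *
      have h0 : ∀ i, 0 ≤ c i := fun i => le_trans (by split_ifs <;> simp) (h i).1
      have h1 : ∀ i, c i ≤ 1 := fun i => (h i).2.trans (by split_ifs <;> simp)
      refine ⟨⟨⟨h0, σ, hσ, fun i hi => ?_⟩, h1⟩, j, hj, le_antisymm (h1 j) ?_⟩
      · by_contra hn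
        have := (h i).2
        rw [if_neg hn] at this
        exact hi (le_antisymm this (h0 i))
      · simpa using (h j).1

theorem cubeFace_subset {m : ℕ} (Δ : Set (Finset (Fin m))) (S : Set (Fin m)) :
    cubeFace Δ S ⊆ cubeSet Δ := fun _ h => h.1

theorem isTamePair_cube {m : ℕ} (Δ : Set (Finset (Fin m))) (S : Set (Fin m)) :
    IsTamePair (cubeSet Δ) (cubeFace Δ S) :=
  ⟨cubeFace_subset Δ S, m, _, _, isCompactPL_cubeSet Δ, isCompactPL_cubeFace Δ S,
    cubeFace_subset Δ S, Homeomorph.refl _, by simp⟩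

/-- The join of two families of finite index sets. -/
def joinComplex {m₁ m₂ : ℕ} (Δ₁ : Set (Finset (Fin m₁))) (Δ₂ : Set (Finset (Fin m₂))) :
    Set (Finset (Fin (m₁ + m₂))) :=
  {τ | ∃ σ₁ ∈ Δ₁, ∃ σ₂ ∈ Δ₂,
    (∀ i, Fin.castAdd m₂ i ∈ τ ↔ i ∈ σ₁) ∧ ∀ i, Fin.natAdd m₁ i ∈ τ ↔ i ∈ σ₂}

theorem mem_coneComplex_join {m₁ m₂ : ℕ} {Δ₁ : Set (Finset (Fin m₁))}
    {Δ₂ : Set (Finset (Fin m₂))} {c : Euc (m₁ + m₂)} :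
    c ∈ coneComplex (joinComplex Δ₁ Δ₂) ↔
      WithLp.toLp 2 (fun i => c (Fin.castAdd m₂ i)) ∈ coneComplex Δ₁ ∧
      WithLp.toLp 2 (fun i => c (Fin.natAdd m₁ i)) ∈ coneComplex Δ₂ := by
  classical
  constructor
  · rintro ⟨h0, τ, ⟨σ₁, h₁, σ₂, h₂, e₁, e₂⟩, h⟩
    exact ⟨⟨fun i => h0 _, σ₁, h₁, fun i hi => (e₁ i).1 (h _ hi)⟩,
      ⟨fun i => h0 _, σ₂, h₂, fun i hi => (e₂ i).1 (h _ hi)⟩⟩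
  · rintro ⟨⟨h01, σ₁, h₁, k₁⟩, ⟨h02, σ₂, h₂, k₂⟩⟩
    let τ : Finset (Fin (m₁ + m₂)) := Finset.univ.filter fun i =>
      Fin.addCases (motive := fun _ => Prop) (fun i => i ∈ σ₁) (fun i => i ∈ σ₂) i
    have e₁ : ∀ i, Fin.castAdd m₂ i ∈ τ ↔ i ∈ σ₁ := fun i => by simp [τ]
    have e₂ : ∀ i, Fin.natAdd m₁ i ∈ τ ↔ i ∈ σ₂ := fun i => by simp [τ]
    refine ⟨fun i => Fin.addCases h01 h02 i, τ, ⟨σ₁, h₁, σ₂, h₂, e₁, e₂⟩, fun i => ?_⟩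
    refine Fin.addCases (fun i hi => (e₁ i).2 (k₁ i hi)) (fun i hi => (e₂ i).2 (k₂ i hi)) i

theorem mem_cubeSet_join {m₁ m₂ : ℕ} {Δ₁ : Set (Finset (Fin m₁))}
    {Δ₂ : Set (Finset (Fin m₂))} {c : Euc (m₁ + m₂)} :
    c ∈ cubeSet (joinComplex Δ₁ Δ₂) ↔
      WithLp.toLp 2 (fun i => c (Fin.castAdd m₂ i)) ∈ cubeSet Δ₁ ∧
      WithLp.toLp 2 (fun i => c (Fin.natAdd m₁ i)) ∈ cubeSet Δ₂ := by
  simp only [cubeSet, mem_ofPred_eq, mem_coneComplex_join]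
  constructor
  · rintro ⟨⟨h₁, h₂⟩, h⟩
    exact ⟨⟨h₁, fun i => h _⟩, h₂, fun i => h _⟩
  · rintro ⟨⟨h₁, k₁⟩, h₂, k₂⟩
    exact ⟨⟨h₁, h₂⟩, fun i => Fin.addCases k₁ k₂ i⟩

/-- The cubical pair of a join is exactly the product of the cubical pairs; hence the value of a
curvature map on it is the product of the values. -/
theorem CurvatureMap.cubeVal_join (ρ : CurvatureMap) {m₁ m₂ : ℕ} (Δ₁ : Set (Finset (Fin m₁)))
    (Δ₂ : Set (Finset (Fin m₂))) (S₁ : Set (Fin m₁)) (S₂ : Set (Fin m₂)) (S : Set (Fin (m₁ + m₂)))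
    (hS₁ : ∀ i, Fin.castAdd m₂ i ∈ S ↔ i ∈ S₁) (hS₂ : ∀ i, Fin.natAdd m₁ i ∈ S ↔ i ∈ S₂) :
    ρ.cubeVal (joinComplex Δ₁ Δ₂) S = ρ.cubeVal Δ₁ S₁ * ρ.cubeVal Δ₂ S₂ := by
  have h := ρ.mul m₁ m₂ _ _ _ _ (isTamePair_cube Δ₁ S₁) (isTamePair_cube Δ₂ S₂)
  have hJ : ∀ c : Euc (m₁ + m₂), (EuclideanSpace.finAddEquivProd c : Euc m₁ × Euc m₂) =
      (WithLp.toLp 2 (fun i => c (Fin.castAdd m₂ i)),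
        WithLp.toLp 2 (fun i => c (Fin.natAdd m₁ i))) := fun c => by ext <;> simp
  have mem : ∀ (A : Set (Euc m₁)) (B : Set (Euc m₂)) (c : Euc (m₁ + m₂)), c ∈ eucProd A B ↔
      WithLp.toLp 2 (fun i => c (Fin.castAdd m₂ i)) ∈ A ∧
      WithLp.toLp 2 (fun i => c (Fin.natAdd m₁ i)) ∈ B := by
    intro A B c
    rw [eucProd, mem_preimage, hJ, mem_prod]
  have e1 : cubeSet (joinComplex Δ₁ Δ₂) = eucProd (cubeSet Δ₁) (cubeSet Δ₂) := by
    ext c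
    rw [mem_cubeSet_join, mem]
  have e2 : cubeFace (joinComplex Δ₁ Δ₂) S =
      eucProd (cubeSet Δ₁) (cubeFace Δ₂ S₂) ∪ eucProd (cubeFace Δ₁ S₁) (cubeSet Δ₂) := by
    ext c
    simp only [cubeFace, mem_union, mem, mem_ofPred_eq, mem_cubeSet_join]
    constructor
    · rintro ⟨⟨h₁, h₂⟩, i, hi, hci⟩
      induction i using Fin.addCases with
      | left i => exact Or.inr ⟨⟨h₁, i, (hS₁ i).1 hi, hci⟩, h₂⟩
      | right i => exact Or.inl ⟨h₁, h₂, i, (hS₂ i).1 hi, hci⟩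
    · rintro (⟨h₁, h₂, i, hi, hci⟩ | ⟨⟨h₁, i, hi, hci⟩, h₂⟩)
      · exact ⟨⟨h₁, h₂⟩, _, (hS₂ i).2 hi, hci⟩
      · exact ⟨⟨h₁, h₂⟩, _, (hS₁ i).2 hi, hci⟩
  rw [CurvatureMap.cubeVal, e1, e2, h]
  rfl

/-! ### Rescaling the positive and the negative coordinates -/

/-- A quotient `g w / h` with `|g| ≤ K h` is continuous also where `h` vanishes, if `w` vanishes
there: it is bounded by `K |w|`, and its value is `0` there because `x / 0 = 0`. -/
theorem continuousOn_mul_div_of_le {X : Type*} [TopologicalSpace X] {s : Set X} {g w h : X → ℝ}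
    {K : ℝ} (hg : ContinuousOn g s) (hw : ContinuousOn w s) (hh : ContinuousOn h s)
    (hle : ∀ x ∈ s, |g x| ≤ K * h x) (h0 : ∀ x ∈ s, 0 ≤ h x)
    (hz : ∀ x ∈ s, h x = 0 → w x = 0) :
    ContinuousOn (fun x => g x * w x / h x) s := by
  intro x hx
  by_cases hx0 : h x = 0
  · have hval : g x * w x / h x = 0 := by rw [hx0, div_zero]
    rw [ContinuousWithinAt, hval]
    refine squeeze_zero_norm' (a := fun y => K * |w y|) ?_ ?_
    · filter_upwards [self_mem_nhdsWithin] with y hy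
      rw [Real.norm_eq_abs, abs_div, abs_mul, abs_of_nonneg (h0 y hy)]
      rcases (h0 y hy).eq_or_lt with hy0 | hy0
      · rw [← hy0, div_zero, hz y hy hy0.symm]; simp
      · rw [div_le_iff₀ hy0]
        calc |g y| * |w y| ≤ (K * h y) * |w y| := by
              gcongr
              exact hle y hy
          _ = K * |w y| * h y := by ring
    · have : Tendsto (fun y => K * |w y|) (𝓝[s] x) (𝓝 (K * |w x|)) :=
        ((hw x hx).abs).const_mul K
      rwa [hz x hx hx0, abs_zero, mul_zero] at this
  · exact ((hg x hx).mul (hw x hx)).div (hh x hx) hx0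

open Classical in
/-- Multiply the coordinates with index in `S` by `α`, and the others by `β`. -/
noncomputable def splitScale {m : ℕ} (S : Set (Fin m)) (α β : ℝ) (c : Fin m → ℝ) : Fin m → ℝ :=
  fun i => if i ∈ S then α * c i else β * c i

/-- A set of nonnegative coordinate vectors that contains with a vector all nonnegative vectors
of smaller support. -/
structure IsSupportClosed {m : ℕ} (M : Set (Fin m → ℝ)) : Prop where
  nonneg : ∀ c ∈ M, ∀ i, 0 ≤ c i
  mem_of_support : ∀ c ∈ M, ∀ d : Fin m → ℝ, (∀ i, 0 ≤ d i) → (∀ i, c i = 0 → d i = 0) → d ∈ M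

section SplitScale

variable {m : ℕ} {S : Set (Fin m)}

theorem splitScale_of_mem {i : Fin m} (hi : i ∈ S) (α β : ℝ) (c : Fin m → ℝ) :
    splitScale S α β c i = α * c i := if_pos hi

theorem splitScale_of_notMem {i : Fin m} (hi : i ∉ S) (α β : ℝ) (c : Fin m → ℝ) :
    splitScale S α β c i = β * c i := if_neg hi

theorem splitScale_splitScale (α β α' β' : ℝ) (c : Fin m → ℝ) :
    splitScale S α β (splitScale S α' β' c) = splitScale S (α * α') (β * β') c := by
  ext i
  by_cases hi : i ∈ S
  · simp only [splitScale_of_mem hi, mul_assoc]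
  · simp only [splitScale_of_notMem hi, mul_assoc]

theorem splitScale_smul (α β t : ℝ) (c : Fin m → ℝ) :
    splitScale S α β (t • c) = t • splitScale S α β c := by
  ext i
  by_cases hi : i ∈ S
  · simp only [splitScale_of_mem hi, Pi.smul_apply, smul_eq_mul]; ring
  · simp only [splitScale_of_notMem hi, Pi.smul_apply, smul_eq_mul]; ring

theorem splitScale_self (t : ℝ) (c : Fin m → ℝ) : splitScale S t t c = t • c := by
  ext i
  by_cases hi : i ∈ S
  · simp only [splitScale_of_mem hi, Pi.smul_apply, smul_eq_mul]
  · simp only [splitScale_of_notMem hi, Pi.smul_apply, smul_eq_mul]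

theorem continuous_splitScale_const (α β : ℝ) : Continuous (splitScale S α β) := by
  refine continuous_pi fun i => ?_
  by_cases hi : i ∈ S
  · simp only [splitScale_of_mem hi]; fun_prop
  · simp only [splitScale_of_notMem hi]; fun_prop

theorem IsSupportClosed.smul_mem {M : Set (Fin m → ℝ)} (hM : IsSupportClosed M) {c : Fin m → ℝ}
    (hc : c ∈ M) {t : ℝ} (ht : 0 ≤ t) : t • c ∈ M :=
  hM.mem_of_support c hc _ (fun i => mul_nonneg ht (hM.nonneg c hc i)) fun i hi => by simp [hi]

theorem IsSupportClosed.splitScale_mem {M : Set (Fin m → ℝ)} (hM : IsSupportClosed M)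
    {c : Fin m → ℝ} (hc : c ∈ M) {α β : ℝ} (hα : 0 ≤ α) (hβ : 0 ≤ β) :
    splitScale S α β c ∈ M := by
  refine hM.mem_of_support c hc _ (fun i => ?_) fun i h => ?_
  · by_cases hi : i ∈ S
    · rw [splitScale_of_mem hi]; exact mul_nonneg hα (hM.nonneg c hc i)
    · rw [splitScale_of_notMem hi]; exact mul_nonneg hβ (hM.nonneg c hc i)
  · by_cases hi : i ∈ S
    · rw [splitScale_of_mem hi, h, mul_zero]
    · rw [splitScale_of_notMem hi, h, mul_zero]

/-- The part of the weighted coordinate sum `∑ w i * c i` with indices in `S`. -/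
noncomputable def posSum (S : Set (Fin m)) (w c : Fin m → ℝ) : ℝ := ∑ i, w i * splitScale S 1 0 c i

/-- The part of the weighted coordinate sum `∑ w i * c i` with indices outside `S`. -/
noncomputable def negSum (S : Set (Fin m)) (w c : Fin m → ℝ) : ℝ := ∑ i, w i * splitScale S 0 1 c i

theorem posSum_splitScale (w : Fin m → ℝ) (α β : ℝ) (c : Fin m → ℝ) :
    posSum S w (splitScale S α β c) = α * posSum S w c := by
  unfold posSum
  rw [Finset.mul_sum]
  refine Finset.sum_congr rfl fun i _ => ?_
  by_cases hi : i ∈ S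
  · simp only [splitScale_of_mem hi]; ring
  · simp only [splitScale_of_notMem hi]; ring

theorem negSum_splitScale (w : Fin m → ℝ) (α β : ℝ) (c : Fin m → ℝ) :
    negSum S w (splitScale S α β c) = β * negSum S w c := by
  unfold negSum
  rw [Finset.mul_sum]
  refine Finset.sum_congr rfl fun i _ => ?_
  by_cases hi : i ∈ S
  · simp only [splitScale_of_mem hi]; ring
  · simp only [splitScale_of_notMem hi]; ring

theorem posSum_smul (w : Fin m → ℝ) (t : ℝ) (c : Fin m → ℝ) :
    posSum S w (t • c) = t * posSum S w c := by
  rw [← splitScale_self (S := S), posSum_splitScale]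

theorem negSum_smul (w : Fin m → ℝ) (t : ℝ) (c : Fin m → ℝ) :
    negSum S w (t • c) = t * negSum S w c := by
  rw [← splitScale_self (S := S), negSum_splitScale]

theorem continuous_posSum (w : Fin m → ℝ) : Continuous (posSum S w) :=
  continuous_finsetSum _ fun i _ =>
    continuous_const.mul ((continuous_apply i).comp (continuous_splitScale_const 1 0))

theorem continuous_negSum (w : Fin m → ℝ) : Continuous (negSum S w) :=
  continuous_finsetSum _ fun i _ =>
    continuous_const.mul ((continuous_apply i).comp (continuous_splitScale_const 0 1))

variable {w : Fin m → ℝ} (hw : ∀ i, 0 < w i)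
include hw

theorem posSum_nonneg {c : Fin m → ℝ} (hc : ∀ i, 0 ≤ c i) : 0 ≤ posSum S w c := by
  refine Finset.sum_nonneg fun i _ => mul_nonneg (hw i).le ?_
  by_cases hi : i ∈ S
  · simpa [splitScale_of_mem hi] using hc i
  · simp [splitScale_of_notMem hi]

theorem negSum_nonneg {c : Fin m → ℝ} (hc : ∀ i, 0 ≤ c i) : 0 ≤ negSum S w c := by
  refine Finset.sum_nonneg fun i _ => mul_nonneg (hw i).le ?_
  by_cases hi : i ∈ S
  · simp [splitScale_of_mem hi]
  · simpa [splitScale_of_notMem hi] using hc i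

theorem eq_zero_of_posSum {c : Fin m → ℝ} (hc : ∀ i, 0 ≤ c i) (h : posSum S w c = 0) {i : Fin m}
    (hi : i ∈ S) : c i = 0 := by
  have := (Finset.sum_eq_zero_iff_of_nonneg (fun j _ => mul_nonneg (hw j).le (by
    by_cases hj : j ∈ S
    · simpa [splitScale_of_mem hj] using hc j
    · simp [splitScale_of_notMem hj]))).1 h i (Finset.mem_univ i)
  rw [splitScale_of_mem hi, one_mul] at this
  exact (mul_eq_zero.1 this).resolve_left (hw i).ne'

theorem eq_zero_of_negSum {c : Fin m → ℝ} (hc : ∀ i, 0 ≤ c i) (h : negSum S w c = 0) {i : Fin m}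
    (hi : i ∉ S) : c i = 0 := by
  have := (Finset.sum_eq_zero_iff_of_nonneg (fun j _ => mul_nonneg (hw j).le (by
    by_cases hj : j ∈ S
    · simp [splitScale_of_mem hj]
    · simpa [splitScale_of_notMem hj] using hc j))).1 h i (Finset.mem_univ i)
  rw [splitScale_of_notMem hi, one_mul] at this
  exact (mul_eq_zero.1 this).resolve_left (hw i).ne'

end SplitScale

/-- The norm of the positive part, in the maximum norm. -/
noncomputable def posMax {m : ℕ} (S : Set (Fin m)) (c : Fin m → ℝ) : ℝ := ‖splitScale S 1 0 c‖

/-- The norm of the negative part, in the maximum norm. -/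
noncomputable def negMax {m : ℕ} (S : Set (Fin m)) (c : Fin m → ℝ) : ℝ := ‖splitScale S 0 1 c‖

section MaxSplit

variable {m : ℕ} {S : Set (Fin m)}

theorem posMax_nonneg (c : Fin m → ℝ) : 0 ≤ posMax S c := norm_nonneg _

theorem negMax_nonneg (c : Fin m → ℝ) : 0 ≤ negMax S c := norm_nonneg _

theorem posMax_splitScale {α : ℝ} (hα : 0 ≤ α) (β : ℝ) (c : Fin m → ℝ) :
    posMax S (splitScale S α β c) = α * posMax S c := by
  have : splitScale S 1 0 (splitScale S α β c) = α • splitScale S 1 0 c := by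
    ext i
    by_cases hi : i ∈ S
    · simp only [splitScale_of_mem hi, Pi.smul_apply, smul_eq_mul]; ring
    · simp only [splitScale_of_notMem hi, Pi.smul_apply, smul_eq_mul]; ring
  rw [posMax, this, norm_smul, Real.norm_of_nonneg hα, posMax]

theorem negMax_splitScale (α : ℝ) {β : ℝ} (hβ : 0 ≤ β) (c : Fin m → ℝ) :
    negMax S (splitScale S α β c) = β * negMax S c := by
  have : splitScale S 0 1 (splitScale S α β c) = β • splitScale S 0 1 c := by
    ext i
    by_cases hi : i ∈ S
    · simp only [splitScale_of_mem hi, Pi.smul_apply, smul_eq_mul]; ring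
    · simp only [splitScale_of_notMem hi, Pi.smul_apply, smul_eq_mul]; ring
  rw [negMax, this, norm_smul, Real.norm_of_nonneg hβ, negMax]

theorem abs_le_posMax {i : Fin m} (hi : i ∈ S) (c : Fin m → ℝ) : |c i| ≤ posMax S c := by
  have := norm_le_pi_norm (splitScale S 1 0 c) i
  rwa [splitScale_of_mem hi, one_mul] at this

theorem abs_le_negMax {i : Fin m} (hi : i ∉ S) (c : Fin m → ℝ) : |c i| ≤ negMax S c := by
  have := norm_le_pi_norm (splitScale S 0 1 c) i
  rwa [splitScale_of_notMem hi, one_mul] at this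

theorem posMax_eq_zero_iff {c : Fin m → ℝ} : posMax S c = 0 ↔ ∀ i ∈ S, c i = 0 := by
  rw [posMax, norm_eq_zero, funext_iff]
  refine forall_congr' fun i => ?_
  by_cases hi : i ∈ S
  · simp [splitScale_of_mem hi, hi]
  · simp [splitScale_of_notMem hi, hi]

theorem negMax_eq_zero_iff {c : Fin m → ℝ} : negMax S c = 0 ↔ ∀ i ∉ S, c i = 0 := by
  rw [negMax, norm_eq_zero, funext_iff]
  refine forall_congr' fun i => ?_
  by_cases hi : i ∈ S
  · simp [splitScale_of_mem hi, hi]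
  · simp [splitScale_of_notMem hi, hi]

theorem norm_eq_max (c : Fin m → ℝ) : ‖c‖ = max (posMax S c) (negMax S c) := by
  refine le_antisymm ?_ (max_le ?_ ?_)
  · refine (pi_norm_le_iff_of_nonneg (le_max_of_le_left (norm_nonneg _))).2 fun i => ?_
    by_cases hi : i ∈ S
    · exact le_max_of_le_left (abs_le_posMax hi c)
    · exact le_max_of_le_right (abs_le_negMax hi c)
  · refine (pi_norm_le_iff_of_nonneg (norm_nonneg _)).2 fun i => ?_
    by_cases hi : i ∈ S
    · rw [splitScale_of_mem hi, one_mul]; exact norm_le_pi_norm c i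
    · rw [splitScale_of_notMem hi]; simp
  · refine (pi_norm_le_iff_of_nonneg (norm_nonneg _)).2 fun i => ?_
    by_cases hi : i ∈ S
    · rw [splitScale_of_mem hi]; simp
    · rw [splitScale_of_notMem hi, one_mul]; exact norm_le_pi_norm c i

theorem continuous_posMax : Continuous (posMax S) := (continuous_splitScale_const 1 0).norm

theorem continuous_negMax : Continuous (negMax S) := (continuous_splitScale_const 0 1).norm

end MaxSplit

section SumToMax

variable {m : ℕ} {S : Set (Fin m)} {w : Fin m → ℝ}

/-- The change of scale on the positive and on the negative coordinates that turns the weighted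
sums of the coordinates into their maxima. -/
noncomputable def sumToMax (S : Set (Fin m)) (w c : Fin m → ℝ) : Fin m → ℝ :=
  splitScale S (posSum S w c / posMax S c) (negSum S w c / negMax S c) c

/-- The inverse of `sumToMax`. -/
noncomputable def maxToSum (S : Set (Fin m)) (w c : Fin m → ℝ) : Fin m → ℝ :=
  splitScale S (posMax S c / posSum S w c) (negMax S c / negSum S w c) c

theorem posMax_eq_zero_iff_posSum (hw : ∀ i, 0 < w i) {c : Fin m → ℝ} (hc : ∀ i, 0 ≤ c i) :
    posMax S c = 0 ↔ posSum S w c = 0 := by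
  rw [posMax_eq_zero_iff]
  constructor
  · intro h
    refine Finset.sum_eq_zero fun i _ => ?_
    by_cases hi : i ∈ S
    · rw [splitScale_of_mem hi, h i hi]; simp
    · rw [splitScale_of_notMem hi]; simp
  · exact fun h i hi => eq_zero_of_posSum hw hc h hi

theorem negMax_eq_zero_iff_negSum (hw : ∀ i, 0 < w i) {c : Fin m → ℝ} (hc : ∀ i, 0 ≤ c i) :
    negMax S c = 0 ↔ negSum S w c = 0 := by
  rw [negMax_eq_zero_iff]
  constructor
  · intro h
    refine Finset.sum_eq_zero fun i _ => ?_
    by_cases hi : i ∈ S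
    · rw [splitScale_of_mem hi]; simp
    · rw [splitScale_of_notMem hi, h i hi]; simp
  · exact fun h i hi => eq_zero_of_negSum hw hc h hi

theorem posMax_sumToMax (hw : ∀ i, 0 < w i) {c : Fin m → ℝ} (hc : ∀ i, 0 ≤ c i) :
    posMax S (sumToMax S w c) = posSum S w c := by
  rw [sumToMax, posMax_splitScale (div_nonneg (posSum_nonneg hw hc) (posMax_nonneg _))]
  by_cases h : posMax S c = 0
  · rw [h, (posMax_eq_zero_iff_posSum hw hc).1 h, mul_zero]
  · field_simp

theorem negMax_sumToMax (hw : ∀ i, 0 < w i) {c : Fin m → ℝ} (hc : ∀ i, 0 ≤ c i) :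
    negMax S (sumToMax S w c) = negSum S w c := by
  rw [sumToMax, negMax_splitScale _ (div_nonneg (negSum_nonneg hw hc) (negMax_nonneg _))]
  by_cases h : negMax S c = 0
  · rw [h, (negMax_eq_zero_iff_negSum hw hc).1 h, mul_zero]
  · field_simp

theorem sumToMax_smul {t : ℝ} (ht : 0 < t) (c : Fin m → ℝ) :
    sumToMax S w (t • c) = t • sumToMax S w c := by
  have h1 : posMax S (t • c) = t * posMax S c := by
    rw [← splitScale_self (S := S), posMax_splitScale ht.le]
  have h2 : negMax S (t • c) = t * negMax S c := by
    rw [← splitScale_self (S := S), negMax_splitScale _ ht.le]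
  rw [sumToMax, posSum_smul, negSum_smul, h1, h2, mul_div_mul_left _ _ ht.ne',
    mul_div_mul_left _ _ ht.ne', splitScale_smul, sumToMax]

theorem sumToMax_mem (hw : ∀ i, 0 < w i) {M : Set (Fin m → ℝ)} (hM : IsSupportClosed M)
    {c : Fin m → ℝ} (hc : c ∈ M) : sumToMax S w c ∈ M :=
  hM.splitScale_mem hc (div_nonneg (posSum_nonneg hw (hM.nonneg c hc)) (norm_nonneg _))
    (div_nonneg (negSum_nonneg hw (hM.nonneg c hc)) (norm_nonneg _))

theorem maxToSum_mem (hw : ∀ i, 0 < w i) {M : Set (Fin m → ℝ)} (hM : IsSupportClosed M)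
    {c : Fin m → ℝ} (hc : c ∈ M) : maxToSum S w c ∈ M :=
  hM.splitScale_mem hc (div_nonneg (norm_nonneg _) (posSum_nonneg hw (hM.nonneg c hc)))
    (div_nonneg (norm_nonneg _) (negSum_nonneg hw (hM.nonneg c hc)))

theorem maxToSum_sumToMax (hw : ∀ i, 0 < w i) {c : Fin m → ℝ} (hc : ∀ i, 0 ≤ c i) :
    maxToSum S w (sumToMax S w c) = c := by
  rw [maxToSum, posMax_sumToMax hw hc, negMax_sumToMax hw hc, sumToMax, posSum_splitScale,
    negSum_splitScale, splitScale_splitScale]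
  ext i
  by_cases hi : i ∈ S
  · rw [splitScale_of_mem hi]
    by_cases h : posSum S w c = 0
    · rw [eq_zero_of_posSum hw hc h hi, mul_zero]
    · have h' : posMax S c ≠ 0 := fun h'' => h ((posMax_eq_zero_iff_posSum hw hc).1 h'')
      field_simp
  · rw [splitScale_of_notMem hi]
    by_cases h : negSum S w c = 0
    · rw [eq_zero_of_negSum hw hc h hi, mul_zero]
    · have h' : negMax S c ≠ 0 := fun h'' => h ((negMax_eq_zero_iff_negSum hw hc).1 h'')
      field_simp

theorem sumToMax_maxToSum (hw : ∀ i, 0 < w i) {c : Fin m → ℝ} (hc : ∀ i, 0 ≤ c i) :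
    sumToMax S w (maxToSum S w c) = c := by
  rw [sumToMax, maxToSum, posSum_splitScale, negSum_splitScale,
    posMax_splitScale (div_nonneg (posMax_nonneg _) (posSum_nonneg hw hc)),
    negMax_splitScale _ (div_nonneg (negMax_nonneg _) (negSum_nonneg hw hc)), splitScale_splitScale]
  ext i
  by_cases hi : i ∈ S
  · rw [splitScale_of_mem hi]
    by_cases h : posSum S w c = 0
    · rw [eq_zero_of_posSum hw hc h hi, mul_zero]
    · have h' : posMax S c ≠ 0 := fun h'' => h ((posMax_eq_zero_iff_posSum hw hc).1 h'')
      field_simp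
  · rw [splitScale_of_notMem hi]
    by_cases h : negSum S w c = 0
    · rw [eq_zero_of_negSum hw hc h hi, mul_zero]
    · have h' : negMax S c ≠ 0 := fun h'' => h ((negMax_eq_zero_iff_negSum hw hc).1 h'')
      field_simp

theorem bijOn_sumToMax (hw : ∀ i, 0 < w i) {M : Set (Fin m → ℝ)} (hM : IsSupportClosed M) :
    BijOn (sumToMax S w) M M := by
  refine ⟨fun c hc => sumToMax_mem hw hM hc, fun c hc d hd h => ?_, fun c hc =>
    ⟨maxToSum S w c, maxToSum_mem hw hM hc, sumToMax_maxToSum hw (hM.nonneg c hc)⟩⟩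
  rw [← maxToSum_sumToMax (S := S) hw (hM.nonneg c hc), h,
    maxToSum_sumToMax hw (hM.nonneg d hd)]

theorem continuousOn_sumToMax (hw : ∀ i, 0 < w i) {M : Set (Fin m → ℝ)} (hM : IsSupportClosed M) :
    ContinuousOn (sumToMax S w) M := by
  refine continuousOn_pi.2 fun i => ?_
  by_cases hi : i ∈ S
  · have := continuousOn_mul_div_of_le (s := M) (g := fun c => c i) (w := posSum S w)
      (h := posMax S) (K := 1) (by fun_prop) (continuous_posSum w).continuousOn
      continuous_posMax.continuousOn (fun c _ => by rw [one_mul]; exact abs_le_posMax hi c)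
      (fun c _ => norm_nonneg _)
      (fun c hc h => (posMax_eq_zero_iff_posSum hw (hM.nonneg c hc)).1 h)
    refine this.congr fun c _ => ?_
    rw [sumToMax, splitScale_of_mem hi]; ring
  · have := continuousOn_mul_div_of_le (s := M) (g := fun c => c i) (w := negSum S w)
      (h := negMax S) (K := 1) (by fun_prop) (continuous_negSum w).continuousOn
      continuous_negMax.continuousOn (fun c _ => by rw [one_mul]; exact abs_le_negMax hi c)
      (fun c _ => norm_nonneg _)
      (fun c hc h => (negMax_eq_zero_iff_negSum hw (hM.nonneg c hc)).1 h)
    refine this.congr fun c _ => ?_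
    rw [sumToMax, splitScale_of_notMem hi]; ring

end SumToMax

section Tilt

variable {V : Type*} [NormedAddCommGroup V] [NormedSpace ℝ V] {m : ℕ} {S : Set (Fin m)}
  {w : Fin m → ℝ} {u : Fin m → V} {ε K : ℝ}

/-- The norm of the vector with coordinates `c` with respect to the family `u`. -/
noncomputable def comboNorm (u : Fin m → V) (c : Fin m → ℝ) : ℝ := ‖∑ i, c i • u i‖

/-- The amount by which `tilt` changes the scale at `c`. -/
noncomputable def tiltAmount (S : Set (Fin m)) (w : Fin m → ℝ) (u : Fin m → V) (ε : ℝ)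
    (c : Fin m → ℝ) : ℝ :=
  ε * comboNorm u c / (posSum S w c + negSum S w c)

/-- The map that scales the positive coordinates down and the negative ones up in such a way
that the difference of the weighted sums decreases by `ε` times the norm. -/
noncomputable def tilt (S : Set (Fin m)) (w : Fin m → ℝ) (u : Fin m → V) (ε : ℝ)
    (c : Fin m → ℝ) : Fin m → ℝ :=
  splitScale S (1 - tiltAmount S w u ε c) (1 + tiltAmount S w u ε c) c

theorem continuous_comboNorm (u : Fin m → V) : Continuous (comboNorm u) := by
  unfold comboNorm; fun_prop

theorem comboNorm_smul {t : ℝ} (ht : 0 ≤ t) (c : Fin m → ℝ) :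
    comboNorm u (t • c) = t * comboNorm u c := by
  simp only [comboNorm, Pi.smul_apply, smul_eq_mul, mul_smul, ← Finset.smul_sum]
  rw [norm_smul, Real.norm_of_nonneg ht]

theorem posSum_add_negSum (S : Set (Fin m)) (w c : Fin m → ℝ) :
    posSum S w c + negSum S w c = ∑ i, w i * c i := by
  rw [posSum, negSum, ← Finset.sum_add_distrib]
  refine Finset.sum_congr rfl fun i _ => ?_
  by_cases hi : i ∈ S
  · simp [splitScale_of_mem hi]
  · simp [splitScale_of_notMem hi]

theorem comboNorm_sub_le (hu : ∀ i, ‖u i‖ ≤ K * w i) (c d : Fin m → ℝ) :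
    comboNorm u d - comboNorm u c ≤ K * ∑ i, w i * |d i - c i| := by
  refine (norm_sub_norm_le _ _).trans ?_
  rw [← Finset.sum_sub_distrib, Finset.mul_sum]
  refine (norm_sum_le _ _).trans (Finset.sum_le_sum fun i _ => ?_)
  rw [← sub_smul, norm_smul, Real.norm_eq_abs]
  calc |d i - c i| * ‖u i‖ ≤ |d i - c i| * (K * w i) := by gcongr; exact hu i
    _ = K * (w i * |d i - c i|) := by ring

theorem comboNorm_le (hu : ∀ i, ‖u i‖ ≤ K * w i) {c : Fin m → ℝ} (hc : ∀ i, 0 ≤ c i) :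
    comboNorm u c ≤ K * (posSum S w c + negSum S w c) := by
  have := comboNorm_sub_le hu 0 c
  have h0 : comboNorm u (0 : Fin m → ℝ) = 0 := by simp [comboNorm]
  rw [h0, sub_zero] at this
  refine this.trans (le_of_eq ?_)
  rw [posSum_add_negSum]
  simp [abs_of_nonneg (hc _)]

variable (hw : ∀ i, 0 < w i) (hε : 0 ≤ ε) (hK : ε * K < 1) (hu : ∀ i, ‖u i‖ ≤ K * w i)
include hw hε

theorem tiltAmount_nonneg {c : Fin m → ℝ} (hc : ∀ i, 0 ≤ c i) : 0 ≤ tiltAmount S w u ε c :=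
  div_nonneg (mul_nonneg hε (norm_nonneg _)) (add_nonneg (posSum_nonneg hw hc) (negSum_nonneg hw hc))

include hu

omit hw hε in
/-- The defining equation of `tiltAmount`. It holds without assuming the denominator nonzero: when
the weighted sums vanish, so does the norm. -/
theorem tiltAmount_mul {c : Fin m → ℝ} (hc : ∀ i, 0 ≤ c i) :
    tiltAmount S w u ε c * (posSum S w c + negSum S w c) = ε * comboNorm u c := by
  unfold tiltAmount
  by_cases h : posSum S w c + negSum S w c = 0
  · have h1 := comboNorm_le (S := S) hu hc
    rw [h, mul_zero] at h1
    have h2 : comboNorm u c = 0 := le_antisymm h1 (norm_nonneg _)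
    rw [h, h2]; simp
  · field_simp

include hK

theorem tiltAmount_lt_one {c : Fin m → ℝ} (hc : ∀ i, 0 ≤ c i) : tiltAmount S w u ε c < 1 := by
  unfold tiltAmount
  have h0 := add_nonneg (posSum_nonneg (S := S) hw hc) (negSum_nonneg (S := S) hw hc)
  rcases h0.eq_or_lt with h | h
  · rw [← h, div_zero]; exact one_pos
  · rw [div_lt_one h]
    calc ε * comboNorm u c ≤ ε * (K * (posSum S w c + negSum S w c)) := by
          gcongr; exact comboNorm_le hu hc
      _ = (ε * K) * (posSum S w c + negSum S w c) := by ring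
      _ < 1 * (posSum S w c + negSum S w c) := by gcongr
      _ = _ := one_mul _

omit hw hε hK hu in
theorem tiltAmount_smul {t : ℝ} (ht : 0 < t) (c : Fin m → ℝ) :
    tiltAmount S w u ε (t • c) = tiltAmount S w u ε c := by
  rw [tiltAmount, comboNorm_smul ht.le, posSum_smul, negSum_smul, ← mul_add, mul_left_comm,
    mul_div_mul_left _ _ ht.ne', tiltAmount]

omit hw hε hK hu in
theorem tilt_smul {t : ℝ} (ht : 0 < t) (c : Fin m → ℝ) :
    tilt S w u ε (t • c) = t • tilt S w u ε c := by
  rw [tilt, tiltAmount_smul ht, splitScale_smul, tilt]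

theorem tilt_mem {M : Set (Fin m → ℝ)} (hM : IsSupportClosed M) {c : Fin m → ℝ} (hc : c ∈ M) :
    tilt S w u ε c ∈ M := by
  have h1 := tiltAmount_nonneg (S := S) (u := u) hw hε (hM.nonneg c hc)
  have h2 := tiltAmount_lt_one (S := S) hw hε hK hu (hM.nonneg c hc)
  exact hM.splitScale_mem hc (by linarith) (by linarith)

omit hw hε hK in
theorem posSum_sub_negSum_tilt {c : Fin m → ℝ} (hc : ∀ i, 0 ≤ c i) :
    posSum S w (tilt S w u ε c) - negSum S w (tilt S w u ε c) =
      posSum S w c - negSum S w c - ε * comboNorm u c := by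
  rw [tilt, posSum_splitScale, negSum_splitScale, ← tiltAmount_mul (S := S) hu hc]
  ring

/-- Two points with the same image under `tilt` cannot have different scales. Where the scale is
larger, the positive coordinates are larger and the negative ones smaller; the difference of the
weighted sums then increases by more than `ε` times the change of the norm, as `ε * K < 1`. -/
theorem tilt_injective_aux {c d : Fin m → ℝ} (hc : ∀ i, 0 ≤ c i) (hd : ∀ i, 0 ≤ d i)
    (h : tilt S w u ε c = tilt S w u ε d)
    (hlt : tiltAmount S w u ε c < tiltAmount S w u ε d) : False := by
  set η := tiltAmount S w u ε c with hη
  set η' := tiltAmount S w u ε d with hη'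
  have h0 : 0 ≤ η := tiltAmount_nonneg hw hε hc
  have h1 : η' < 1 := tiltAmount_lt_one hw hε hK hu hd
  -- the positive coordinates of `d` are larger than those of `c`, the negative ones smaller
  have hpos : ∀ i ∈ S, (1 - η) * c i = (1 - η') * d i := by
    intro i hi
    have := congrFun h i
    rwa [tilt, tilt, splitScale_of_mem hi, splitScale_of_mem hi] at this
  have hneg : ∀ i ∉ S, (1 + η) * c i = (1 + η') * d i := by
    intro i hi
    have := congrFun h i
    rwa [tilt, tilt, splitScale_of_notMem hi, splitScale_of_notMem hi] at this
  have hpos' : ∀ i ∈ S, c i ≤ d i := by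
    intro i hi
    have := hpos i hi
    have h3 : (1 - η') * c i ≤ (1 - η) * c i :=
      mul_le_mul_of_nonneg_right (by linarith) (hc i)
    exact le_of_mul_le_mul_left (h3.trans this.le) (by linarith)
  have hneg' : ∀ i ∉ S, d i ≤ c i := by
    intro i hi
    have := hneg i hi
    have h3 : (1 + η) * c i ≤ (1 + η') * c i :=
      mul_le_mul_of_nonneg_right (by linarith) (hc i)
    exact le_of_mul_le_mul_left (this.symm.le.trans h3) (by linarith)
  set P := posSum S w
  set Q := negSum S w
  have hsum : ∑ i, w i * |d i - c i| = (P d - P c) + (Q c - Q d) := by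
    simp only [P, Q, posSum, negSum, ← Finset.sum_sub_distrib, ← Finset.sum_add_distrib]
    refine Finset.sum_congr rfl fun i _ => ?_
    by_cases hi : i ∈ S
    · simp only [splitScale_of_mem hi]
      rw [abs_of_nonneg (sub_nonneg.2 (hpos' i hi))]; ring
    · simp only [splitScale_of_notMem hi]
      rw [abs_of_nonpos (sub_nonpos.2 (hneg' i hi))]; ring
  have e1 := posSum_sub_negSum_tilt (S := S) (ε := ε) hu hc
  have e2 := posSum_sub_negSum_tilt (S := S) (ε := ε) hu hd
  rw [h, e2] at e1
  have e3 : (P d - P c) + (Q c - Q d) ≤ ε * K * ((P d - P c) + (Q c - Q d)) := by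
    have := mul_le_mul_of_nonneg_left (comboNorm_sub_le hu c d) hε
    rw [hsum] at this
    linarith
  have e4 : 0 ≤ (P d - P c) + (Q c - Q d) := by
    rw [← hsum]
    exact Finset.sum_nonneg fun i _ => mul_nonneg (hw i).le (abs_nonneg _)
  have e5 : ∑ i, w i * |d i - c i| = 0 := by
    rw [hsum]
    nlinarith
  have e6 : d = c := by
    ext i
    have := (Finset.sum_eq_zero_iff_of_nonneg
      (fun j _ => mul_nonneg (hw j).le (abs_nonneg (d j - c j)))).1 e5 i (Finset.mem_univ i)
    have := (mul_eq_zero.1 this).resolve_left (hw i).ne'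
    exact sub_eq_zero.1 (abs_eq_zero.1 this)
  exact hlt.ne (by rw [hη, hη', e6])

/-- `tilt` is injective because the difference of the weighted sums minus `ε` times the norm
is strictly increasing in the positive and strictly decreasing in the negative coordinates. -/
theorem tilt_injOn {M : Set (Fin m → ℝ)} (hM : IsSupportClosed M) : InjOn (tilt S w u ε) M := by
  intro c hc d hd h
  have hc0 := hM.nonneg c hc
  have hd0 := hM.nonneg d hd
  have h0 := tiltAmount_nonneg (S := S) (u := u) hw hε hc0
  have h1 := tiltAmount_lt_one (S := S) hw hε hK hu hc0
  rcases lt_trichotomy (tiltAmount S w u ε c) (tiltAmount S w u ε d) with hlt | heq | hlt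
  · exact (tilt_injective_aux hw hε hK hu hc0 hd0 h hlt).elim
  · rw [tilt, tilt, ← heq] at h
    ext i
    have := congrFun h i
    by_cases hi : i ∈ S
    · rw [splitScale_of_mem hi, splitScale_of_mem hi] at this
      exact mul_left_cancel₀ (by linarith) this
    · rw [splitScale_of_notMem hi, splitScale_of_notMem hi] at this
      exact mul_left_cancel₀ (by linarith) this
  · exact (tilt_injective_aux hw hε hK hu hd0 hc0 h.symm hlt).elim

/-- A point `e` with positive and negative parts `e⁺`, `e⁻` is, up to a positive factor, the image
of some `t e⁺ + (1 - t) e⁻`, by the intermediate value theorem. -/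
theorem tilt_surjOn {M : Set (Fin m → ℝ)} (hM : IsSupportClosed M) :
    SurjOn (tilt S w u ε) M M := by
  intro e he
  have he0 := hM.nonneg e he
  have h0 := tiltAmount_nonneg (S := S) (u := u) hw hε he0
  have h1 := tiltAmount_lt_one (S := S) hw hε hK hu he0
  have hP := posSum_nonneg (S := S) hw he0
  have hQ := negSum_nonneg (S := S) hw he0
  -- if one of the parts is missing, `tilt` is multiplication by a constant on the ray of `e`
  rcases hP.eq_or_lt with hP0 | hP0
  · refine ⟨(1 + tiltAmount S w u ε e)⁻¹ • e, hM.smul_mem he (by positivity), ?_⟩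
    rw [tilt_smul (by positivity)]
    ext i
    by_cases hi : i ∈ S
    · rw [Pi.smul_apply, tilt, splitScale_of_mem hi, eq_zero_of_posSum hw he0 hP0.symm hi]; simp
    · rw [Pi.smul_apply, tilt, splitScale_of_notMem hi, smul_eq_mul]
      have : 1 + tiltAmount S w u ε e ≠ 0 := by positivity
      field_simp
  rcases hQ.eq_or_lt with hQ0 | hQ0
  · have h2 : 0 < 1 - tiltAmount S w u ε e := by linarith
    refine ⟨(1 - tiltAmount S w u ε e)⁻¹ • e, hM.smul_mem he (by positivity), ?_⟩
    rw [tilt_smul (by positivity)]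
    ext i
    by_cases hi : i ∈ S
    · rw [Pi.smul_apply, tilt, splitScale_of_mem hi, smul_eq_mul]
      field_simp
    · rw [Pi.smul_apply, tilt, splitScale_of_notMem hi, eq_zero_of_negSum hw he0 hQ0.symm hi]; simp
  -- both parts are present: find the right ratio on the segment joining them
  let c : ℝ → Fin m → ℝ := fun t => splitScale S t (1 - t) e
  have hcM : ∀ t ∈ Icc (0 : ℝ) 1, c t ∈ M := fun t ht =>
    hM.splitScale_mem he ht.1 (by linarith [ht.2])
  have hcc : Continuous c := by
    refine continuous_pi fun i => ?_
    by_cases hi : i ∈ S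
    · simp only [c, splitScale_of_mem hi]; fun_prop
    · simp only [c, splitScale_of_notMem hi]; fun_prop
  let η : ℝ → ℝ := fun t => tiltAmount S w u ε (c t)
  have hη : ContinuousOn η (Icc 0 1) := by
    refine ContinuousOn.div ?_ ?_ ?_
    · exact (continuous_const.mul ((continuous_comboNorm u).comp hcc)).continuousOn
    · exact (((continuous_posSum w).comp hcc).add ((continuous_negSum w).comp hcc)).continuousOn
    · intro t ht
      simp only [c, posSum_splitScale, negSum_splitScale]
      have : 0 ≤ t * posSum S w e := mul_nonneg ht.1 hP
      have : 0 ≤ (1 - t) * negSum S w e := mul_nonneg (by linarith [ht.2]) hQ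
      intro h
      have h3 : t * posSum S w e = 0 := by linarith
      have h4 : (1 - t) * negSum S w e = 0 := by linarith
      have h5 := (mul_eq_zero.1 h3).resolve_right hP0.ne'
      have h6 := (mul_eq_zero.1 h4).resolve_right hQ0.ne'
      linarith
  have hη0 : ∀ t ∈ Icc (0 : ℝ) 1, 0 ≤ η t := fun t ht =>
    tiltAmount_nonneg hw hε (hM.nonneg _ (hcM t ht))
  have hη1 : ∀ t ∈ Icc (0 : ℝ) 1, η t < 1 := fun t ht =>
    tiltAmount_lt_one hw hε hK hu (hM.nonneg _ (hcM t ht))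
  let g : ℝ → ℝ := fun t => (1 - η t) * t - (1 + η t) * (1 - t)
  have hg : ContinuousOn g (Icc 0 1) := by fun_prop
  obtain ⟨t, ht, hgt⟩ : (0 : ℝ) ∈ g '' Icc 0 1 := by
    refine intermediate_value_Icc zero_le_one hg ⟨?_, ?_⟩
    · have := hη0 0 (by simp)
      simp only [g]; linarith
    · have := hη1 1 (by simp)
      simp only [g]; linarith
  have hgt' : (1 - η t) * t = (1 + η t) * (1 - t) := by simp only [g] at hgt; linarith
  have a0 := hη0 t ht
  have a1 := hη1 t ht
  have ht0 : 0 < t := by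
    rcases ht.1.eq_or_lt with h | h
    · rw [← h] at hgt' a0 a1; linarith
    · exact h
  have hμ : 0 < (1 - η t) * t := mul_pos (by linarith) ht0
  refine ⟨((1 - η t) * t)⁻¹ • c t, hM.smul_mem (hcM t ht) (by positivity), ?_⟩
  rw [tilt_smul (by positivity)]
  change ((1 - η t) * t)⁻¹ • splitScale S (1 - η t) (1 + η t) (splitScale S t (1 - t) e) = e
  rw [splitScale_splitScale, ← hgt', splitScale_self, smul_smul, inv_mul_cancel₀ hμ.ne', one_smul]

omit hε hK in
theorem continuousOn_tilt {M : Set (Fin m → ℝ)} (hM : IsSupportClosed M) :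
    ContinuousOn (tilt S w u ε) M := by
  refine continuousOn_pi.2 fun i => ?_
  have := continuousOn_mul_div_of_le (s := M) (g := comboNorm u) (w := fun c => c i)
      (h := fun c => posSum S w c + negSum S w c) (K := K)
      (continuous_comboNorm u).continuousOn (by fun_prop)
      ((continuous_posSum w).add (continuous_negSum w)).continuousOn
      (fun c hc => by
        rw [abs_of_nonneg (show 0 ≤ comboNorm u c from norm_nonneg _)]
        exact comboNorm_le hu (hM.nonneg c hc))
      (fun c hc => add_nonneg (posSum_nonneg hw (hM.nonneg c hc))
        (negSum_nonneg hw (hM.nonneg c hc)))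
      (fun c hc h => by
        have h1 := posSum_nonneg (S := S) hw (hM.nonneg c hc)
        have h2 := negSum_nonneg (S := S) hw (hM.nonneg c hc)
        by_cases hi : i ∈ S
        · exact eq_zero_of_posSum hw (hM.nonneg c hc) (by linarith) hi
        · exact eq_zero_of_negSum hw (hM.nonneg c hc) (by linarith) hi)
  have hci : ContinuousOn (fun c : Fin m → ℝ => c i) M := by fun_prop
  by_cases hi : i ∈ S
  · refine (hci.sub (this.const_smul ε)).congr fun c _ => ?_
    rw [tilt, splitScale_of_mem hi, tiltAmount]
    change (1 - _) * _ = c i - ε * (comboNorm u c * c i / (posSum S w c + negSum S w c))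
    ring
  · refine (hci.add (this.const_smul ε)).congr fun c _ => ?_
    rw [tilt, splitScale_of_notMem hi, tiltAmount]
    change (1 + _) * _ = c i + ε * (comboNorm u c * c i / (posSum S w c + negSum S w c))
    ring

/-- There is a homogeneous homeomorphism of `M` after which the sign of
`posSum - negSum - ε * norm` is the sign of `posMax - negMax`. -/
theorem exists_homogeneous_bijOn {M : Set (Fin m → ℝ)} (hM : IsSupportClosed M) :
    ∃ Ω : (Fin m → ℝ) → (Fin m → ℝ), BijOn Ω M M ∧ ContinuousOn Ω M ∧
      (∀ t : ℝ, 0 < t → ∀ c, Ω (t • c) = t • Ω c) ∧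
      ∀ c ∈ M, negMax S (Ω c) ≤ posMax S (Ω c) ↔
        ε * comboNorm u c ≤ posSum S w c - negSum S w c := by
  have hb : BijOn (tilt S w u ε) M M :=
    ⟨fun c hc => tilt_mem hw hε hK hu hM hc, tilt_injOn hw hε hK hu hM,
      tilt_surjOn hw hε hK hu hM⟩
  refine ⟨sumToMax S w ∘ tilt S w u ε, (bijOn_sumToMax hw hM).comp hb,
    (continuousOn_sumToMax hw hM).comp (continuousOn_tilt hw hu hM) hb.mapsTo,
    fun t ht c => ?_, fun c hc => ?_⟩
  · simp only [Function.comp_apply, tilt_smul ht, sumToMax_smul ht]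
  · have := hM.nonneg _ (hb.mapsTo hc)
    simp only [Function.comp_apply]
    rw [posMax_sumToMax hw this, negMax_sumToMax hw this, ← sub_nonneg,
      posSum_sub_negSum_tilt (ε := ε) hu (hM.nonneg c hc), sub_nonneg]

end Tilt

/-! ### The cone and link of a simplicial cone -/

/-- Two continuous bijections from the same compact space give a homeomorphism of pairs. -/
theorem PairHomeomorphic.of_bijOn_of_bijOn {Z : Type*} [TopologicalSpace Z] {D : Set Z}
    (hD : IsCompact D) {n m : ℕ} {X Y : Set (Euc n)} {X' Y' : Set (Euc m)}
    (f : Z → Euc n) (g : Z → Euc m) (hf : ContinuousOn f D) (hg : ContinuousOn g D)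
    (hfb : BijOn f D X) (hgb : BijOn g D X') (hY : ∀ z ∈ D, f z ∈ Y ↔ g z ∈ Y') :
    PairHomeomorphic X Y X' Y' := by
  have := isCompact_iff_compactSpace.mp hD
  have hfc : Continuous (hfb.equiv f) :=
    (continuousOn_iff_continuous_domRestrict.mp hf).subtype_mk _
  have hgc : Continuous (hgb.equiv g) :=
    (continuousOn_iff_continuous_domRestrict.mp hg).subtype_mk _
  let F := hfc.homeoOfEquivCompactToT2
  let G := hgc.homeoOfEquivCompactToT2
  refine ⟨F.symm.trans G, ?_⟩
  ext y
  constructor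
  · rintro ⟨x, hx, rfl⟩
    obtain ⟨z, rfl⟩ := F.surjective x
    simp only [Homeomorph.trans_apply, Homeomorph.symm_apply_apply]
    exact (hY z z.2).1 hx
  · intro hy
    obtain ⟨z, rfl⟩ := G.surjective y
    exact ⟨F z, (hY z z.2).2 hy, by simp⟩

theorem isClosed_coneComplex {m : ℕ} (Δ : Set (Finset (Fin m))) : IsClosed (coneComplex Δ) := by
  have : coneComplex Δ = ⋃ σ ∈ Δ, {c : Euc m | ∀ i, 0 ≤ c i ∧ (i ∉ σ → c i = 0)} := by
    ext c
    simp only [coneComplex, mem_ofPred_eq, mem_iUnion, exists_prop]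
    constructor
    · rintro ⟨h0, σ, hσ, h⟩
      exact ⟨σ, hσ, fun i => ⟨h0 i, fun hi => by_contra fun hc => hi (h i hc)⟩⟩
    · rintro ⟨σ, hσ, h⟩
      exact ⟨fun i => (h i).1, σ, hσ, fun i hc => by_contra fun hi => hc ((h i).2 hi)⟩
  rw [this]
  refine Δ.toFinite.isClosed_biUnion fun σ _ => ?_
  simp only [ofPred_forall]
  refine isClosed_iInter fun i => ?_
  rw [ofPred_and]
  refine (isClosed_le continuous_const (by fun_prop)).inter ?_
  by_cases hi : i ∈ σ
  · simp [hi]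
  · simp only [hi, not_false_eq_true, forall_true_left]
    exact isClosed_eq (by fun_prop) continuous_const

theorem isSupportClosed_coneComplex {m : ℕ} (Δ : Set (Finset (Fin m))) :
    IsSupportClosed {c : Fin m → ℝ | WithLp.toLp 2 c ∈ coneComplex Δ} where
  nonneg c hc i := hc.1 i
  mem_of_support := by
    rintro c ⟨-, σ, hσ, h⟩ d hd hcd
    exact ⟨hd, σ, hσ, fun i hi => h i fun hc => hi (hcd i hc)⟩

/-- A family of vectors parametrizes its cone complex bijectively. -/
def IsSimplicialFan {V : Type*} [AddCommGroup V] [Module ℝ V] {m : ℕ} (u : Fin m → V)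
    (Δ : Set (Finset (Fin m))) : Prop :=
  ∀ c ∈ coneComplex Δ, ∀ d ∈ coneComplex Δ, ∑ i, c i • u i = ∑ i, d i • u i → c = d

/-- The union of the simplicial cones spanned by the subfamilies of `u` with indices in `Δ`. -/
def fanSet {V : Type*} [AddCommGroup V] [Module ℝ V] {m : ℕ} (u : Fin m → V)
    (Δ : Set (Finset (Fin m))) : Set V :=
  {y | ∃ c ∈ coneComplex Δ, ∑ i, c i • u i = y}

/-- The linear map given by the spanning vectors is injective on the cone complex, so its norm is
bounded below on the compact set of vectors of norm one of the complex. -/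
theorem IsSimplicialFan.exists_comboNorm_ge {V : Type*} [NormedAddCommGroup V] [NormedSpace ℝ V]
    {m : ℕ} {u : Fin m → V} {Δ : Set (Finset (Fin m))} (h : IsSimplicialFan u Δ) :
    ∃ κ > 0, ∀ c : Fin m → ℝ, WithLp.toLp 2 c ∈ coneComplex Δ → κ * ‖c‖ ≤ comboNorm u c := by
  set M := {c : Fin m → ℝ | WithLp.toLp 2 c ∈ coneComplex Δ} with hMdef
  have hM : IsSupportClosed M := isSupportClosed_coneComplex Δ
  have hMc : IsClosed M := (isClosed_coneComplex Δ).preimage (by fun_prop)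
  have hcomp : IsCompact (M ∩ Metric.sphere 0 1) := (isCompact_sphere 0 1).inter_left hMc
  rcases (M ∩ Metric.sphere (0 : Fin m → ℝ) 1).eq_empty_or_nonempty with he | hne
  · refine ⟨1, one_pos, fun c hc => ?_⟩
    by_cases h0 : c = 0
    · subst h0; simp [comboNorm]
    · exfalso
      have : ‖c‖⁻¹ • c ∈ M ∩ Metric.sphere (0 : Fin m → ℝ) 1 :=
        ⟨hM.smul_mem hc (by positivity), by simp [norm_smul, h0]⟩
      rw [he] at this
      exact this
  · obtain ⟨c₀, hc₀, hmin⟩ := hcomp.exists_isMinOn hne (continuous_comboNorm u).continuousOn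
    have hc₀0 : c₀ ≠ 0 := by
      rintro rfl
      have := hc₀.2
      simp at this
    refine ⟨comboNorm u c₀, ?_, fun c hc => ?_⟩
    · refine (norm_nonneg _).lt_of_ne' fun h0 => hc₀0 ?_
      have h1 : (0 : Fin m → ℝ) ∈ M := by simpa using hM.smul_mem hc₀.1 le_rfl
      have := h _ hc₀.1 _ h1 (by
        have : ∑ i, c₀ i • u i = 0 := norm_eq_zero.1 h0
        simpa using this)
      exact WithLp.toLp_injective 2 this
    · by_cases h0 : c = 0
      · subst h0; simp [comboNorm]
      · have h1 : ‖c‖⁻¹ • c ∈ M ∩ Metric.sphere (0 : Fin m → ℝ) 1 :=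
          ⟨hM.smul_mem hc (by positivity), by simp [norm_smul, h0]⟩
        have h2 : comboNorm u c₀ ≤ comboNorm u (‖c‖⁻¹ • c) := hmin h1
        rw [comboNorm_smul (by positivity)] at h2
        have h3 : 0 < ‖c‖ := norm_pos_iff.2 h0
        calc comboNorm u c₀ * ‖c‖ ≤ (‖c‖⁻¹ * comboNorm u c) * ‖c‖ := by gcongr
          _ = comboNorm u c := by field_simp

/-- Near a point where `X` is a simplicial cone and for a direction `a` which is not orthogonal to
any of the spanning vectors, the cone and link of `X` form a pair homeomorphic to a cubical
pair. The set `|ℓ| ≤ δ`, `N ≤ r` in the cone, where `ℓ` is the linear form of `a` and `N` the norm,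
is starshaped with gauge `G = max (N / r) (|ℓ| / δ)`, and the link is the part of its boundary
`G = 1` where `ℓ ≥ (δ / r) N`. A homogeneous homeomorphism straightens this part, and a radial one
turns `G` into the maximum of the coordinates. -/
theorem pairHomeomorphic_coneAt_cube {n m : ℕ} {u : Fin m → Euc n} {Δ : Set (Finset (Fin m))}
    (hu : IsSimplicialFan u Δ) {a : Euc n} (ha : ∀ i, inner ℝ (u i) a ≠ 0) :
    ∃ ε₀ > 0, ∀ (X : Set (Euc n)) (x : Euc n) (r δ : ℝ), 0 < r → 0 < δ → δ < ε₀ * r →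
      (∀ y, ‖y - x‖ ≤ r → (y ∈ X ↔ y - x ∈ fanSet u Δ)) →
      PairHomeomorphic (cubeSet Δ) (cubeFace Δ {i | 0 < inner ℝ (u i) a})
        (coneAt X x a r δ) (linkAt X x a r δ) := by
  set S : Set (Fin m) := {i | 0 < inner ℝ (u i) a} with hS
  set w : Fin m → ℝ := fun i => |inner ℝ (u i) a| with hwdef
  have hw : ∀ i, 0 < w i := fun i => abs_pos.2 (ha i)
  -- with `ε = δ / r < (K + 1)⁻¹` the condition `ε * K < 1` of `exists_homogeneous_bijOn` holds
  set K : ℝ := ∑ i, ‖u i‖ / w i with hKdef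
  have hK0 : 0 ≤ K := Finset.sum_nonneg fun i _ => div_nonneg (norm_nonneg _) (hw i).le
  have huK : ∀ i, ‖u i‖ ≤ K * w i := by
    intro i
    rw [← div_le_iff₀ (hw i)]
    exact Finset.single_le_sum (f := fun i => ‖u i‖ / w i)
      (fun i _ => div_nonneg (norm_nonneg _) (hw i).le) (Finset.mem_univ i)
  obtain ⟨κ, hκ, hκM⟩ := hu.exists_comboNorm_ge
  set M := {c : Fin m → ℝ | WithLp.toLp 2 c ∈ coneComplex Δ} with hMdef
  have hM : IsSupportClosed M := isSupportClosed_coneComplex Δ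
  have hMc : IsClosed M := (isClosed_coneComplex Δ).preimage (by fun_prop)
  refine ⟨(K + 1)⁻¹, by positivity, fun X x r δ hr hδ hδr hX => ?_⟩
  set ε := δ / r with hεdef
  have hε : 0 < ε := div_pos hδ hr
  have hεK : ε * K < 1 := by
    have h1 : ε < (K + 1)⁻¹ := by rwa [hεdef, div_lt_iff₀ hr]
    calc ε * K ≤ ε * (K + 1) := by gcongr; linarith
      _ < (K + 1)⁻¹ * (K + 1) := by gcongr
      _ = 1 := by field_simp
  obtain ⟨Ω, hΩb, hΩc, hΩh, hΩs⟩ := exists_homogeneous_bijOn (S := S) hw hε.le hεK huK hM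
  set L : (Fin m → ℝ) → ℝ := fun c => posSum S w c - negSum S w c with hL
  set N : (Fin m → ℝ) → ℝ := comboNorm u with hN
  set G : (Fin m → ℝ) → ℝ := fun c => max (N c / r) (|L c| / δ) with hG
  have hNc : Continuous N := continuous_comboNorm u
  have hLc : Continuous L := (continuous_posSum w).sub (continuous_negSum w)
  have hGc : Continuous G := (hNc.div_const r).max (hLc.abs.div_const δ)
  have hN0 : ∀ c, 0 ≤ N c := fun c => norm_nonneg _
  have hG0 : ∀ c, 0 ≤ G c := fun c => le_max_of_le_left (div_nonneg (hN0 c) hr.le)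
  have hGpos : ∀ c ∈ M, c ≠ 0 → 0 < G c := fun c hc h0 =>
    lt_max_of_lt_left (div_pos ((mul_pos hκ (norm_pos_iff.2 h0)).trans_le (hκM c hc)) hr)
  have hGh : ∀ t : ℝ, 0 ≤ t → ∀ c, G (t • c) = t * G c := by
    intro t ht c
    simp only [hG, hL, hN, comboNorm_smul ht, posSum_smul, negSum_smul, ← mul_sub, abs_mul,
      abs_of_nonneg ht, mul_div_assoc]
    rw [mul_max_of_nonneg _ _ ht]
  have hGz : G 0 = 0 := by simpa using hGh 0 le_rfl 0
  have hLin : ∀ c : Fin m → ℝ, inner ℝ (∑ i, c i • u i) a = L c := by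
    intro c
    simp only [sum_inner, inner_smul_left, hL, posSum, negSum, ← Finset.sum_sub_distrib]
    refine Finset.sum_congr rfl fun i _ => ?_
    by_cases hi : i ∈ S
    · simp only [splitScale_of_mem hi, hwdef]
      rw [abs_of_pos hi]
      simp [mul_comm]
    · simp only [splitScale_of_notMem hi, hwdef]
      rw [abs_of_nonpos (not_lt.1 hi)]
      simp [mul_comm]
  set D : Set (Fin m → ℝ) := {c | c ∈ M ∧ G c ≤ 1} with hD
  have hDN : ∀ c ∈ D, N c ≤ r := fun c hc => by
    have := (le_max_left _ _).trans hc.2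
    rwa [div_le_one hr] at this
  have hDL : ∀ c ∈ D, |L c| ≤ δ := fun c hc => by
    have := (le_max_right _ _).trans hc.2
    rwa [div_le_one hδ] at this
  have hDc : IsCompact D := by
    refine Metric.isCompact_of_isClosed_isBounded (hMc.inter (isClosed_le hGc continuous_const)) ?_
    refine (Metric.isBounded_closedBall (x := 0) (r := r / κ)).subset fun c hc => ?_
    rw [mem_closedBall_zero_iff, le_div_iff₀' hκ]
    exact (hκM c hc.1).trans (hDN c hc)
  have hΩ0 : ∀ c ∈ M, c ≠ 0 → Ω c ≠ 0 := by
    intro c hc h0 hz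
    have h1 : (2 : ℝ) • c = c := hΩb.injOn (hM.smul_mem hc zero_le_two) hc (by
      rw [hΩh 2 two_pos, hz, smul_zero])
    refine h0 ?_
    have : c + c = c := by rwa [two_smul] at h1
    simpa using this
  -- the map onto the cubical complex
  set Θ : (Fin m → ℝ) → (Fin m → ℝ) := fun c => (G c / ‖Ω c‖) • Ω c with hΘ
  have hΘ0 : Θ 0 = 0 := by simp [hΘ, hGz]
  have hΘn : ∀ c ∈ M, ‖Θ c‖ = G c := by
    intro c hc
    by_cases h0 : c = 0
    · rw [h0, hΘ0, hGz, norm_zero]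
    · have := norm_ne_zero_iff.2 (hΩ0 c hc h0)
      rw [hΘ]
      simp only [norm_smul, norm_div, norm_norm, Real.norm_of_nonneg (hG0 c)]
      field_simp
  have hΘM : ∀ c ∈ M, Θ c ∈ M := fun c hc =>
    hM.smul_mem (hΩb.mapsTo hc) (div_nonneg (hG0 c) (norm_nonneg _))
  have hΘc : ContinuousOn Θ M := by
    intro c hc
    by_cases h0 : c = 0
    · subst h0
      rw [ContinuousWithinAt, hΘ0]
      refine squeeze_zero_norm' (a := G) ?_ ?_
      · filter_upwards [self_mem_nhdsWithin] with d hd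
        exact (hΘn d hd).le
      · have := hGc.tendsto 0
        rw [hGz] at this
        exact this.mono_left nhdsWithin_le_nhds
    · exact (hGc.continuousWithinAt.div (hΩc c hc).norm
        (norm_ne_zero_iff.2 (hΩ0 c hc h0))).smul (hΩc c hc)
  have hΘinj : InjOn Θ M := by
    intro c hc d hd h
    have hn : G c = G d := by rw [← hΘn c hc, h, hΘn d hd]
    by_cases hc0 : c = 0
    · by_contra hne
      have hd0 : d ≠ 0 := fun h => hne (hc0.trans h.symm)
      have := hGpos d hd hd0
      rw [← hn, hc0, hGz] at this
      exact this.false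
    have hd0 : d ≠ 0 := by
      rintro rfl
      have := hGpos c hc hc0
      rw [hn, hGz] at this
      exact this.false
    have p1 : 0 < G c := hGpos c hc hc0
    have p2 : 0 < ‖Ω c‖ := norm_pos_iff.2 (hΩ0 c hc hc0)
    have p3 : 0 < ‖Ω d‖ := norm_pos_iff.2 (hΩ0 d hd hd0)
    have e1 : (‖Ω d‖ / ‖Ω c‖) • Ω c = Ω d := by
      have h' : (G c / ‖Ω c‖) • Ω c = (G d / ‖Ω d‖) • Ω d := h
      rw [← hn] at h'
      have h2 := congrArg (fun v => (‖Ω d‖ / G c) • v) h'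
      simp only [smul_smul] at h2
      rw [show ‖Ω d‖ / G c * (G c / ‖Ω c‖) = ‖Ω d‖ / ‖Ω c‖ by field_simp,
        show ‖Ω d‖ / G c * (G c / ‖Ω d‖) = 1 by field_simp, one_smul] at h2
      exact h2
    have t0 : 0 < ‖Ω d‖ / ‖Ω c‖ := by positivity
    rw [← hΩh _ t0] at e1
    have e2 := hΩb.injOn (hM.smul_mem hc t0.le) hd e1
    have e3 : G d = ‖Ω d‖ / ‖Ω c‖ * G c := by
      have := hGh _ t0.le c
      rwa [e2] at this
    have e4 : ‖Ω d‖ / ‖Ω c‖ = 1 := by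
      rw [← hn] at e3
      exact mul_right_cancel₀ p1.ne' (by rw [one_mul]; exact e3.symm)
    rw [← e2, e4, one_smul]
  have hΘsurj : SurjOn Θ M M := by
    intro e he
    by_cases he0 : e = 0
    · exact ⟨0, he0 ▸ he, by rw [hΘ0, he0]⟩
    obtain ⟨c, hc, rfl⟩ := hΩb.surjOn he
    have hc0 : c ≠ 0 := by
      rintro rfl
      have := hΩh 2 two_pos 0
      rw [smul_zero, two_smul] at this
      exact he0 (by simpa using this.symm)
    have p1 := hGpos c hc hc0
    have p2 : 0 < ‖Ω c‖ := norm_pos_iff.2 he0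
    have t0 : 0 < ‖Ω c‖ / G c := by positivity
    refine ⟨(‖Ω c‖ / G c) • c, hM.smul_mem hc t0.le, ?_⟩
    simp only [hΘ]
    rw [hΩh _ t0, hGh _ t0.le, norm_smul, Real.norm_of_nonneg t0.le, smul_smul]
    rw [show ‖Ω c‖ / G c * G c / (‖Ω c‖ / G c * ‖Ω c‖) * (‖Ω c‖ / G c) = 1 by field_simp, one_smul]
  have hle : ∀ c ∈ M, ∀ i, Θ c i ≤ G c := fun c hc i => by
    rw [← hΘn c hc]
    exact (le_abs_self _).trans (norm_le_pi_norm (Θ c) i)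
  refine PairHomeomorphic.of_bijOn_of_bijOn hDc (fun c => WithLp.toLp 2 (Θ c))
    (fun c => x + ∑ i, c i • u i) ?_ (by fun_prop) ⟨?_, ?_, ?_⟩ ⟨?_, ?_, ?_⟩ ?_
  · exact (PiLp.continuous_toLp 2 _).comp_continuousOn (hΘc.mono fun c hc => hc.1)
  · exact fun c hc => ⟨hΘM c hc.1, fun i => (hle c hc.1 i).trans hc.2⟩
  · exact fun c hc d hd h => hΘinj hc.1 hd.1 (WithLp.toLp_injective 2 h)
  · rintro e ⟨heM, he1⟩
    obtain ⟨c, hc, hce⟩ := hΘsurj (show e.ofLp ∈ M from heM)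
    refine ⟨c, ⟨hc, ?_⟩, by simp only [hce]⟩
    rw [← hΘn c hc, hce, pi_norm_le_iff_of_nonneg zero_le_one]
    intro i
    rw [Real.norm_of_nonneg (heM.1 i)]
    exact he1 i
  · intro c hc
    have h1 : ‖(x + ∑ i, c i • u i) - x‖ ≤ r := by
      rw [add_sub_cancel_left]; exact hDN c hc
    refine ⟨⟨(hX _ h1).2 ⟨WithLp.toLp 2 c, hc.1, by simp⟩, ?_⟩, ?_⟩
    · rwa [Metric.mem_closedBall, dist_eq_norm]
    · rw [add_sub_cancel_left, hLin]
      exact abs_le.1 (hDL c hc)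
  · intro c hc d hd h
    exact WithLp.toLp_injective 2 (hu _ hc.1 _ hd.1 (add_left_cancel h))
  · rintro y ⟨⟨hyX, hyr⟩, h1, h2⟩
    rw [Metric.mem_closedBall, dist_eq_norm] at hyr
    obtain ⟨c, hc, hcy⟩ := (hX y hyr).1 hyX
    refine ⟨c.ofLp, ⟨hc, max_le ?_ ?_⟩, ?_⟩
    · rw [div_le_one hr]
      change ‖∑ i, c i • u i‖ ≤ r
      rwa [hcy]
    · rw [div_le_one hδ, ← hLin, hcy]
      exact abs_le.2 ⟨h1, h2⟩
    · simp only [hcy]; abel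
  · intro c hc
    have h1 : ‖(x + ∑ i, c i • u i) - x‖ ≤ r := by
      rw [add_sub_cancel_left]; exact hDN c hc
    -- the coordinates in `S` attain the maximum norm of `Θ c` exactly where `ℓ ≥ ε N`
    have hsgn : 0 < G c → (posMax S (Θ c) = G c ↔ ε * N c ≤ L c) := by
      intro hGc0
      have hc0 : c ≠ 0 := by rintro rfl; rw [hGz] at hGc0; exact hGc0.false
      have p2 : 0 < ‖Ω c‖ := norm_pos_iff.2 (hΩ0 c hc.1 hc0)
      have e1 : posMax S (Θ c) = G c / ‖Ω c‖ * posMax S (Ω c) := by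
        simp only [hΘ]
        rw [← splitScale_self (S := S), posMax_splitScale (by positivity)]
      have e2 := norm_eq_max (S := S) (Ω c)
      rw [← hΩs c hc.1, e1]
      constructor
      · intro h
        have : posMax S (Ω c) = ‖Ω c‖ := by
          field_simp at h
          exact h
        rw [this, e2]
        exact le_max_right _ _
      · intro h
        rw [max_eq_left h] at e2
        rw [← e2]
        field_simp
    constructor
    · rintro ⟨-, i, hi, hci⟩
      have hci' : Θ c i = 1 := hci
      have hG1 : G c = 1 := le_antisymm hc.2 (hci'.symm.le.trans (hle c hc.1 i))
      have hp : posMax S (Θ c) = G c := by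
        refine le_antisymm ?_ ?_
        · rw [← hΘn c hc.1, norm_eq_max (S := S)]; exact le_max_left _ _
        · have := abs_le_posMax hi (Θ c)
          rwa [hci', abs_one, ← hG1] at this
      have hs := (hsgn (by rw [hG1]; exact one_pos)).1 hp
      refine ⟨⟨(hX _ h1).2 ⟨WithLp.toLp 2 c, hc.1, by simp⟩, ?_⟩, ?_⟩
      · rwa [Metric.mem_closedBall, dist_eq_norm]
      · rw [add_sub_cancel_left, hLin]
        have hL0 : 0 ≤ L c := (mul_nonneg hε.le (hN0 c)).trans hs
        have hLδ := hDL c hc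
        rw [abs_of_nonneg hL0] at hLδ
        refine le_antisymm hLδ ?_
        rcases le_total (N c / r) (|L c| / δ) with h | h
        · have : G c = |L c| / δ := max_eq_right h
          rw [this, abs_of_nonneg hL0, div_eq_one_iff_eq hδ.ne'] at hG1
          exact hG1.ge
        · have : G c = N c / r := max_eq_left h
          rw [this, div_eq_one_iff_eq hr.ne'] at hG1
          rw [hG1, hεdef, div_mul_cancel₀ _ hr.ne'] at hs
          exact hs
    · rintro ⟨-, h2⟩
      rw [add_sub_cancel_left, hLin] at h2
      have hG1 : G c = 1 := by
        refine le_antisymm hc.2 (le_max_of_le_right ?_)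
        rw [h2, abs_of_pos hδ, div_self hδ.ne']
      have hs : ε * N c ≤ L c := by
        rw [h2, hεdef]
        calc δ / r * N c ≤ δ / r * r := by gcongr; exact hDN c hc
          _ = δ := by field_simp
      have hp := (hsgn (by rw [hG1]; exact one_pos)).2 hs
      refine ⟨⟨hΘM c hc.1, fun i => (hle c hc.1 i).trans hc.2⟩, ?_⟩
      by_contra hno
      have hlt : ∀ i, ‖splitScale S 1 0 (Θ c) i‖ < 1 := by
        intro i
        by_cases hi : i ∈ S
        · rw [splitScale_of_mem hi, one_mul, Real.norm_of_nonneg ((hΘM c hc.1).1 i)]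
          refine lt_of_le_of_ne ((hle c hc.1 i).trans hc.2) fun h => hno ⟨i, hi, h⟩
        · rw [splitScale_of_notMem hi]; simp
      have := (pi_norm_lt_iff one_pos).2 hlt
      rw [← posMax, hp, hG1] at this
      exact this.false

/-- The index of a set at a point near which it is a simplicial cone. -/
theorem CurvatureMap.index_eq_cubeVal (ρ : CurvatureMap) {n m : ℕ} {u : Fin m → Euc n}
    {Δ : Set (Finset (Fin m))} (hu : IsSimplicialFan u Δ) {a : Euc n}
    (ha : ∀ i, inner ℝ (u i) a ≠ 0) {X : Set (Euc n)} {x : Euc n}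
    (hX : ∀ᶠ y in 𝓝 x, y ∈ X ↔ y - x ∈ fanSet u Δ) :
    ρ.index X x a = ρ.cubeVal Δ {i | 0 < inner ℝ (u i) a} := by
  set v := ρ.cubeVal Δ {i | 0 < inner ℝ (u i) a} with hv
  obtain ⟨ε₀, hε₀, h⟩ := pairHomeomorphic_coneAt_cube hu ha
  obtain ⟨r₀, hr₀, hX⟩ := Metric.eventually_nhds_iff.1 hX
  have key : ∀ᶠ r in 𝓝[>] (0 : ℝ), ∀ᶠ δ in 𝓝[>] (0 : ℝ),
      ρ.val n (coneAt X x a r δ) (linkAt X x a r δ) = v := by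
    filter_upwards [Ioo_mem_nhdsGT hr₀] with r hr
    filter_upwards [Ioo_mem_nhdsGT (mul_pos hε₀ hr.1)] with δ hδ
    refine (ρ.val_eq_of_homeomorphic (isTamePair_cube _ _) ?_
      (h X x r δ hr.1 hδ.1 hδ.2 fun y hy => hX ?_)).symm
    · rintro y ⟨hy, hyδ⟩
      exact ⟨hy, by rw [hyδ]; linarith [hδ.1], hyδ.le⟩
    · rw [dist_eq_norm]; exact hy.trans_lt hr.2
  have huniq : ∀ v' : ℝ, (∀ᶠ r in 𝓝[>] (0 : ℝ), ∀ᶠ δ in 𝓝[>] (0 : ℝ),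
      ρ.val n (coneAt X x a r δ) (linkAt X x a r δ) = v') → v' = v := by
    intro v' hv'
    obtain ⟨r, h1, h2⟩ := (hv'.and key).exists
    obtain ⟨δ, h3, h4⟩ := (h1.and h2).exists
    rw [← h3, h4]
  exact huniq _ (Classical.epsilon_spec (p := fun v : ℝ =>
    ∀ᶠ r in 𝓝[>] (0 : ℝ), ∀ᶠ δ in 𝓝[>] (0 : ℝ),
      ρ.val n (coneAt X x a r δ) (linkAt X x a r δ) = v) ⟨v, key⟩)

/-! ### Simplicial subdivision of a hyperplane arrangement -/

/-- The sign vector of a point with respect to a family of linear forms. -/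
noncomputable def signVec {V J : Type*} [AddCommGroup V] [Module ℝ V] (h : J → V →ₗ[ℝ] ℝ) (y : V) :
    J → SignType := fun j => SignType.sign (h j y)

/-- The sign vector `s` arises from `t` by replacing some entries by zero: the cell of `s` is a
face of the cell of `t`. -/
def SignFace {J : Type*} (s t : J → SignType) : Prop := ∀ j, s j = 0 ∨ s j = t j

theorem SignFace.refl {J : Type*} (s : J → SignType) : SignFace s s := fun _ => Or.inr rfl

theorem SignFace.trans {J : Type*} {s t r : J → SignType} (h : SignFace s t) (h' : SignFace t r) :
    SignFace s r := fun j => by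
  rcases h j with h1 | h1
  · exact Or.inl h1
  · rw [h1]; exact h' j

/-- A set that contains with each point the closure of the cell of the point in the arrangement of
the hyperplanes `h j = 0`. -/
def IsCellUnion {V J : Type*} [AddCommGroup V] [Module ℝ V] (h : J → V →ₗ[ℝ] ℝ) (C : Set V) : Prop :=
  ∀ y ∈ C, ∀ y', SignFace (signVec h y') (signVec h y) → y' ∈ C

section Arrangement

variable {V J : Type*} [AddCommGroup V] [Module ℝ V] [Fintype J] {h : J → V →ₗ[ℝ] ℝ}

/-- The number of nonzero entries of a sign vector. -/
noncomputable def signSize (s : J → SignType) : ℕ :=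
  open Classical in (Finset.univ.filter fun j => s j ≠ 0).card

/-- Passing to a proper face of a sign vector strictly lowers the number of nonzero signs. -/
theorem SignFace.eq_of_size_le {s t : J → SignType} (hst : SignFace s t)
    (hle : signSize t ≤ signSize s) : s = t := by
  classical
  have hsub : (Finset.univ.filter fun j => s j ≠ 0) ⊆ Finset.univ.filter fun j => t j ≠ 0 := by
    intro j hj
    simp only [Finset.mem_filter, Finset.mem_univ, true_and] at hj ⊢
    rwa [← (hst j).resolve_left hj]
  have heq := Finset.eq_of_subset_of_card_le hsub (by simpa [signSize] using hle)
  ext1 j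
  rcases hst j with h0 | h0
  · by_contra hne
    have : j ∈ Finset.univ.filter fun j => t j ≠ 0 := by
      simp only [Finset.mem_filter, Finset.mem_univ, true_and]
      intro ht
      exact hne (h0.trans ht.symm)
    rw [← heq] at this
    simp [h0] at this
  · exact h0

variable {m : ℕ} {u : Fin m → V}

/-- A positive combination of points in the cells of a chain lies in the largest of these
cells. -/
theorem exists_top_of_chain {c : Fin m → ℝ} (hc : ∀ i, 0 ≤ c i)
    (hchain : ∀ i j, c i ≠ 0 → c j ≠ 0 →
      SignFace (signVec h (u i)) (signVec h (u j)) ∨ SignFace (signVec h (u j)) (signVec h (u i)))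
    (hne : c ≠ 0) :
    ∃ i₀, c i₀ ≠ 0 ∧ (∀ i, c i ≠ 0 → SignFace (signVec h (u i)) (signVec h (u i₀))) ∧
      signVec h (∑ i, c i • u i) = signVec h (u i₀) := by
  classical
  obtain ⟨i₁, hi₁⟩ : ∃ i, c i ≠ 0 := by
    by_contra hno
    push Not at hno
    exact hne (funext hno)
  obtain ⟨i₀, hi₀, hmax⟩ := Finset.exists_max_image (Finset.univ.filter fun i => c i ≠ 0)
    (fun i => signSize (signVec h (u i))) ⟨i₁, by simpa using hi₁⟩
  simp only [Finset.mem_filter, Finset.mem_univ, true_and] at hi₀ hmax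
  have htop : ∀ i, c i ≠ 0 → SignFace (signVec h (u i)) (signVec h (u i₀)) := by
    intro i hi
    rcases hchain i i₀ hi hi₀ with h1 | h1
    · exact h1
    · rw [h1.eq_of_size_le (hmax i hi)]; exact SignFace.refl _
  refine ⟨i₀, hi₀, htop, ?_⟩
  have hpos : 0 < c i₀ := (hc i₀).lt_of_ne' hi₀
  ext1 j
  simp only [signVec, map_sum, map_smul, smul_eq_mul]
  have hterm : ∀ i, c i * h j (u i) = 0 ∨
      SignType.sign (h j (u i)) = SignType.sign (h j (u i₀)) := by
    intro i
    by_cases hi : c i = 0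
    · left; rw [hi, zero_mul]
    · rcases htop i hi j with h1 | h1
      · left
        rw [sign_eq_zero_iff.1 h1, mul_zero]
      · exact Or.inr h1
  rcases lt_trichotomy (h j (u i₀)) 0 with hs | hs | hs
  · rw [sign_neg hs, sign_neg]
    refine Finset.sum_neg' (fun i _ => ?_) ⟨i₀, Finset.mem_univ _, mul_neg_of_pos_of_neg hpos hs⟩
    rcases hterm i with h1 | h1
    · exact h1.le
    · rw [sign_neg hs, sign_eq_neg_one_iff] at h1
      exact mul_nonpos_of_nonneg_of_nonpos (hc i) h1.le
  · rw [hs]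
    refine congrArg _ (Finset.sum_eq_zero fun i _ => ?_)
    rcases hterm i with h1 | h1
    · exact h1
    · rw [hs, sign_zero, sign_eq_zero_iff] at h1
      rw [h1, mul_zero]
  · rw [sign_pos hs, sign_pos]
    refine Finset.sum_pos' (fun i _ => ?_) ⟨i₀, Finset.mem_univ _, mul_pos hpos hs⟩
    rcases hterm i with h1 | h1
    · exact h1.ge
    · rw [sign_pos hs, sign_eq_one_iff] at h1
      exact mul_nonneg (hc i) h1.le

/-- The coefficients of a chain combination are determined by the point: the largest cell is
the cell of the point, and one can cancel a multiple of the vector in this cell. -/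
theorem chain_coeff_unique (h0 : ∀ i, signVec h (u i) ≠ 0)
    (hinj : Function.Injective fun i => signVec h (u i)) :
    ∀ (N : ℕ) (c d : Fin m → ℝ), (∀ i, 0 ≤ c i) → (∀ i, 0 ≤ d i) →
    (∀ i j, c i ≠ 0 → c j ≠ 0 →
      SignFace (signVec h (u i)) (signVec h (u j)) ∨ SignFace (signVec h (u j)) (signVec h (u i))) →
    (∀ i j, d i ≠ 0 → d j ≠ 0 →
      SignFace (signVec h (u i)) (signVec h (u j)) ∨ SignFace (signVec h (u j)) (signVec h (u i))) →
    (Finset.univ.filter fun i => c i ≠ 0).card + (Finset.univ.filter fun i => d i ≠ 0).card ≤ N →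
    ∑ i, c i • u i = ∑ i, d i • u i → c = d := by
  have hzero : signVec h (0 : V) = 0 := by
    ext1 j
    simp [signVec]
  intro N
  induction N with
  | zero =>
    intro c d _ _ _ _ hcard _
    have h1 : (Finset.univ.filter fun i => c i ≠ 0).card = 0 := by omega
    have h2 : (Finset.univ.filter fun i => d i ≠ 0).card = 0 := by omega
    rw [Finset.card_eq_zero, Finset.filter_eq_empty_iff] at h1 h2
    ext i
    rw [not_not.1 (h1 (Finset.mem_univ i)), not_not.1 (h2 (Finset.mem_univ i))]
  | succ N ih =>
    intro c d hc hd hcc hcd hcard hsum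
    by_cases c0 : c = 0
    · by_contra hne
      have d0 : d ≠ 0 := fun hd0 => hne (c0.trans hd0.symm)
      obtain ⟨i, -, -, hi⟩ := exists_top_of_chain hd hcd d0
      rw [← hsum, c0] at hi
      simp only [Pi.zero_apply, zero_smul, Finset.sum_const_zero, hzero] at hi
      exact h0 i hi.symm
    by_cases d0 : d = 0
    · exfalso
      obtain ⟨i, -, -, hi⟩ := exists_top_of_chain hc hcc c0
      rw [hsum, d0] at hi
      simp only [Pi.zero_apply, zero_smul, Finset.sum_const_zero, hzero] at hi
      exact h0 i hi.symm
    obtain ⟨i, hci, -, hi⟩ := exists_top_of_chain hc hcc c0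
    obtain ⟨i', hdi, -, hi'⟩ := exists_top_of_chain hd hcd d0
    have hii : i = i' := hinj (by simp only [← hi, ← hi', hsum])
    subst hii
    -- cancel the smaller one of the two top coefficients
    set t := min (c i) (d i) with ht
    have hsupp : ∀ e : Fin m → ℝ, e i ≠ 0 → ∀ j, Function.update e i (e i - t) j ≠ 0 → e j ≠ 0 := by
      intro e he j hj
      by_cases hji : j = i
      · rw [hji]; exact he
      · rwa [Function.update_of_ne hji] at hj
    have hcard' : ∀ e : Fin m → ℝ, e i ≠ 0 →
        (Finset.univ.filter fun j => Function.update e i (e i - t) j ≠ 0).card ≤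
          (Finset.univ.filter fun j => e j ≠ 0).card := fun e he =>
      Finset.card_le_card fun j hj => by
        simp only [Finset.mem_filter, Finset.mem_univ, true_and] at hj ⊢
        exact hsupp e he j hj
    have hcard'' : ∀ e : Fin m → ℝ, e i ≠ 0 → e i = t →
        (Finset.univ.filter fun j => Function.update e i (e i - t) j ≠ 0).card <
          (Finset.univ.filter fun j => e j ≠ 0).card := fun e he het =>
      Finset.card_lt_card ⟨fun j hj => by
        simp only [Finset.mem_filter, Finset.mem_univ, true_and] at hj ⊢
        exact hsupp e he j hj, fun hsub => by
        have := hsub (show i ∈ Finset.univ.filter fun j => e j ≠ 0 by simpa using he)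
        simp [het] at this⟩
    have hsum' : ∀ e : Fin m → ℝ, ∑ j, Function.update e i (e i - t) j • u j =
        ∑ j, e j • u j - t • u i := by
      intro e
      rw [← Finset.add_sum_erase _ _ (Finset.mem_univ i),
        ← Finset.add_sum_erase (Finset.univ) (fun j => e j • u j) (Finset.mem_univ i),
        Function.update_self, sub_smul]
      have : ∑ j ∈ Finset.univ.erase i, Function.update e i (e i - t) j • u j =
          ∑ j ∈ Finset.univ.erase i, e j • u j := Finset.sum_congr rfl fun j hj => by
        rw [Function.update_of_ne (Finset.ne_of_mem_erase hj)]
      rw [this]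
      abel
    have hnn : ∀ e : Fin m → ℝ, (∀ j, 0 ≤ e j) → t ≤ e i →
        ∀ j, 0 ≤ Function.update e i (e i - t) j := by
      intro e he hte j
      by_cases hji : j = i
      · rw [hji, Function.update_self]; linarith
      · rw [Function.update_of_ne hji]; exact he j
    have key := ih (Function.update c i (c i - t)) (Function.update d i (d i - t))
      (hnn c hc (min_le_left _ _)) (hnn d hd (min_le_right _ _))
      (fun j l hj hl => hcc j l (hsupp c hci j hj) (hsupp c hci l hl))
      (fun j l hj hl => hcd j l (hsupp d hdi j hj) (hsupp d hdi l hl))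
      (by
        have a1 := hcard' c hci
        have a2 := hcard' d hdi
        rcases min_choice (c i) (d i) with hm | hm
        · have := hcard'' c hci (by rw [ht, hm])
          omega
        · have := hcard'' d hdi (by rw [ht, hm])
          omega)
      (by rw [hsum', hsum', hsum])
    ext j
    have hj := congrFun key j
    by_cases hji : j = i
    · rw [hji, Function.update_self, Function.update_self] at hj
      rw [hji]; linarith
    · rwa [Function.update_of_ne hji, Function.update_of_ne hji] at hj

/-- Every point is a chain combination: subtract the largest multiple of the vector in the
cell of the point that keeps it in the closure of this cell. -/
theorem exists_chain_coeff (hsep : ∀ y, (∀ j, h j y = 0) → y = 0)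
    (hall : ∀ y, y ≠ 0 → ∃ i, signVec h (u i) = signVec h y) :
    ∀ (N : ℕ) (y : V), signSize (signVec h y) ≤ N → ∃ c : Fin m → ℝ, (∀ i, 0 ≤ c i) ∧
      ∑ i, c i • u i = y ∧
      (∀ i j, c i ≠ 0 → c j ≠ 0 → SignFace (signVec h (u i)) (signVec h (u j)) ∨
        SignFace (signVec h (u j)) (signVec h (u i))) ∧
      ∀ i, c i ≠ 0 → SignFace (signVec h (u i)) (signVec h y) := by
  classical
  intro N
  induction N with
  | zero =>
    intro y hy
    have hy0 : y = 0 := by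
      refine hsep y fun j => ?_
      rw [signSize, Nat.le_zero, Finset.card_eq_zero, Finset.filter_eq_empty_iff] at hy
      exact sign_eq_zero_iff.1 (not_not.1 (hy (Finset.mem_univ j)))
    exact ⟨0, by simp, by simp [hy0], by simp, by simp⟩
  | succ N ih =>
    intro y hy
    by_cases hy0 : y = 0
    · exact ⟨0, by simp, by simp [hy0], by simp, by simp⟩
    obtain ⟨i₀, hi₀⟩ := hall y hy0
    have hsgn : ∀ j, SignType.sign (h j (u i₀)) = SignType.sign (h j y) := congrFun hi₀
    obtain ⟨j₁, hj₁⟩ : ∃ j, h j y ≠ 0 := by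
      by_contra hno
      push Not at hno
      exact hy0 (hsep y hno)
    obtain ⟨j₀, hj₀, hmin⟩ := Finset.exists_min_image (Finset.univ.filter fun j => h j y ≠ 0)
      (fun j => h j y / h j (u i₀)) ⟨j₁, by simpa using hj₁⟩
    simp only [Finset.mem_filter, Finset.mem_univ, true_and] at hj₀ hmin
    have hratio : ∀ j, h j y ≠ 0 → 0 < h j y / h j (u i₀) := by
      intro j hj
      have := hsgn j
      rcases lt_or_gt_of_ne hj with h1 | h1
      · rw [sign_neg h1, sign_eq_neg_one_iff] at this
        exact div_pos_of_neg_of_neg h1 this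
      · rw [sign_pos h1, sign_eq_one_iff] at this
        exact div_pos h1 this
    set t := h j₀ y / h j₀ (u i₀) with ht
    have ht0 : 0 < t := hratio j₀ hj₀
    have hne : ∀ j, h j y ≠ 0 → h j (u i₀) ≠ 0 := by
      intro j hj h1
      have := hratio j hj
      rw [h1, div_zero] at this
      exact this.false
    have hval : ∀ j, h j (y - t • u i₀) = h j y - t * h j (u i₀) := fun j => by
      rw [map_sub, map_smul, smul_eq_mul]
    have hface : SignFace (signVec h (y - t • u i₀)) (signVec h y) := by
      intro j
      simp only [signVec, hval]
      by_cases hj : h j y = 0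
      · left
        have := hsgn j
        rw [hj, sign_zero, sign_eq_zero_iff] at this
        rw [hj, this]; simp
      · have h1 : h j y - t * h j (u i₀) = (h j y / h j (u i₀) - t) * h j (u i₀) := by
          have := hne j hj
          field_simp
        have h2 : 0 ≤ h j y / h j (u i₀) - t := sub_nonneg.2 (hmin j hj)
        rw [h1, sign_mul, hsgn j]
        rcases h2.eq_or_lt with h3 | h3
        · left; rw [← h3]; simp
        · right; rw [sign_pos h3, one_mul]
    have hlt : signSize (signVec h (y - t • u i₀)) ≤ N := by
      by_contra hcon
      have heq := hface.eq_of_size_le (by omega)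
      have h1 := congrFun heq j₀
      simp only [signVec, hval] at h1
      rw [ht, div_mul_cancel₀ _ (hne j₀ hj₀), sub_self, sign_zero] at h1
      exact hj₀ (sign_eq_zero_iff.1 h1.symm)
    obtain ⟨c, hc, hsum, hchain, hcf⟩ := ih _ hlt
    have hsupp : ∀ i, (c + Pi.single i₀ t : Fin m → ℝ) i ≠ 0 → i = i₀ ∨ c i ≠ 0 := by
      intro i hi
      by_cases hii : i = i₀
      · exact Or.inl hii
      · rw [Pi.add_apply, Pi.single_eq_of_ne hii, add_zero] at hi
        exact Or.inr hi
    have hface' : ∀ i, (c + Pi.single i₀ t : Fin m → ℝ) i ≠ 0 → SignFace (signVec h (u i)) (signVec h y) := by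
      intro i hi
      rcases hsupp i hi with rfl | h1
      · rw [hi₀]; exact SignFace.refl _
      · exact (hcf i h1).trans hface
    refine ⟨c + Pi.single i₀ t, fun i => ?_, ?_, fun i j hi hj => ?_, hface'⟩
    · refine add_nonneg (hc i) ?_
      by_cases hii : i = i₀
      · rw [hii, Pi.single_eq_same]; exact ht0.le
      · rw [Pi.single_eq_of_ne hii]
    · simp only [Pi.add_apply, add_smul, Finset.sum_add_distrib, hsum]
      rw [Finset.sum_eq_single i₀ (fun i _ hi => by rw [Pi.single_eq_of_ne hi, zero_smul])
        (fun hi => (hi (Finset.mem_univ _)).elim), Pi.single_eq_same]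
      abel
    · rcases hsupp i hi with rfl | h1
      · right; rw [hi₀]; exact hface' j hj
      · rcases hsupp j hj with rfl | h2
        · left; rw [hi₀]; exact hface' i hi
        · exact hchain i j h1 h2

/-- A union of closed cells of an arrangement of hyperplanes with intersection zero is a
simplicial fan: choose a vector in each cell other than the origin, and take the cones spanned by
the vectors of the chains of cells (the barycentric subdivision). -/
theorem exists_simplicialFan (hsep : ∀ y, (∀ j, h j y = 0) → y = 0) {C : Set V}
    (hC : IsCellUnion h C) (hne : C.Nonempty) :
    ∃ (m : ℕ) (u : Fin m → V) (Δ : Set (Finset (Fin m))),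
      (∀ i, u i ≠ 0) ∧ IsSimplicialFan u Δ ∧ fanSet u Δ = C := by
  classical
  have hfin : {s : J → SignType | s ≠ 0 ∧ ∃ y, signVec h y = s}.Finite := Set.toFinite _
  obtain ⟨m, e⟩ : ∃ m, Nonempty (Fin m ≃ {s : J → SignType | s ≠ 0 ∧ ∃ y, signVec h y = s}) := by
    have := hfin.fintype
    exact ⟨_, ⟨(Fintype.equivFin _).symm⟩⟩
  obtain ⟨e⟩ := e
  choose u hu using fun i => (e i).2.2
  have h0 : ∀ i, signVec h (u i) ≠ 0 := fun i => by rw [hu i]; exact (e i).2.1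
  have hzero : signVec h (0 : V) = 0 := by
    ext1 j
    simp [signVec]
  have hinj : Function.Injective fun i => signVec h (u i) := by
    intro i j hij
    simp only [hu] at hij
    exact e.injective (Subtype.ext hij)
  have hall : ∀ y, y ≠ 0 → ∃ i, signVec h (u i) = signVec h y := by
    intro y hy
    have hy' : signVec h y ≠ 0 := by
      intro h1
      exact hy (hsep y fun j => sign_eq_zero_iff.1 (congrFun h1 j))
    refine ⟨e.symm ⟨signVec h y, hy', y, rfl⟩, ?_⟩
    rw [hu, Equiv.apply_symm_apply]
  let Δ : Set (Finset (Fin m)) := {τ | (∀ i ∈ τ, ∀ j ∈ τ,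
    SignFace (signVec h (u i)) (signVec h (u j)) ∨ SignFace (signVec h (u j)) (signVec h (u i))) ∧
      ∀ i ∈ τ, u i ∈ C}
  have hzC : (0 : V) ∈ C := by
    obtain ⟨y, hy⟩ := hne
    refine hC y hy 0 fun j => ?_
    left
    simp [signVec]
  refine ⟨m, u, Δ, fun i hi => h0 i (by rw [hi, hzero]), ?_, ?_⟩
  · rintro c ⟨hc, τ, hτ, hcτ⟩ d ⟨hd, τ', hτ', hdτ'⟩ hsum
    have := chain_coeff_unique h0 hinj _ c.ofLp d.ofLp hc hd
      (fun i j hi hj => hτ.1 i (hcτ i hi) j (hcτ j hj))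
      (fun i j hi hj => hτ'.1 i (hdτ' i hi) j (hdτ' j hj)) le_rfl hsum
    exact PiLp.ext (congrFun this)
  · ext y
    constructor
    · rintro ⟨c, ⟨hc, τ, hτ, hcτ⟩, rfl⟩
      by_cases hc0 : c.ofLp = 0
      · simpa [hc0] using hzC
      · obtain ⟨i, hi, -, hs⟩ := exists_top_of_chain (h := h) (u := u) hc
          (fun i j hi hj => hτ.1 i (hcτ i hi) j (hcτ j hj)) hc0
        exact hC _ (hτ.2 i (hcτ i hi)) _ (by rw [hs]; exact SignFace.refl _)
    · intro hy
      obtain ⟨c, hc, hsum, hchain, hface⟩ := exists_chain_coeff hsep hall _ y le_rfl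
      refine ⟨WithLp.toLp 2 c, ⟨hc, Finset.univ.filter fun i => c i ≠ 0, ⟨?_, ?_⟩, ?_⟩, hsum⟩
      · intro i hi j hj
        exact hchain i j (by simpa using hi) (by simpa using hj)
      · intro i hi
        exact hC y hy _ (hface i (by simpa using hi))
      · intro i hi
        simpa using hi

end Arrangement

/-! ### Tangent cones of polytopes -/

section CellUnion

variable {V : Type*} [AddCommGroup V] [Module ℝ V]

/-- A union of closed cells of the arrangement of finitely many linear hyperplanes. -/
def IsPolyhedralFan (C : Set V) : Prop :=
  ∃ H : Set (V →ₗ[ℝ] ℝ), H.Finite ∧ IsCellUnion (Subtype.val : H → V →ₗ[ℝ] ℝ) C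

theorem IsCellUnion.mono {H H' : Set (V →ₗ[ℝ] ℝ)} (hH : H ⊆ H') {C : Set V}
    (h : IsCellUnion (Subtype.val : H → V →ₗ[ℝ] ℝ) C) :
    IsCellUnion (Subtype.val : H' → V →ₗ[ℝ] ℝ) C :=
  fun y hy y' hf => h y hy y' fun j => hf ⟨j, hH j.2⟩

theorem isPolyhedralFan_biUnion {ι : Type*} {T : Set ι} (hT : T.Finite) {C : ι → Set V}
    (h : ∀ i ∈ T, IsPolyhedralFan (C i)) : IsPolyhedralFan (⋃ i ∈ T, C i) := by
  choose! H hH hC using h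
  refine ⟨⋃ i ∈ T, H i, hT.biUnion hH, fun y hy y' hf => ?_⟩
  obtain ⟨i, hi, hy⟩ := mem_iUnion₂.1 hy
  exact mem_iUnion₂.2 ⟨i, hi, (hC i hi).mono (subset_biUnion_of_mem hi) y hy y' hf⟩

/-- The nonnegative combinations of a finite set of vectors. -/
def posCone (t : Finset V) : Set V := {y | ∃ c : V → ℝ, (∀ w ∈ t, 0 ≤ c w) ∧ ∑ w ∈ t, c w • w = y}

/-- Carathéodory's theorem for cones: a nonnegative combination of vectors is a nonnegative
combination of linearly independent ones among them. -/
theorem exists_linearIndepOn_posCone (t : Finset V) {y : V} (hy : y ∈ posCone t) :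
    ∃ B ⊆ t, LinearIndepOn ℝ id (B : Set V) ∧ y ∈ posCone B := by
  classical
  induction t using Finset.strongInduction with
  | H t ih =>
    by_cases hli : LinearIndepOn ℝ id (t : Set V)
    · exact ⟨t, subset_rfl, hli, hy⟩
    obtain ⟨c, hc, rfl⟩ := hy
    obtain ⟨g, hg, w₁, hw₁, hgw₁⟩ : ∃ g : V → ℝ, ∑ w ∈ t, g w • w = 0 ∧ ∃ w ∈ t, 0 < g w := by
      rw [linearIndepOn_finset_iff] at hli
      push Not at hli
      obtain ⟨g, hg, w, hw, hgw⟩ := hli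
      rcases lt_or_gt_of_ne hgw with h | h
      · exact ⟨-g, by simpa using hg, w, hw, by simpa using h⟩
      · exact ⟨g, hg, w, hw, h⟩
    obtain ⟨w₀, hw₀, hmin⟩ := Finset.exists_min_image (t.filter fun w => 0 < g w)
      (fun w => c w / g w) ⟨w₁, by simp [hw₁, hgw₁]⟩
    simp only [Finset.mem_filter] at hw₀ hmin
    set r := c w₀ / g w₀ with hr
    have hr0 : 0 ≤ r := div_nonneg (hc _ hw₀.1) hw₀.2.le
    have hnn : ∀ w ∈ t, 0 ≤ c w - r * g w := by
      intro w hw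
      by_cases hgw : 0 < g w
      · have := hmin w ⟨hw, hgw⟩
        rw [le_div_iff₀ hgw] at this
        linarith
      · have := mul_nonpos_of_nonneg_of_nonpos hr0 (not_lt.1 hgw)
        linarith [hc w hw]
    have hz : c w₀ - r * g w₀ = 0 := by
      rw [hr, div_mul_cancel₀ _ hw₀.2.ne', sub_self]
    have hsum : ∑ w ∈ t.erase w₀, (c w - r * g w) • w = ∑ w ∈ t, c w • w := by
      have h1 : ∑ w ∈ t, (c w - r * g w) • w = ∑ w ∈ t, c w • w := by
        simp only [sub_smul, Finset.sum_sub_distrib, mul_smul, ← Finset.smul_sum, hg, smul_zero,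
          sub_zero]
      rw [← h1, ← Finset.add_sum_erase _ _ hw₀.1, hz, zero_smul, zero_add]
    obtain ⟨B, hB, hBl, hyB⟩ := ih (t.erase w₀) (Finset.erase_ssubset hw₀.1)
      ⟨fun w => c w - r * g w, fun w hw => hnn w (Finset.mem_of_mem_erase hw), hsum⟩
    exact ⟨B, hB.trans (Finset.erase_subset _ _), hBl, hyB⟩

theorem posCone_mono {B t : Finset V} (h : B ⊆ t) : posCone B ⊆ posCone t := by
  classical
  rintro y ⟨c, hc, rfl⟩
  refine ⟨fun w => if w ∈ B then c w else 0, fun w _ => ?_, ?_⟩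
  · dsimp only
    split_ifs with hw
    · exact hc w hw
    · exact le_rfl
  · simp only [ite_smul, zero_smul]
    rw [← Finset.sum_filter]
    refine Finset.sum_congr ?_ fun _ _ => rfl
    ext w
    simp only [Finset.mem_filter]
    exact ⟨fun hw => hw.2, fun hw => ⟨h hw, hw⟩⟩

/-- The cone over a linearly independent set is described by the coordinate functions of a basis
containing the set. -/
theorem posCone_eq_of_linearIndepOn {B : Finset V} (hB : LinearIndepOn ℝ id (B : Set V)) :
    ∃ (I : Set V) (b : Basis I ℝ V) (e : B → I), (∀ w : B, b (e w) = w) ∧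
      posCone B = {y | ∀ i, (i ∈ range e → 0 ≤ b.coord i y) ∧ (i ∉ range e → b.coord i y = 0)} ∧
      ∀ y ∈ posCone B, ∑ w : B, b.coord (e w) y • (w : V) = y := by
  classical
  set b := Basis.extend hB with hb
  let e : B → ↥(hB.extend (subset_univ (B : Set V))) := fun w =>
    ⟨w, hB.subset_extend (subset_univ _) w.2⟩
  have hbe : ∀ w : B, b (e w) = w := fun w => by rw [hb, Basis.extend_apply_self]
  have he : Function.Injective e := fun v w h => Subtype.ext (congrArg Subtype.val h :)
  have hsumB : ∀ y, (∀ i, i ∉ range e → b.coord i y = 0) → ∑ w : B, b.coord (e w) y • (w : V) = y := by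
    intro y hy
    apply b.ext_elem
    intro i
    rw [map_sum, Finsupp.finsetSum_apply]
    simp only [map_smul, Finsupp.smul_apply, smul_eq_mul, ← hbe, b.repr_self]
    by_cases hi : i ∈ range e
    · obtain ⟨w, rfl⟩ := hi
      rw [Finset.sum_eq_single w]
      · simp
      · intro v _ hv
        rw [Finsupp.single_eq_of_ne' (fun h => hv (he h)), mul_zero]
      · simp
    · rw [Finset.sum_eq_zero]
      · exact (hy i hi).symm
      · intro v _
        rw [Finsupp.single_eq_of_ne' (fun h => hi ⟨v, h⟩), mul_zero]
  have hset : posCone B =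
      {y | ∀ i, (i ∈ range e → 0 ≤ b.coord i y) ∧ (i ∉ range e → b.coord i y = 0)} := by
    ext y
    constructor
    · rintro ⟨c, hc, rfl⟩ i
      have hval : b.coord i (∑ w ∈ B, c w • w) = ∑ w : B, c w * (Finsupp.single (e w) (1 : ℝ)) i := by
        rw [map_sum, ← Finset.sum_coe_sort B]
        refine Finset.sum_congr rfl fun w _ => ?_
        have hrep : b.repr (w : V) = Finsupp.single (e w) 1 := by rw [← hbe w, b.repr_self]
        rw [map_smul, smul_eq_mul, Basis.coord_apply, hrep]
      rw [hval]
      constructor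
      · intro _
        refine Finset.sum_nonneg fun w _ => mul_nonneg (hc w w.2) ?_
        rw [Finsupp.single_apply]
        split_ifs <;> simp
      · intro hi
        refine Finset.sum_eq_zero fun w _ => ?_
        rw [Finsupp.single_eq_of_ne' (fun h => hi ⟨w, h⟩), mul_zero]
    · intro hy
      refine ⟨fun v => if hv : v ∈ B then b.coord (e ⟨v, hv⟩) y else 0, fun w hw => ?_, ?_⟩
      · simp only [hw, dif_pos]
        exact (hy _).1 ⟨_, rfl⟩
      · rw [← Finset.sum_coe_sort B]
        simp only [Finset.coe_mem, dif_pos]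
        exact hsumB y fun i hi => (hy i).2 hi
  refine ⟨_, b, e, hbe, hset, fun y hy => ?_⟩
  rw [hset] at hy
  exact hsumB y fun i hi => (hy i).2 hi

theorem isPolyhedralFan_posCone_of_linearIndepOn [FiniteDimensional ℝ V] {B : Finset V}
    (hB : LinearIndepOn ℝ id (B : Set V)) : IsPolyhedralFan (posCone B) := by
  obtain ⟨ι, b, e, -, hset, -⟩ := posCone_eq_of_linearIndepOn hB
  have := FiniteDimensional.fintypeBasisIndex b
  refine ⟨range b.coord, finite_range _, fun y hy y' hf => ?_⟩
  rw [hset] at hy ⊢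
  intro i
  have h1 : b.coord i y' = 0 ∨ SignType.sign (b.coord i y') = SignType.sign (b.coord i y) := by
    rcases hf ⟨b.coord i, i, rfl⟩ with h | h
    · exact Or.inl (sign_eq_zero_iff.1 h)
    · exact Or.inr h
  rcases h1 with h1 | h1
  · exact ⟨fun _ => h1.ge, fun _ => h1⟩
  · refine ⟨fun hi => ?_, fun hi => ?_⟩
    · rw [← sign_nonneg_iff, h1, sign_nonneg_iff]
      exact (hy i).1 hi
    · rw [(hy i).2 hi, sign_zero, sign_eq_zero_iff] at h1
      exact h1

theorem posCone_eq_biUnion (t : Finset V) :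
    posCone t = ⋃ B ∈ {B : Finset V | B ⊆ t ∧ LinearIndepOn ℝ id (B : Set V)}, posCone B := by
  ext y
  simp only [mem_iUnion, exists_prop]
  constructor
  · intro hy
    obtain ⟨B, hB, hBl, hyB⟩ := exists_linearIndepOn_posCone t hy
    exact ⟨B, ⟨hB, hBl⟩, hyB⟩
  · rintro ⟨B, ⟨hB, -⟩, hy⟩
    exact posCone_mono hB hy

theorem finite_linearIndepOn_subsets (t : Finset V) :
    {B : Finset V | B ⊆ t ∧ LinearIndepOn ℝ id (B : Set V)}.Finite :=
  (t.powerset.finite_toSet).subset fun B hB => by simpa using hB.1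

/-- By Carathéodory's theorem a finitely generated cone is the union of the cones spanned by its
linearly independent subsets of generators, and those are cut out by coordinates of a basis. -/
theorem isPolyhedralFan_posCone [FiniteDimensional ℝ V] (t : Finset V) :
    IsPolyhedralFan (posCone t) := by
  rw [posCone_eq_biUnion]
  exact isPolyhedralFan_biUnion (finite_linearIndepOn_subsets t) fun B hB =>
    isPolyhedralFan_posCone_of_linearIndepOn hB.2

end CellUnion

/-- The cone of the directions in which one can move inside `P` from `x`. -/
def tangentDirections {V : Type*} [AddCommGroup V] [Module ℝ V] (P : Set V) (x : V) : Set V :=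
  {y | ∃ ε : ℝ, 0 < ε ∧ x + ε • y ∈ P}

section TangentDirections

variable {V : Type*} [AddCommGroup V] [Module ℝ V]

/-- The tangent cone of a polytope at `x` is spanned by the differences of its vertices with `x`. -/
theorem tangentDirections_convexHull {t : Finset V} {x : V}
    (hx : x ∈ convexHull ℝ (t : Set V)) [DecidableEq V] :
    tangentDirections (convexHull ℝ (t : Set V)) x = posCone (t.image fun v => v - x) := by
  have hsumim : ∀ c : V → ℝ, ∑ w ∈ t.image (fun v => v - x), c w • w =
      ∑ v ∈ t, c (v - x) • (v - x) := fun c =>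
    Finset.sum_image fun v _ w _ h => sub_left_injective h
  ext y
  constructor
  · rintro ⟨ε, hε, hy⟩
    obtain ⟨c, hc, hc1, hcy⟩ := Finset.mem_convexHull'.1 hy
    refine ⟨fun w => ε⁻¹ * c (w + x), fun w hw => ?_, ?_⟩
    · obtain ⟨v, hv, rfl⟩ := Finset.mem_image.1 hw
      simp only [sub_add_cancel]
      exact mul_nonneg (inv_nonneg.2 hε.le) (hc v hv)
    · rw [hsumim]
      simp only [sub_add_cancel, mul_smul, ← Finset.smul_sum, smul_sub, Finset.sum_sub_distrib]
      rw [hcy, ← Finset.sum_smul, hc1, one_smul,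
        ← smul_sub, add_sub_cancel_left, smul_smul, inv_mul_cancel₀ hε.ne', one_smul]
  · rintro ⟨c, hc, rfl⟩
    rw [hsumim]
    set s := ∑ v ∈ t, c (v - x) with hs
    have hcv : ∀ v ∈ t, 0 ≤ c (v - x) := fun v hv => hc _ (Finset.mem_image_of_mem _ hv)
    have hs0 : 0 ≤ s := Finset.sum_nonneg hcv
    refine ⟨(1 + s)⁻¹, by positivity, ?_⟩
    have h1 : (1 + s) ≠ 0 := by positivity
    have h2 : x + (1 + s)⁻¹ • ∑ v ∈ t, c (v - x) • (v - x) =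
        (1 + s)⁻¹ • x + ∑ v ∈ t, ((1 + s)⁻¹ * c (v - x)) • v := by
      simp only [smul_sub, Finset.sum_sub_distrib, ← Finset.sum_smul, ← hs, Finset.smul_sum,
        smul_smul]
      have : x = (1 + s)⁻¹ • x + ((1 + s)⁻¹ * s) • x := by
        rw [← add_smul, ← mul_one_add, inv_mul_cancel₀ h1, one_smul]
      nth_rewrite 1 [this]
      abel
    rw [h2]
    have hconv := convex_convexHull ℝ (t : Set V)
    by_cases hs0' : s = 0
    · have : ∀ v ∈ t, c (v - x) = 0 := (Finset.sum_eq_zero_iff_of_nonneg hcv).1 (hs ▸ hs0')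
      rw [Finset.sum_eq_zero fun v hv => by rw [this v hv, mul_zero, zero_smul], hs0']
      simpa using hx
    · have h3 : ∑ v ∈ t, (s⁻¹ * c (v - x)) • v ∈ convexHull ℝ (t : Set V) := by
        refine hconv.sum_mem (fun v hv => mul_nonneg (inv_nonneg.2 hs0) (hcv v hv)) ?_
          fun v hv => subset_convexHull ℝ _ hv
        rw [← Finset.mul_sum, ← hs, inv_mul_cancel₀ hs0']
      have h4 : ∑ v ∈ t, ((1 + s)⁻¹ * c (v - x)) • v =
          ((1 + s)⁻¹ * s) • ∑ v ∈ t, (s⁻¹ * c (v - x)) • v := by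
        rw [Finset.smul_sum]
        refine Finset.sum_congr rfl fun v _ => ?_
        rw [smul_smul]
        congr 1
        field_simp
      rw [h4]
      refine hconv hx h3 (by positivity) (by positivity) ?_
      rw [← mul_one_add, inv_mul_cancel₀ h1]

/-- Moving along a convex set: the directions form a convex cone. -/
theorem add_mem_tangentDirections {P : Set V} (hP : Convex ℝ P) {x y z : V}
    (hy : y ∈ tangentDirections P x) (hz : z ∈ tangentDirections P x) :
    y + z ∈ tangentDirections P x := by
  obtain ⟨ε, hε, hy⟩ := hy
  obtain ⟨δ, hδ, hz⟩ := hz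
  refine ⟨ε * δ / (ε + δ), by positivity, ?_⟩
  have := hP hy hz (a := δ / (ε + δ)) (b := ε / (ε + δ)) (by positivity) (by positivity)
    (by field_simp; ring)
  have h2 : (δ / (ε + δ)) • (x + ε • y) + (ε / (ε + δ)) • (x + δ • z) =
      x + (ε * δ / (ε + δ)) • (y + z) := by
    have h3 : x = (δ / (ε + δ)) • x + (ε / (ε + δ)) • x := by
      rw [← add_smul, show δ / (ε + δ) + ε / (ε + δ) = 1 by field_simp; ring, one_smul]
    nth_rewrite 3 [h3]
    simp only [smul_add, smul_smul]
    rw [show δ / (ε + δ) * ε = ε * δ / (ε + δ) by ring,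
      show ε / (ε + δ) * δ = ε * δ / (ε + δ) by ring]
    abel
  rwa [h2] at this

end TangentDirections

/-- Near one of its points, a polytope coincides with its cone of tangent directions. -/
theorem IsPolytope.eventually_mem_iff {n : ℕ} {P : Set (Euc n)} (hP : IsPolytope P) {x : Euc n}
    (hx : x ∈ P) : ∀ᶠ y in 𝓝 x, y ∈ P ↔ y - x ∈ tangentDirections P x := by
  classical
  obtain ⟨s, hs, rfl⟩ := hP
  obtain ⟨t, rfl⟩ := hs.exists_finset_coe
  rw [tangentDirections_convexHull hx]
  set W := t.image fun v => v - x with hW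
  have key : ∀ B ∈ {B : Finset (Euc n) | B ⊆ W ∧ LinearIndepOn ℝ id (B : Set (Euc n))},
      ∀ᶠ y in 𝓝 x, y - x ∈ posCone B → y ∈ convexHull ℝ (t : Set (Euc n)) := by
    rintro B ⟨hBW, hB⟩
    obtain ⟨ι, b, e, -, hset, hsum⟩ := posCone_eq_of_linearIndepOn hB
    have hcont : Continuous fun y => ∑ w : B, b.coord (e w) (y - x) := by
      refine continuous_finsetSum _ fun w _ => ?_
      exact (b.coord (e w)).continuous_of_finiteDimensional.comp (by fun_prop)
    have hev : ∀ᶠ y in 𝓝 x, ∑ w : B, b.coord (e w) (y - x) < 1 := by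
      refine hcont.continuousAt.eventually_lt continuousAt_const ?_
      simp
    filter_upwards [hev] with y hy hyB
    have hrep := hsum _ hyB
    rw [hset] at hyB
    have hnn : ∀ w : B, 0 ≤ b.coord (e w) (y - x) := fun w => (hyB _).1 ⟨w, rfl⟩
    have hyx : y = (1 - ∑ w : B, b.coord (e w) (y - x)) • x +
        ∑ w : B, b.coord (e w) (y - x) • ((w : Euc n) + x) := by
      simp only [smul_add, Finset.sum_add_distrib, hrep, ← Finset.sum_smul, sub_smul, one_smul]
      abel
    have hmem : ∀ w : B, (w : Euc n) + x ∈ convexHull ℝ (t : Set (Euc n)) := by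
      intro w
      obtain ⟨v, hv, hvw⟩ := Finset.mem_image.1 (hBW w.2)
      rw [← hvw, sub_add_cancel]
      exact subset_convexHull ℝ _ hv
    rw [hyx]
    have hconv := convex_convexHull ℝ (t : Set (Euc n))
    have := hconv.sum_mem (t := Finset.univ) (w := fun o : Option B =>
      o.elim (1 - ∑ w : B, b.coord (e w) (y - x)) fun w => b.coord (e w) (y - x))
      (z := fun o : Option B => o.elim x fun w => (w : Euc n) + x)
      (by
        rintro (_ | w) _
        · simp only [Option.elim_none]; linarith
        · simpa using hnn w)
      (by rw [Fintype.sum_option]; simp)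
      (by
        rintro (_ | w) _
        · exact hx
        · exact hmem w)
    rw [Fintype.sum_option] at this
    simpa using this
  filter_upwards [(finite_linearIndepOn_subsets W).eventually_all.2 key] with y hy
  constructor
  · intro hyP
    rw [← tangentDirections_convexHull hx]
    exact ⟨1, one_pos, by simpa using hyP⟩
  · intro hyW
    obtain ⟨B, hB, hBl, hyB⟩ := exists_linearIndepOn_posCone W hyW
    exact hy B ⟨hB, hBl⟩ hyB

theorem IsPolytope.isPolyhedralFan_tangentDirections {n : ℕ} {P : Set (Euc n)} (hP : IsPolytope P)
    {x : Euc n} (hx : x ∈ P) : IsPolyhedralFan (tangentDirections P x) := by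
  classical
  obtain ⟨s, hs, rfl⟩ := hP
  obtain ⟨t, rfl⟩ := hs.exists_finset_coe
  rw [tangentDirections_convexHull hx]
  exact isPolyhedralFan_posCone _

theorem IsPolytope.convex {n : ℕ} {P : Set (Euc n)} (hP : IsPolytope P) : Convex ℝ P := by
  obtain ⟨s, hs, rfl⟩ := hP
  exact convex_convexHull ℝ s

/-! ### The normal fan of a face -/

theorem eventually_add_smul_mem_of_mem_intrinsicInterior {n : ℕ} {F : Set (Euc n)} {x v : Euc n}
    (hx : x ∈ intrinsicInterior ℝ F) (hv : v ∈ vectorSpan ℝ F) :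
    ∀ᶠ ε in 𝓝 (0 : ℝ), x + ε • v ∈ F := by
  obtain ⟨y, hy, rfl⟩ := mem_intrinsicInterior.1 hx
  have hmem : ∀ ε : ℝ, (y : Euc n) + ε • v ∈ affineSpan ℝ F := by
    intro ε
    have h1 : ε • v ∈ (affineSpan ℝ F).direction := by
      rw [direction_affineSpan]
      exact Submodule.smul_mem _ _ hv
    have := AffineSubspace.vadd_mem_of_mem_direction h1 y.2
    rwa [vadd_eq_add, add_comm] at this
  let f : ℝ → affineSpan ℝ F := fun ε => ⟨y + ε • v, hmem ε⟩
  have hf : Continuous f := Continuous.subtype_mk (by fun_prop) _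
  have hf0 : f 0 = y := Subtype.ext (by simp [f])
  have : ∀ᶠ ε in 𝓝 (0 : ℝ), f ε ∈ interior ((↑) ⁻¹' F : Set (affineSpan ℝ F)) := by
    refine hf.continuousAt.eventually_mem ?_
    rw [hf0]
    exact isOpen_interior.mem_nhds hy
  filter_upwards [this] with ε hε
  exact (interior_subset hε : f ε ∈ ((↑) ⁻¹' F : Set (affineSpan ℝ F)))

/-- The directions along a face at a relative interior point lie in the tangent cone. -/
theorem vectorSpan_subset_tangentDirections {n : ℕ} {F P : Set (Euc n)} (hFP : F ⊆ P) {x v : Euc n}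
    (hx : x ∈ intrinsicInterior ℝ F) (hv : v ∈ vectorSpan ℝ F) : v ∈ tangentDirections P x := by
  have h := (eventually_add_smul_mem_of_mem_intrinsicInterior hx hv).filter_mono
    (nhdsWithin_le_nhds (s := Ioi (0 : ℝ)))
  obtain ⟨ε, hε, hε0⟩ := (h.and self_mem_nhdsWithin).exists
  exact ⟨ε, hε0, hFP hε⟩

/-- A relative interior point `x'` of `F` is a proper convex combination of any `x ∈ F` and a
further point of `F`, and a segment from `x` into `P` shrinks to a segment from `x'` into `P`. -/
theorem tangentDirections_subset_of_mem_intrinsicInterior {n : ℕ} {F P : Set (Euc n)} (hFP : F ⊆ P)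
    (hP : Convex ℝ P) {x x' : Euc n} (hx : x ∈ F) (hx' : x' ∈ intrinsicInterior ℝ F) :
    tangentDirections P x ⊆ tangentDirections P x' := by
  rintro y ⟨ε, hε, hy⟩
  have hv : x' - x ∈ vectorSpan ℝ F :=
    vsub_mem_vectorSpan ℝ (intrinsicInterior_subset hx') hx
  have h := (eventually_add_smul_mem_of_mem_intrinsicInterior hx' hv).filter_mono
    (nhdsWithin_le_nhds (s := Ioi (0 : ℝ)))
  obtain ⟨δ, hδ, hδ0⟩ := (h.and self_mem_nhdsWithin).exists
  have hδ0' : 0 < δ := hδ0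
  refine ⟨δ / (1 + δ) * ε, by positivity, ?_⟩
  have hc := hP (hFP hδ) hy (a := 1 / (1 + δ)) (b := δ / (1 + δ)) (by positivity) (by positivity)
    (by field_simp)
  convert hc using 1
  simp only [smul_add, smul_sub, smul_smul]
  rw [show (1 / (1 + δ) * δ) = δ / (1 + δ) by ring]
  have : x' = (1 / (1 + δ)) • x' + (δ / (1 + δ)) • x' := by
    rw [← add_smul, show 1 / (1 + δ) + δ / (1 + δ) = 1 by field_simp, one_smul]
  nth_rewrite 1 [this]
  abel

theorem tangentDirections_eq_of_mem_intrinsicInterior {n : ℕ} {F P : Set (Euc n)} (hFP : F ⊆ P)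
    (hP : Convex ℝ P) {x x' : Euc n} (hx : x ∈ intrinsicInterior ℝ F)
    (hx' : x' ∈ intrinsicInterior ℝ F) : tangentDirections P x = tangentDirections P x' :=
  (tangentDirections_subset_of_mem_intrinsicInterior hFP hP (intrinsicInterior_subset hx) hx').antisymm
    (tangentDirections_subset_of_mem_intrinsicInterior hFP hP (intrinsicInterior_subset hx') hx)

/-- A cell of a polyhedral complex that meets the relative interior of another cell contains it. -/
theorem PolyComplex.subset_of_mem_intrinsicInterior {n : ℕ} (K : PolyComplex n) {F P : Set (Euc n)}
    (hF : F ∈ K.cells) (hP : P ∈ K.cells) {x : Euc n} (hx : x ∈ intrinsicInterior ℝ F) (hxP : x ∈ P) :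
    F ⊆ P := by
  have hxF := intrinsicInterior_subset hx
  obtain ⟨l, hl⟩ := K.inter_face F hF P hP ⟨x, hxF, hxP⟩
  have hxmax : ∀ y ∈ F, l y ≤ l x := by
    have : x ∈ F ∩ P := ⟨hxF, hxP⟩
    rw [hl] at this
    exact this.2
  intro z hz
  -- a linear form that is maximal at a relative interior point is constant on the face
  have hlz : l z = l x := by
    refine le_antisymm (hxmax z hz) ?_
    have hv : x - z ∈ vectorSpan ℝ F := vsub_mem_vectorSpan ℝ hxF hz
    have h := (eventually_add_smul_mem_of_mem_intrinsicInterior hx hv).filter_mono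
      (nhdsWithin_le_nhds (s := Ioi (0 : ℝ)))
    obtain ⟨δ, hδ, hδ0⟩ := (h.and self_mem_nhdsWithin).exists
    have hδ0' : 0 < δ := hδ0
    have := hxmax _ hδ
    rw [map_add, map_smul, map_sub, smul_eq_mul] at this
    nlinarith
  have : z ∈ F ∩ P := by
    rw [hl]
    exact ⟨hz, fun y hy => by rw [hlz]; exact hxmax y hy⟩
  exact this.2

/-- Near a relative interior point of a face only the cells that contain the face are met, and each
of them agrees with its tangent cone. -/
theorem PolyComplex.eventually_mem_space_iff {n : ℕ} (K : PolyComplex n) {F : Set (Euc n)}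
    (hF : F ∈ K.cells) {x : Euc n} (hx : x ∈ intrinsicInterior ℝ F) :
    ∀ᶠ y in 𝓝 x, y ∈ K.space ↔
      y - x ∈ ⋃ P ∈ {P | P ∈ K.cells ∧ F ⊆ P}, tangentDirections P x := by
  have hxF := intrinsicInterior_subset hx
  have key : ∀ P ∈ K.cells, ∀ᶠ y in 𝓝 x, (F ⊆ P → (y ∈ P ↔ y - x ∈ tangentDirections P x)) ∧
      (¬ F ⊆ P → y ∉ P) := by
    intro P hP
    by_cases hFP : F ⊆ P
    · filter_upwards [(K.polytope P hP).eventually_mem_iff (hFP hxF)] with y hy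
      exact ⟨fun _ => hy, fun h => (h hFP).elim⟩
    · have hxP : x ∉ P := fun h => hFP (K.subset_of_mem_intrinsicInterior hF hP hx h)
      filter_upwards [(K.polytope P hP).isCompact.isClosed.isOpen_compl.mem_nhds hxP] with y hy
      exact ⟨fun h => (hFP h).elim, fun _ => hy⟩
  filter_upwards [K.finite.eventually_all.2 key] with y hy
  simp only [PolyComplex.space, mem_sUnion, mem_iUnion, exists_prop]
  constructor
  · rintro ⟨P, hP, hyP⟩
    have hFP : F ⊆ P := by
      by_contra h
      exact (hy P hP).2 h hyP
    exact ⟨P, ⟨hP, hFP⟩, ((hy P hP).1 hFP).1 hyP⟩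
  · rintro ⟨P, ⟨hP, hFP⟩, hyP⟩
    exact ⟨P, hP, ((hy P hP).1 hFP).2 hyP⟩

/-- `u` and `Δ` span the normal fan of `X` along `F`: near each relative interior point `x` of `F`,
the set `X` is the product of the affine hull of `F` and the translate to `x` of a simplicial fan
in the orthogonal complement. -/
structure IsNormalFan {n : ℕ} (X F : Set (Euc n)) {m : ℕ} (u : Fin m → (vectorSpan ℝ F)ᗮ)
    (Δ : Set (Finset (Fin m))) : Prop where
  ne_zero : ∀ i, u i ≠ 0
  isSimplicialFan : IsSimplicialFan u Δ
  eventually_mem_iff : ∀ x ∈ intrinsicInterior ℝ F, ∀ᶠ y in 𝓝 x,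
    y ∈ X ↔ (vectorSpan ℝ F)ᗮ.orthogonalProjectionOnto (y - x) ∈ fanSet u Δ

theorem isPolyhedralFan_comap {V W : Type*} [AddCommGroup V] [Module ℝ V] [AddCommGroup W]
    [Module ℝ W] (f : W →ₗ[ℝ] V) {C : Set V} (hC : IsPolyhedralFan C) :
    IsPolyhedralFan (f ⁻¹' C) := by
  obtain ⟨H, hH, hHC⟩ := hC
  refine ⟨(fun g => g ∘ₗ f) '' H, hH.image _, fun y hy y' hf => ?_⟩
  exact hHC (f y) hy (f y') fun j => hf ⟨_, j, j.2, rfl⟩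

theorem IsPolyhedralFan.exists_simplicialFan {V : Type*} [AddCommGroup V] [Module ℝ V]
    [FiniteDimensional ℝ V] {C : Set V} (hC : IsPolyhedralFan C) (hne : C.Nonempty) :
    ∃ (m : ℕ) (u : Fin m → V) (Δ : Set (Finset (Fin m))),
      (∀ i, u i ≠ 0) ∧ IsSimplicialFan u Δ ∧ fanSet u Δ = C := by
  obtain ⟨H, hH, hHC⟩ := hC
  let b := finBasis ℝ V
  -- the coordinate hyperplanes are added to make the intersection of all hyperplanes trivial
  have hfin : (H ∪ range b.coord).Finite := hH.union (finite_range _)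
  have := hfin.fintype
  refine _root_.exists_simplicialFan (h := (Subtype.val : ↥(H ∪ range b.coord) → V →ₗ[ℝ] ℝ))
    (fun y hy => ?_) (hHC.mono subset_union_left) hne
  refine b.ext_elem fun i => ?_
  simpa using hy ⟨b.coord i, Or.inr ⟨i, rfl⟩⟩

/-- The union of the tangent cones of the cells containing `F` is the same at all relative interior
points of `F` and is invariant under translations along `F`, hence it is determined by its trace on
the orthogonal complement, which has a simplicial subdivision. -/
theorem PolyComplex.exists_isNormalFan {n : ℕ} (K : PolyComplex n) {F : Set (Euc n)}
    (hF : F ∈ K.cells) : ∃ (m : ℕ) (u : Fin m → (vectorSpan ℝ F)ᗮ) (Δ : Set (Finset (Fin m))),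
      IsNormalFan K.space F u Δ := by
  set E := vectorSpan ℝ F with hE
  obtain ⟨x₀, hx₀⟩ := (K.nonempty F hF).intrinsicInterior (K.polytope F hF).convex
  have hx₀F := intrinsicInterior_subset hx₀
  set C := ⋃ P ∈ {P | P ∈ K.cells ∧ F ⊆ P}, tangentDirections P x₀ with hC
  have hCfan : IsPolyhedralFan C := by
    refine isPolyhedralFan_biUnion (K.finite.subset fun P hP => hP.1) ?_
    rintro P ⟨hP, hFP⟩
    exact (K.polytope P hP).isPolyhedralFan_tangentDirections (hFP hx₀F)
  have hCadd : ∀ y ∈ C, ∀ v ∈ E, y + v ∈ C := by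
    intro y hy v hv
    obtain ⟨P, ⟨hP, hFP⟩, hyP⟩ := mem_iUnion₂.1 hy
    exact mem_iUnion₂.2 ⟨P, ⟨hP, hFP⟩, add_mem_tangentDirections (K.polytope P hP).convex hyP
      (vectorSpan_subset_tangentDirections hFP hx₀ hv)⟩
  have hC0 : (0 : Euc n) ∈ C := mem_iUnion₂.2 ⟨F, ⟨hF, subset_rfl⟩,
    vectorSpan_subset_tangentDirections subset_rfl hx₀ (Submodule.zero_mem _)⟩
  obtain ⟨m, u, Δ, hu0, hu, hfan⟩ :=
    (isPolyhedralFan_comap Eᗮ.subtype hCfan).exists_simplicialFan ⟨0, by simpa using hC0⟩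
  refine ⟨m, u, Δ, hu0, hu, fun x hx => ?_⟩
  filter_upwards [K.eventually_mem_space_iff hF hx] with y hy
  have hCx : (⋃ P ∈ {P | P ∈ K.cells ∧ F ⊆ P}, tangentDirections P x) = C :=
    iUnion₂_congr fun P hP =>
      tangentDirections_eq_of_mem_intrinsicInterior hP.2 (K.polytope P hP.1).convex hx hx₀
  refine hy.trans ?_
  change y - x ∈ (⋃ P ∈ {P | P ∈ K.cells ∧ F ⊆ P}, tangentDirections P x) ↔ _
  rw [hCx, hfan]
  change y - x ∈ C ↔ ((Eᗮ.orthogonalProjectionOnto (y - x) : Eᗮ) : Euc n) ∈ C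
  have hd : (y - x) - ((Eᗮ.orthogonalProjectionOnto (y - x) : Eᗮ) : Euc n) ∈ E := by
    have := Eᗮ.sub_starProjection_mem_orthogonal (y - x)
    rwa [Submodule.orthogonal_orthogonal] at this
  constructor
  · intro h
    have := hCadd _ h _ (E.neg_mem hd)
    simpa using this
  · intro h
    have := hCadd _ h _ hd
    simpa using this

/-- The index of the normal slice of `X` at a point of the face `F`. -/
theorem IsNormalFan.index_normalSpace (ρ : CurvatureMap) {n : ℕ} {X F : Set (Euc n)} {m : ℕ}
    {u : Fin m → (vectorSpan ℝ F)ᗮ} {Δ : Set (Finset (Fin m))} (h : IsNormalFan X F u Δ)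
    {x : Euc n} (hx : x ∈ intrinsicInterior ℝ F) {a : (vectorSpan ℝ F)ᗮ}
    (ha : ∀ i, inner ℝ (u i) a ≠ 0) :
    ρ.index (X ∩ CurvatureMap.normalSpace F x) x (a : Euc n) =
      ρ.cubeVal Δ {i | 0 < inner ℝ (u i) a} := by
  have hcoe : ∀ c : Euc m, ∑ i, c i • (u i : Euc n) = ((∑ i, c i • u i : (vectorSpan ℝ F)ᗮ) : Euc n) :=
    fun c => by simp
  have hfan : IsSimplicialFan (fun i => (u i : Euc n)) Δ := by
    intro c hc d hd hcd
    rw [hcoe, hcoe] at hcd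
    exact h.isSimplicialFan c hc d hd (Subtype.ext hcd)
  refine ρ.index_eq_cubeVal hfan (a := a) ha ?_
  filter_upwards [h.eventually_mem_iff x hx] with y hy
  constructor
  · rintro ⟨hyX, hyN⟩
    obtain ⟨c, hc, hcy⟩ := hy.1 hyX
    refine ⟨c, hc, ?_⟩
    rw [hcoe, hcy]
    exact Submodule.starProjection_eq_self_iff.2 hyN
  · rintro ⟨c, hc, hcy⟩
    have hyN : y - x ∈ (vectorSpan ℝ F)ᗮ := by
      rw [← hcy, hcoe]
      exact Subtype.property _
    refine ⟨hy.2 ⟨c, hc, Subtype.ext ?_⟩, hyN⟩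
    rw [← hcoe, hcy]
    exact (Submodule.starProjection_eq_self_iff.2 hyN).symm

/-! ### Orthogonal matrices as isometries -/

namespace OGroup

variable {n : ℕ}

theorem lin_mul (A B : OGroup n) (x : Euc n) : (A * B).lin x = A.lin (B.lin x) := by
  simp [OGroup.lin, Matrix.toLpLin_apply]

@[simp] theorem lin_one (x : Euc n) : (1 : OGroup n).lin x = x := by
  simp [OGroup.lin]

@[simp] theorem lin_inv_lin (A : OGroup n) (x : Euc n) : A⁻¹.lin (A.lin x) = x := by
  rw [← lin_mul, inv_mul_cancel, lin_one]

@[simp] theorem lin_lin_inv (A : OGroup n) (x : Euc n) : A.lin (A⁻¹.lin x) = x := by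
  rw [← lin_mul, mul_inv_cancel, lin_one]

theorem inner_lin_left (A : OGroup n) (x y : Euc n) :
    inner ℝ (A.lin x) y = inner ℝ x (A⁻¹.lin y) := by
  have h : (A⁻¹).lin = LinearMap.adjoint A.lin := by
    rw [OGroup.lin, OGroup.lin, ← Matrix.toEuclideanLin_conjTranspose_eq_adjoint]
    rfl
  rw [h, LinearMap.adjoint_inner_right]

theorem inner_lin_lin (A : OGroup n) (x y : Euc n) :
    inner ℝ (A.lin x) (A.lin y) = inner ℝ x y := by
  rw [inner_lin_left, lin_inv_lin]

/-- The linear isometry of an orthogonal matrix. -/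
noncomputable def isometryEquiv (A : OGroup n) : Euc n ≃ₗᵢ[ℝ] Euc n where
  toLinearEquiv := LinearEquiv.ofLinearMap A.lin A⁻¹.lin (by ext1 x; simp) (by ext1 x; simp)
  norm_map' x := by
    change ‖A.lin x‖ = ‖x‖
    rw [norm_eq_sqrt_real_inner, inner_lin_lin, ← norm_eq_sqrt_real_inner]

@[simp] theorem norm_lin (A : OGroup n) (x : Euc n) : ‖A.lin x‖ = ‖x‖ := A.isometryEquiv.norm_map x

theorem lin_injective (A : OGroup n) : Function.Injective A.lin := A.isometryEquiv.injective

theorem continuous_lin : Continuous fun p : OGroup n × Euc n => p.1.lin p.2 := by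
  have h : Continuous fun p : OGroup n × Euc n =>
      (WithLp.toLp 2 ((p.1 : Matrix (Fin n) (Fin n) ℝ).mulVec p.2.ofLp) : Euc n) := by
    refine (PiLp.continuous_toLp 2 _).comp ?_
    exact (continuous_subtype_val.comp continuous_fst).matrix_mulVec (by fun_prop)
  exact h

/-- Every linear isometry of `E^n` is given by an orthogonal matrix. -/
theorem exists_lin_eq (e : Euc n ≃ₗᵢ[ℝ] Euc n) : ∃ A : OGroup n, ∀ x, A.lin x = e x := by
  set M : Matrix (Fin n) (Fin n) ℝ := Matrix.toEuclideanLin.symm e.toLinearMap with hM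
  have hMe : Matrix.toEuclideanLin M = e.toLinearMap := by rw [hM, LinearEquiv.apply_symm_apply]
  have hmem : M ∈ Matrix.orthogonalGroup (Fin n) ℝ := by
    rw [Matrix.mem_orthogonalGroup_iff']
    change star M * M = 1
    apply Matrix.toEuclideanLin.injective
    have h1 : Matrix.toEuclideanLin (star M) = LinearMap.adjoint (Matrix.toEuclideanLin M) :=
      Matrix.toEuclideanLin_conjTranspose_eq_adjoint M
    ext1 x
    have h2 : Matrix.toEuclideanLin (star M * M) x =
        Matrix.toEuclideanLin (star M) (Matrix.toEuclideanLin M x) := by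
      simp [Matrix.toLpLin_apply]
    rw [h2, h1, hMe]
    refine ext_inner_right ℝ fun y => ?_
    rw [LinearMap.adjoint_inner_left]
    change inner ℝ (e x) (e y) = _
    rw [e.inner_map_map]
    simp
  exact ⟨⟨M, hmem⟩, fun x => LinearMap.congr_fun hMe x⟩

end OGroup

/-! ### The index of a transversal intersection -/

/-- The value of a curvature map on the cubical pair of a fan and a direction; the index of the
fan, for generic directions. -/
noncomputable def CurvatureMap.fanVal (ρ : CurvatureMap) {V : Type*} [NormedAddCommGroup V]
    [InnerProductSpace ℝ V] {m : ℕ} (u : Fin m → V) (Δ : Set (Finset (Fin m))) (b : V) : ℝ :=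
  ρ.cubeVal Δ {i | 0 < inner ℝ (u i) b}

/-- The sum map from the product of `V₁` and `A V₂` to the ambient space. -/
noncomputable def sumMap {n : ℕ} (V₁ V₂ : Submodule ℝ (Euc n)) (A : OGroup n) :
    V₁ × V₂ →ₗ[ℝ] Euc n :=
  V₁.subtype.coprod (A.lin ∘ₗ V₂.subtype)

theorem sumMap_apply {n : ℕ} (V₁ V₂ : Submodule ℝ (Euc n)) (A : OGroup n) (p : V₁ × V₂) :
    sumMap V₁ V₂ A p = (p.1 : Euc n) + A.lin p.2 := by
  simp [sumMap]

/-- The adjoint of `sumMap`: the pair of the orthogonal projections. -/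
noncomputable def projMap {n : ℕ} (V₁ V₂ : Submodule ℝ (Euc n)) (A : OGroup n) :
    Euc n →ₗ[ℝ] V₁ × V₂ :=
  (V₁.orthogonalProjectionOnto : Euc n →ₗ[ℝ] V₁).prod
    ((V₂.orthogonalProjectionOnto : Euc n →ₗ[ℝ] V₂) ∘ₗ A⁻¹.lin)

theorem inner_sumMap {n : ℕ} (V₁ V₂ : Submodule ℝ (Euc n)) (A : OGroup n) (y : Euc n)
    (p : V₁ × V₂) : inner ℝ y (sumMap V₁ V₂ A p) =
      inner ℝ (projMap V₁ V₂ A y).1 p.1 + inner ℝ (projMap V₁ V₂ A y).2 p.2 := by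
  have h1 : inner ℝ (projMap V₁ V₂ A y).1 p.1 = inner ℝ y (p.1 : Euc n) :=
    V₁.inner_orthogonalProjectionOnto_eq_of_mem_right p.1 y
  have h2 : inner ℝ (projMap V₁ V₂ A y).2 p.2 = inner ℝ (A⁻¹.lin y) (p.2 : Euc n) :=
    V₂.inner_orthogonalProjectionOnto_eq_of_mem_right p.2 (A⁻¹.lin y)
  rw [sumMap_apply, inner_add_right, h1, h2, OGroup.inner_lin_left, inv_inv]

theorem bijective_projMap {n : ℕ} {V₁ V₂ : Submodule ℝ (Euc n)} {A : OGroup n}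
    (h : Function.Bijective (sumMap V₁ V₂ A)) : Function.Bijective (projMap V₁ V₂ A) := by
  have hinj : Function.Injective (projMap V₁ V₂ A) := by
    refine (injective_iff_map_eq_zero _).2 fun y hy => ?_
    obtain ⟨p, hp⟩ := h.2 y
    have := inner_sumMap V₁ V₂ A y p
    rw [hp, hy] at this
    simpa using this
  refine ⟨hinj, ?_⟩
  refine (LinearMap.injective_iff_surjective_of_finrank_eq_finrank ?_).1 hinj
  exact (LinearEquiv.ofBijective _ h).finrank_eq.symm

/-- Where the faces `F₁` and `g F₂` meet transversally in relative interior points, the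
intersection of the spaces is, in the linear coordinates given by the two projections, the product
of the normal fans; hence its index is the product of the indices of the fans. -/
theorem index_inter_image (ρ : CurvatureMap) {n : ℕ} {X₁ X₂ F₁ F₂ : Set (Euc n)} {m₁ m₂ : ℕ}
    {u₁ : Fin m₁ → (vectorSpan ℝ F₁)ᗮ} {Δ₁ : Set (Finset (Fin m₁))}
    {u₂ : Fin m₂ → (vectorSpan ℝ F₂)ᗮ} {Δ₂ : Set (Finset (Fin m₂))}
    (h₁ : IsNormalFan X₁ F₁ u₁ Δ₁) (h₂ : IsNormalFan X₂ F₂ u₂ Δ₂) {g : Motion n}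
    (hg : Function.Bijective (sumMap (vectorSpan ℝ F₁)ᗮ (vectorSpan ℝ F₂)ᗮ g.1))
    {x : Euc n} (hx₁ : x ∈ intrinsicInterior ℝ F₁) (hx₂ : x ∈ g.image (intrinsicInterior ℝ F₂))
    {b : (vectorSpan ℝ F₁)ᗮ × (vectorSpan ℝ F₂)ᗮ} (hb₁ : ∀ i, inner ℝ (u₁ i) b.1 ≠ 0)
    (hb₂ : ∀ i, inner ℝ (u₂ i) b.2 ≠ 0) :
    ρ.index (X₁ ∩ g.image X₂) x (sumMap _ _ g.1 b) =
      ρ.fanVal u₁ Δ₁ b.1 * ρ.fanVal u₂ Δ₂ b.2 := by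
  obtain ⟨x₂, hx₂, hxx₂⟩ := hx₂
  let L : Euc n ≃ₗ[ℝ] (vectorSpan ℝ F₁)ᗮ × (vectorSpan ℝ F₂)ᗮ := LinearEquiv.ofBijective _ (bijective_projMap hg)
  have hL : ∀ y, L y = projMap _ _ g.1 y := fun y => rfl
  let w : Fin (m₁ + m₂) → Euc n := fun i =>
    Fin.addCases (fun i => L.symm (u₁ i, 0)) (fun i => L.symm (0, u₂ i)) i
  have hwl : ∀ i, w (Fin.castAdd m₂ i) = L.symm (u₁ i, 0) := fun i => by simp [w]
  have hwr : ∀ i, w (Fin.natAdd m₁ i) = L.symm (0, u₂ i) := fun i => by simp [w]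
  have hsum : ∀ c : Euc (m₁ + m₂), L (∑ i, c i • w i) =
      (∑ i, c (Fin.castAdd m₂ i) • u₁ i, ∑ i, c (Fin.natAdd m₁ i) • u₂ i) := by
    intro c
    rw [Fin.sum_univ_add, map_add, map_sum, map_sum]
    simp only [hwl, hwr, map_smul, LinearEquiv.apply_symm_apply, Prod.smul_mk, smul_zero]
    ext1
    · simp [Prod.fst_sum]
    · simp [Prod.snd_sum]
  have hil : ∀ i, inner ℝ (w (Fin.castAdd m₂ i)) (sumMap _ _ g.1 b) = inner ℝ (u₁ i) b.1 := by
    intro i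
    rw [inner_sumMap, ← hL, hwl, LinearEquiv.apply_symm_apply]
    simp
  have hir : ∀ i, inner ℝ (w (Fin.natAdd m₁ i)) (sumMap _ _ g.1 b) = inner ℝ (u₂ i) b.2 := by
    intro i
    rw [inner_sumMap, ← hL, hwr, LinearEquiv.apply_symm_apply]
    simp
  have hfan : IsSimplicialFan w (joinComplex Δ₁ Δ₂) := by
    intro c hc d hd hcd
    have h := congrArg L hcd
    rw [hsum, hsum, Prod.mk.injEq] at h
    rw [mem_coneComplex_join] at hc hd
    have e₁ := h₁.isSimplicialFan _ hc.1 _ hd.1 h.1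
    have e₂ := h₂.isSimplicialFan _ hc.2 _ hd.2 h.2
    ext i
    induction i using Fin.addCases with
    | left i => exact congrFun (WithLp.toLp_injective 2 e₁) i
    | right i => exact congrFun (WithLp.toLp_injective 2 e₂) i
  have hfanSet : ∀ y, y ∈ fanSet w (joinComplex Δ₁ Δ₂) ↔
      (L y).1 ∈ fanSet u₁ Δ₁ ∧ (L y).2 ∈ fanSet u₂ Δ₂ := by
    intro y
    constructor
    · rintro ⟨c, hc, rfl⟩
      rw [mem_coneComplex_join] at hc
      rw [hsum]
      exact ⟨⟨_, hc.1, rfl⟩, ⟨_, hc.2, rfl⟩⟩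
    · rintro ⟨⟨c, hc, hcy⟩, ⟨d, hd, hdy⟩⟩
      refine ⟨WithLp.toLp 2 fun i => Fin.addCases (fun i => c i) (fun i => d i) i, ?_, ?_⟩
      · rw [mem_coneComplex_join]
        simp only [Fin.addCases_left, Fin.addCases_right]
        exact ⟨hc, hd⟩
      · apply L.injective
        rw [hsum]
        simp only [Fin.addCases_left, Fin.addCases_right]
        exact Prod.ext hcy hdy
  have hX : ∀ᶠ y in 𝓝 x, y ∈ X₁ ∩ g.image X₂ ↔ y - x ∈ fanSet w (joinComplex Δ₁ Δ₂) := by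
    have hcont : Tendsto (fun y => g.1⁻¹.lin (y - g.2)) (𝓝 x) (𝓝 x₂) := by
      have h1 : Continuous fun y => g.1⁻¹.lin (y - g.2) :=
        g.1⁻¹.isometryEquiv.continuous.comp (by fun_prop)
      have h2 := h1.tendsto x
      rwa [← hxx₂, show g.1⁻¹.lin (g.1.lin x₂ + g.2 - g.2) = x₂ by simp, hxx₂] at h2
    filter_upwards [h₁.eventually_mem_iff x hx₁, hcont.eventually (h₂.eventually_mem_iff x₂ hx₂)]
      with y hy₁ hy₂
    have himg : y ∈ g.image X₂ ↔ g.1⁻¹.lin (y - g.2) ∈ X₂ := by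
      constructor
      · rintro ⟨z, hz, rfl⟩
        simpa using hz
      · intro hz
        exact ⟨_, hz, by simp⟩
    have hdiff : g.1⁻¹.lin (y - g.2) - x₂ = g.1⁻¹.lin (y - x) := by
      rw [← hxx₂]
      simp only [map_sub, map_add, OGroup.lin_inv_lin]
      abel
    rw [mem_inter_iff, himg, hy₁, hy₂, hdiff, hfanSet]
    rfl
  rw [ρ.index_eq_cubeVal hfan ?_ hX]
  · refine ρ.cubeVal_join _ _ _ _ _ (fun i => ?_) fun i => ?_
    · simp only [mem_ofPred_eq, hil]
    · simp only [mem_ofPred_eq, hir]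
  · intro i
    induction i using Fin.addCases with
    | left i => rw [hil]; exact hb₁ i
    | right i => rw [hir]; exact hb₂ i

/-! ### Spherical averages of homogeneous functions -/

section SphereAverage

open scoped Pointwise

variable {V : Type} [NormedAddCommGroup V] [InnerProductSpace ℝ V] [FiniteDimensional ℝ V]
  [MeasurableSpace V] [BorelSpace V]

/-- Integration in polar coordinates: the integral of the product of a function that is constant
on rays and a radial function is the spherical average of the former times the integral of the
latter. -/
theorem integral_mul_radial_eq_sphereAverage {f K : V → ℝ} (hf : ∀ t : ℝ, 0 < t → ∀ y, f (t • y) = f y)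
    (hK : ∀ y z : V, ‖y‖ = ‖z‖ → K y = K z) :
    ∫ y, f y * K y = sphereAverage V f * ∫ y, K y := by
  unfold sphereAverage
  split_ifs with h0
  · have := finrank_zero_iff.1 h0
    rw [← integral_const_mul]
    exact integral_congr_ae (Eventually.of_forall fun y => by
      change f y * K y = f 0 * K y
      rw [Subsingleton.elim y 0])
  · have : Nontrivial V := nontrivial_of_finrank_pos (Nat.pos_of_ne_zero h0)
    obtain ⟨e, he⟩ := exists_norm_eq V zero_le_one
    set κ : ℝ → ℝ := fun r => K (r • e) with hκ
    have hKκ : ∀ y, K y = κ ‖y‖ := fun y => hK _ _ (by simp [norm_smul, he])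
    have polar : ∀ g : V → ℝ, (∀ t : ℝ, 0 < t → ∀ y, g (t • y) = g y) →
        ∫ y, g y * K y = (∫ a : Metric.sphere (0 : V) 1, g a ∂((volume : Measure V).toSphere)) *
          ∫ r : Ioi (0 : ℝ), κ r ∂(Measure.volumeIoiPow (finrank ℝ V - 1)) := by
      intro g hg
      calc ∫ y, g y * K y = ∫ y : ({(0 : V)}ᶜ : Set V), g y * K y
              ∂((volume : Measure V).comap (↑)) := by
            rw [integral_subtype_comap (measurableSet_singleton _).compl fun y : V => g y * K y,
              restrict_compl_singleton]
        _ = ∫ p : Metric.sphere (0 : V) 1 × Ioi (0 : ℝ), g p.1 * κ p.2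
              ∂((volume : Measure V).toSphere.prod (.volumeIoiPow (finrank ℝ V - 1))) := by
            rw [← (volume : Measure V).measurePreserving_homeomorphUnitSphereProd.integral_comp
              (Homeomorph.measurableEmbedding _)]
            refine integral_congr_ae (Eventually.of_forall fun y => ?_)
            have hy : (y : V) ≠ 0 := y.2
            simp only [homeomorphUnitSphereProd_apply_fst_coe,
              homeomorphUnitSphereProd_apply_snd_coe]
            rw [hKκ, hg _ (inv_pos.2 (norm_pos_iff.2 hy))]
        _ = _ := integral_prod_mul (fun a : Metric.sphere (0 : V) 1 => g a)
              (fun r : Ioi (0 : ℝ) => κ r)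
    have h1 := polar (fun _ => 1) fun _ _ _ => rfl
    simp only [one_mul, integral_const, smul_eq_mul, mul_one] at h1
    rw [polar f hf, h1, average_eq, smul_eq_mul]
    have : (volume : Measure V).toSphere.real univ ≠ 0 := by
      rw [measureReal_ne_zero_iff]
      exact (Measure.measure_univ_ne_zero).2 (Measure.toSphere_ne_zero _)
    field_simp

/-- The spherical average of a function that is constant on rays is its average over the ball. -/
theorem sphereAverage_eq_integral_ball {f : V → ℝ} (hf : ∀ t : ℝ, 0 < t → ∀ y, f (t • y) = f y) :
    sphereAverage V f =
      (volume.real (Metric.closedBall (0 : V) 1))⁻¹ * ∫ y in Metric.closedBall (0 : V) 1, f y := by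
  have h := integral_mul_radial_eq_sphereAverage hf
    (K := (Metric.closedBall (0 : V) 1).indicator fun _ => 1) (fun y z hyz => by
      by_cases hy : ‖y‖ ≤ 1
      · rw [indicator_of_mem (by simpa using hy), indicator_of_mem (by simpa [← hyz] using hy)]
      · rw [indicator_of_notMem (by simpa using hy), indicator_of_notMem (by simpa [← hyz] using hy)])
  have e1 : ∫ y, f y * (Metric.closedBall (0 : V) 1).indicator (fun _ => 1) y =
      ∫ y in Metric.closedBall (0 : V) 1, f y := by
    rw [← integral_indicator Metric.isClosed_closedBall.measurableSet]
    refine integral_congr_ae (Eventually.of_forall fun y => ?_)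
    by_cases hy : y ∈ Metric.closedBall (0 : V) 1
    · simp [indicator_of_mem hy]
    · simp [indicator_of_notMem hy]
  have e2 : ∫ y, (Metric.closedBall (0 : V) 1).indicator (fun _ => (1 : ℝ)) y =
      volume.real (Metric.closedBall (0 : V) 1) := by
    rw [integral_indicator Metric.isClosed_closedBall.measurableSet]
    simp
  have h0 : volume.real (Metric.closedBall (0 : V) 1) ≠ 0 := by
    rw [measureReal_ne_zero_iff measure_closedBall_lt_top.ne]
    exact (Metric.measure_closedBall_pos volume _ one_pos).ne'
  rw [← e1, h, e2]
  field_simp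

/-- Spherical averages ignore the values on finitely many hyperplanes. -/
theorem sphereAverage_congr {f f' : V → ℝ} {m : ℕ} {w : Fin m → V} (hw : ∀ i, w i ≠ 0)
    (h : ∀ a, (∀ i, inner ℝ (w i) a ≠ 0) → f a = f' a) : sphereAverage V f = sphereAverage V f' := by
  unfold sphereAverage
  split_ifs with h0
  · have := finrank_zero_iff.1 h0
    exact h 0 fun i => (hw i (Subsingleton.elim _ _)).elim
  · refine average_congr ?_
    have key : ∀ i, ∀ᵐ a : Metric.sphere (0 : V) 1 ∂(volume : Measure V).toSphere,
        inner ℝ (w i) (a : V) ≠ 0 := by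
      intro i
      have hm : MeasurableSet {a : Metric.sphere (0 : V) 1 | inner ℝ (w i) (a : V) = 0} :=
        (isClosed_eq (by fun_prop) continuous_const).measurableSet
      rw [ae_iff]
      simp only [not_not]
      rw [Measure.toSphere_apply' _ hm]
      have hsub : Ioo (0 : ℝ) 1 • (Subtype.val '' {a : Metric.sphere (0 : V) 1 |
          inner ℝ (w i) (a : V) = 0}) ⊆ (((ℝ ∙ w i)ᗮ : Submodule ℝ V) : Set V) := by
        rintro _ ⟨t, -, _, ⟨a, ha, rfl⟩, rfl⟩
        refine Submodule.smul_mem _ _ ?_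
        rw [Submodule.mem_orthogonal_singleton_iff_inner_right]
        exact ha
      rw [measure_mono_null hsub (Measure.addHaar_submodule _ _ ?_), mul_zero]
      intro htop
      have : w i ∈ (ℝ ∙ w i)ᗮ := htop ▸ Submodule.mem_top
      rw [Submodule.mem_orthogonal_singleton_iff_inner_right] at this
      exact hw i (inner_self_eq_zero.1 this)
    filter_upwards [ae_all_iff.2 key] with a ha
    exact h a ha

end SphereAverage

section FanVal

variable (ρ : CurvatureMap) {V : Type*} [NormedAddCommGroup V] [InnerProductSpace ℝ V] {m : ℕ}
  (u : Fin m → V) (Δ : Set (Finset (Fin m)))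

theorem CurvatureMap.fanVal_smul {t : ℝ} (ht : 0 < t) (b : V) :
    ρ.fanVal u Δ (t • b) = ρ.fanVal u Δ b := by
  simp only [CurvatureMap.fanVal, inner_smul_right, mul_pos_iff_of_pos_left ht]

theorem CurvatureMap.exists_fanVal_bound : ∃ C, ∀ b, |ρ.fanVal u Δ b| ≤ C := by
  obtain ⟨C, hC⟩ := (Set.finite_range fun S : Set (Fin m) => |ρ.cubeVal Δ S|).bddAbove
  exact ⟨C, fun b => hC ⟨_, rfl⟩⟩

theorem CurvatureMap.measurable_fanVal [MeasurableSpace V] [OpensMeasurableSpace V] :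
    Measurable (ρ.fanVal u Δ) := by
  have h : Measurable fun b : V => {i | 0 < inner ℝ (u i) b} := by
    refine measurable_set_iff.2 fun i => ?_
    have hc : Continuous fun b : V => (inner ℝ (u i) b : ℝ) := continuous_const.inner continuous_id
    exact measurableSet_setOfPred.1 (isOpen_lt continuous_const hc).measurableSet
  exact (measurable_of_countable fun S : Set (Fin m) => ρ.cubeVal Δ S).comp h

end FanVal

/-- The curvature along a face is the spherical average of the index of the normal fan, because the
index of the normal slice is the same at all relative interior points. -/
theorem PolyComplex.exists_isNormalFan_atFace (ρ : CurvatureMap) {n : ℕ} (K : PolyComplex n)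
    {F : Set (Euc n)} (hF : F ∈ K.cells) : ∃ (m : ℕ) (u : Fin m → (vectorSpan ℝ F)ᗮ)
      (Δ : Set (Finset (Fin m))), IsNormalFan K.space F u Δ ∧
        ρ.atFace K.space F = sphereAverage (vectorSpan ℝ F)ᗮ (ρ.fanVal u Δ) := by
  obtain ⟨m, u, Δ, h⟩ := K.exists_isNormalFan hF
  refine ⟨m, u, Δ, h, ?_⟩
  have hne : ∃ x, x ∈ intrinsicInterior ℝ F :=
    (K.nonempty F hF).intrinsicInterior (K.polytope F hF).convex
  unfold CurvatureMap.atFace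
  exact sphereAverage_congr h.ne_zero fun a ha =>
    h.index_normalSpace ρ (Classical.epsilon_spec hne) ha

/-! ### The determinant of a pair of subspaces -/

section SumDet

variable {n : ℕ} (U V : Submodule ℝ (Euc n)) (A : OGroup n)

/-- The factor by which the sum map `U × V → E^n`, `(u, v) ↦ u + A v`, changes volumes. -/
noncomputable def sumDet : ℝ :=
  (sumMap U V A ∘ₗ (WithLp.linearEquiv 2 ℝ (U × V)).toLinearMap).normDet

theorem sumDet_nonneg : 0 ≤ sumDet U V A := LinearMap.normDet_nonneg _

variable {U V A}

theorem finrank_withLp_prod : finrank ℝ (WithLp 2 (U × V)) = finrank ℝ U + finrank ℝ V := by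
  rw [(WithLp.linearEquiv 2 ℝ (U × V)).finrank_eq, finrank_prod]

/-- `sumDet` is invariant under isometries of the subspaces and of the ambient space. -/
theorem sumDet_congr {U' V' : Submodule ℝ (Euc n)} {A' : OGroup n} (e₁ : U ≃ₗᵢ[ℝ] U')
    (e₂ : V ≃ₗᵢ[ℝ] V') (B : OGroup n)
    (H : ∀ p : U × V, sumMap U' V' A' (e₁ p.1, e₂ p.2) = B.lin (sumMap U V A p)) :
    sumDet U' V' A' = sumDet U V A := by
  set T := sumMap U V A ∘ₗ (WithLp.linearEquiv 2 ℝ (U × V)).toLinearMap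
  set T' := sumMap U' V' A' ∘ₗ (WithLp.linearEquiv 2 ℝ (U' × V')).toLinearMap
  let e : WithLp 2 (U × V) ≃ₗᵢ[ℝ] WithLp 2 (U' × V') :=
    LinearIsometryEquiv.withLpProdCongr 2 e₁ e₂
  have hcomp : T' ∘ₗ e.toLinearIsometry.toLinearMap = B.isometryEquiv.toLinearIsometry.toLinearMap ∘ₗ T := by
    ext1 p
    exact H p.ofLp
  have h1 : (T' ∘ₗ e.toLinearIsometry.toLinearMap).normDet = T'.normDet := by
    rw [LinearMap.normDet_comp_of_finrank_eq _ _ e.toLinearEquiv.finrank_eq,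
      LinearIsometry.normDet_eq_one, mul_one]
  have h2 : (B.isometryEquiv.toLinearIsometry.toLinearMap ∘ₗ T).normDet = T.normDet := by
    rw [LinearMap.normDet_comp]
    have : B.isometryEquiv.toLinearIsometry.toLinearMap.domRestrict T.range =
      (B.isometryEquiv.toLinearIsometry.comp T.range.subtypeₗᵢ).toLinearMap := rfl
    rw [this, LinearIsometry.normDet_eq_one, one_mul]
  change T'.normDet = T.normDet
  rw [← h1, hcomp, h2]

/-- The restriction of an orthogonal matrix to an isometry of subspaces. -/
noncomputable def OGroup.restrict (B : OGroup n) {U U' : Submodule ℝ (Euc n)}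
    (h : U.map B.lin = U') : U ≃ₗᵢ[ℝ] U' :=
  (B.isometryEquiv.submoduleMap U).trans (LinearIsometryEquiv.ofEq _ _ h)

@[simp] theorem OGroup.coe_restrict (B : OGroup n) {U U' : Submodule ℝ (Euc n)}
    (h : U.map B.lin = U') (u : U) : (B.restrict h u : Euc n) = B.lin u := rfl

theorem sumDet_mul_left {B : OGroup n} (h : U.map B.lin = U) :
    sumDet U V (B * A) = sumDet U V A :=
  sumDet_congr (B.restrict h) (.refl ℝ V) B fun p => by
    simp [sumMap_apply, OGroup.lin_mul]

theorem sumDet_mul_right {B : OGroup n} (h : V.map B.lin = V) :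
    sumDet U V (A * B) = sumDet U V A := by
  refine sumDet_congr (.refl ℝ U) (B.restrict h).symm 1 fun p => ?_
  have : B.lin ((B.restrict h).symm p.2 : V) = (p.2 : Euc n) := by
    rw [← B.coe_restrict h, LinearIsometryEquiv.apply_symm_apply]
  simp [sumMap_apply, OGroup.lin_mul, this]

theorem sumDet_map {B₁ B₂ : OGroup n} {U' V' : Submodule ℝ (Euc n)} (h₁ : U.map B₁.lin = U')
    (h₂ : V.map B₂.lin = V') : sumDet U' V' A = sumDet U V (B₁⁻¹ * A * B₂) :=
  sumDet_congr (B₁.restrict h₁) (B₂.restrict h₂) B₁ fun p => by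
    simp [sumMap_apply, OGroup.lin_mul]

/-- The determinant `|U : A V|` is the Jacobian of the sum map `(u, v) ↦ u + A v`. -/
theorem subspaceDet_map (h : finrank ℝ U + finrank ℝ V = n) :
    subspaceDet U (V.map A.lin) = sumDet U V A := by
  have hA : sumDet U (V.map A.lin) 1 = sumDet U V A :=
    sumDet_congr (.refl ℝ U) (A.restrict rfl) 1 fun p => by simp [sumMap_apply]
  rw [← hA]
  generalize hW : V.map A.lin = W
  have hfin : finrank ℝ W = finrank ℝ V := by
    rw [← hW]
    exact (A.restrict (U := V) rfl).toLinearEquiv.finrank_eq.symm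
  have h' : finrank ℝ U + finrank ℝ W = n := by rw [hfin, h]
  rw [subspaceDet, dif_pos h']
  let b : OrthonormalBasis (Fin n) ℝ (WithLp 2 (U × W)) :=
    ((stdOrthonormalBasis ℝ U).prod (stdOrthonormalBasis ℝ W)).reindex
      (finSumFinEquiv.trans (finCongr h'))
  rw [sumDet, LinearMap.normDet_eq_norm_det_toMatrix _ b (EuclideanSpace.basisFun (Fin n) ℝ),
    Real.norm_eq_abs]
  congr 2
  ext i j
  rw [LinearMap.toMatrix_apply]
  simp only [Matrix.of_apply, b, OrthonormalBasis.coe_toBasis, OrthonormalBasis.reindex_apply]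
  have : (finSumFinEquiv.trans (finCongr h')).symm j = finSumFinEquiv.symm (Fin.cast h'.symm j) := rfl
  rw [this]
  rcases finSumFinEquiv.symm (Fin.cast h'.symm j) with p | q
  · simp [sumMap_apply]
  · simp [sumMap_apply]

theorem bijective_sumMap (h : finrank ℝ U + finrank ℝ V = n) (hA : sumDet U V A ≠ 0) :
    Function.Bijective (sumMap U V A) := by
  have hker := not_not.1 fun hk => hA (LinearMap.normDet_eq_zero_iff_ker_ne_bot.2 hk)
  have hinj : Function.Injective (sumMap U V A) := by
    intro p q hpq
    exact WithLp.toLp_injective 2 (LinearMap.ker_eq_bot.1 hker hpq)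
  refine ⟨hinj, (LinearMap.injective_iff_surjective_of_finrank_eq_finrank ?_).1 hinj⟩
  rw [finrank_prod, h, finrank_euclideanSpace_fin]

/-- The complements of complementary subspaces are complementary: a vector in `Uᗮ ∩ A Vᗮ` is
orthogonal to `U + A V`, which is the whole space. -/
theorem bijective_sumMap_orthogonal (h : finrank ℝ U + finrank ℝ V = n) (hA : sumDet U V A ≠ 0) :
    Function.Bijective (sumMap Uᗮ Vᗮ A) := by
  have hsurj := (bijective_sumMap h hA).2
  have hinj : Function.Injective (sumMap Uᗮ Vᗮ A) := by
    refine (injective_iff_map_eq_zero _).2 fun p hp => ?_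
    rw [sumMap_apply] at hp
    have h1 : (p.1 : Euc n) = - A.lin p.2 := eq_neg_of_add_eq_zero_left hp
    have h2 : (p.1 : Euc n) = 0 := by
      obtain ⟨q, hq⟩ := hsurj (p.1 : Euc n)
      have : inner ℝ (p.1 : Euc n) (sumMap U V A q) = 0 := by
        rw [sumMap_apply, inner_add_right, Submodule.inner_left_of_mem_orthogonal q.1.2 p.1.2, h1,
          inner_neg_left, OGroup.inner_lin_lin,
          Submodule.inner_left_of_mem_orthogonal q.2.2 p.2.2]
        simp
      rwa [hq, inner_self_eq_zero] at this
    have h3 : (p.2 : Euc n) = 0 := by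
      apply A.lin_injective
      rw [map_zero, ← neg_eq_zero, ← h1, h2]
    exact Prod.ext (Subtype.ext h2) (Subtype.ext h3)
  refine ⟨hinj, (LinearMap.injective_iff_surjective_of_finrank_eq_finrank ?_).1 hinj⟩
  have e1 := U.finrank_add_finrank_orthogonal
  have e2 := V.finrank_add_finrank_orthogonal
  rw [finrank_euclideanSpace_fin] at *
  rw [finrank_prod]
  omega

theorem continuous_sumDet (h : finrank ℝ U + finrank ℝ V = n) :
    Continuous fun A : OGroup n => sumDet U V A := by
  let b : OrthonormalBasis (Fin n) ℝ (WithLp 2 (U × V)) :=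
    (stdOrthonormalBasis ℝ (WithLp 2 (U × V))).reindex
      (finCongr (by rw [finrank_withLp_prod, h]))
  have : (fun A : OGroup n => sumDet U V A) = fun A =>
      ‖(Matrix.of fun i j => (sumMap U V A (b j).ofLp) i : Matrix (Fin n) (Fin n) ℝ).det‖ := by
    ext A
    rw [sumDet, LinearMap.normDet_eq_norm_det_toMatrix _ b (EuclideanSpace.basisFun (Fin n) ℝ)]
    congr 2
    ext i j
    rw [LinearMap.toMatrix_apply]
    simp
  rw [this]
  refine (Continuous.matrix_det (continuous_pi fun i => continuous_pi fun j => ?_)).norm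
  have hc : Continuous fun A : OGroup n => A.lin ((b j).ofLp.2 : Euc n) :=
    OGroup.continuous_lin.comp (continuous_id.prodMk continuous_const)
  simp only [Matrix.of_apply, sumMap_apply]
  exact (EuclideanSpace.proj (𝕜 := ℝ) i).continuous.comp (continuous_const.add hc)

theorem volume_image_sumMap (h : finrank ℝ U + finrank ℝ V = n) (s : Set (U × V)) :
    volume (sumMap U V A '' s) = ENNReal.ofReal (sumDet U V A) * volume s := by
  have h1 := LinearMap.euclideanHausdorffMeasure_image_eq_normDet_mul_volume
    (sumMap U V A ∘ₗ (WithLp.linearEquiv 2 ℝ (U × V)).toLinearMap) (WithLp.ofLp ⁻¹' s)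
  rw [finrank_withLp_prod, h, EuclideanSpace.euclideanHausdorffMeasure_eq_volume] at h1
  have h2 : volume ((WithLp.ofLp : WithLp 2 (U × V) → U × V) ⁻¹' s) = volume s :=
    (WithLp.volume_preserving_ofLp U V).measure_preimage_equiv
      (f := (MeasurableEquiv.toLp 2 (U × V)).symm) s
  rw [← h2, sumDet, ← h1]
  congr 1
  ext y
  constructor
  · rintro ⟨p, hp, rfl⟩
    exact ⟨WithLp.toLp 2 p, hp, rfl⟩
  · rintro ⟨p, hp, rfl⟩
    exact ⟨p.ofLp, hp, rfl⟩

/-- The sum map of two complementary subspaces as a homeomorphism. -/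
noncomputable def sumHomeomorph (h : Function.Bijective (sumMap U V A)) : U × V ≃ₜ Euc n :=
  (LinearEquiv.ofBijective _ h).toContinuousLinearEquiv.toHomeomorph

theorem volume_eq_sumDet_smul_map (h : finrank ℝ U + finrank ℝ V = n)
    (hb : Function.Bijective (sumMap U V A)) :
    (volume : Measure (Euc n)) =
      ENNReal.ofReal (sumDet U V A) • (volume : Measure (U × V)).map (sumHomeomorph hb) := by
  ext s hs
  rw [Measure.smul_apply, Measure.map_apply (sumHomeomorph hb).measurable hs, smul_eq_mul,
    ← volume_image_sumMap h]
  congr 1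
  exact (image_preimage_eq s hb.2).symm

theorem integral_eq_sumDet_mul (h : finrank ℝ U + finrank ℝ V = n)
    (hb : Function.Bijective (sumMap U V A)) (f : Euc n → ℝ) :
    ∫ y, f y = sumDet U V A * ∫ p : U × V, f (sumMap U V A p) := by
  rw [volume_eq_sumDet_smul_map h hb, integral_smul_measure,
    (sumHomeomorph hb).measurableEmbedding.integral_map,
    ENNReal.toReal_ofReal (sumDet_nonneg _ _ _)]
  rfl

theorem volume_eq_sumDet_mul_preimage (h : finrank ℝ U + finrank ℝ V = n)
    (hb : Function.Bijective (sumMap U V A)) (s : Set (Euc n)) :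
    volume s = ENNReal.ofReal (sumDet U V A) * volume (sumMap U V A ⁻¹' s) := by
  rw [← volume_image_sumMap h, image_preimage_eq s hb.2]

end SumDet

/-- The volume of the set of the translations that make two flat pieces of complementary
dimensions meet. -/
theorem volume_translations {n : ℕ} {U V : Submodule ℝ (Euc n)} (A : OGroup n)
    (h : finrank ℝ U + finrank ℝ V = n) {F G : Set (Euc n)} {x y : Euc n}
    (hF : ∀ z ∈ F, z - x ∈ U) (hG : ∀ z ∈ G, z - y ∈ V) :
    volume {t : Euc n | ∃ a ∈ F, ∃ b ∈ G, a = A.lin b + t} =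
      ENNReal.ofReal (sumDet U V A) * (Measure.euclideanHausdorffMeasure (finrank ℝ U) F *
        Measure.euclideanHausdorffMeasure (finrank ℝ V) G) := by
  let s : Set U := {u | x + u ∈ F}
  let s' : Set V := {v | y - v ∈ G}
  have hs : volume s = Measure.euclideanHausdorffMeasure (finrank ℝ U) F := by
    have hi : Isometry fun u : U => x + (u : Euc n) := by
      refine Isometry.of_dist_eq fun u v => ?_
      rw [dist_add_left]
      rfl
    rw [← InnerProductSpace.euclideanHausdorffMeasure_eq_volume,
      ← hi.euclideanHausdorffMeasure_image]
    congr 1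
    ext z
    constructor
    · rintro ⟨u, hu, rfl⟩
      exact hu
    · intro hz
      have e : x + (z - x) = z := by abel
      exact ⟨⟨z - x, hF z hz⟩, by simpa [s, e] using hz, e⟩
  have hs' : volume s' = Measure.euclideanHausdorffMeasure (finrank ℝ V) G := by
    have hi : Isometry fun u : V => y - (u : Euc n) := by
      refine Isometry.of_dist_eq fun u v => ?_
      rw [dist_sub_left]
      rfl
    rw [← InnerProductSpace.euclideanHausdorffMeasure_eq_volume,
      ← hi.euclideanHausdorffMeasure_image]
    congr 1
    ext z
    constructor
    · rintro ⟨u, hu, rfl⟩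
      exact hu
    · intro hz
      have e : y - (y - z) = z := by abel
      have hm : y - z ∈ V := by
        rw [← neg_sub]
        exact V.neg_mem (hG z hz)
      exact ⟨⟨y - z, hm⟩, by simpa [s', e] using hz, e⟩
  have himg : {t : Euc n | ∃ a ∈ F, ∃ b ∈ G, a = A.lin b + t} =
      (fun t => (x - A.lin y) + t) '' (sumMap U V A '' (s ×ˢ s')) := by
    ext t
    constructor
    · rintro ⟨a, ha, b, hb, hab⟩
      have hm : y - b ∈ V := by
        rw [← neg_sub]
        exact V.neg_mem (hG b hb)
      have e : x + (a - x) = a := by abel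
      have e' : y - (y - b) = b := by abel
      refine ⟨_, ⟨(⟨a - x, hF a ha⟩, ⟨y - b, hm⟩), ⟨?_, ?_⟩, rfl⟩, ?_⟩
      · simpa [s, e] using ha
      · simpa [s', e'] using hb
      · simp only [sumMap_apply, map_sub, hab]
        abel
    · rintro ⟨_, ⟨p, ⟨hp, hp'⟩, rfl⟩, rfl⟩
      refine ⟨_, hp, _, hp', ?_⟩
      simp only [sumMap_apply, map_sub]
      abel
  rw [himg, image_add_left, measure_preimage_add, volume_image_sumMap h, Measure.volume_eq_prod,
    Measure.prod_prod, hs, hs']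

/-! ### Haar measure on the orthogonal group -/

namespace OGroup

variable {n : ℕ}

instance instIsProbabilityMeasureHaar : IsProbabilityMeasure (OGroup.haar n) := by
  refine ⟨?_⟩
  have h := Measure.haarMeasure_self (K₀ := (⊤ : TopologicalSpace.PositiveCompacts (OGroup n)))
  rwa [TopologicalSpace.PositiveCompacts.coe_top] at h

instance instIsHaarMeasureHaar : (OGroup.haar n).IsHaarMeasure :=
  Measure.isHaarMeasure_haarMeasure _

/-- A right translate of the Haar measure is a left invariant probability measure, so it is the
Haar measure. -/
instance instIsMulRightInvariantHaar : (OGroup.haar n).IsMulRightInvariant := by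
  refine ⟨fun g => ?_⟩
  have hp : IsProbabilityMeasure ((OGroup.haar n).map (· * g)) :=
    Measure.isProbabilityMeasure_map (measurable_mul_const g).aemeasurable
  have h := Measure.isMulInvariant_eq_smul_of_compactSpace ((OGroup.haar n).map (· * g))
    (OGroup.haar n)
  have h1 := congrArg (fun μ => μ univ) h
  simp only [measure_univ, Measure.smul_apply] at h1
  rw [h]
  have h2 : Measure.haarScalarFactor ((OGroup.haar n).map (· * g)) (OGroup.haar n) = 1 := by
    rw [ENNReal.smul_def, smul_eq_mul, mul_one] at h1
    exact_mod_cast h1.symm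
  rw [h2, one_smul]

/-- The orthogonal group of the complement of a subspace acts transitively on the spheres of the
complement. -/
theorem exists_fixing (U : Submodule ℝ (Euc n)) {b b' : Euc n} (hb : b ∈ Uᗮ) (hb' : b' ∈ Uᗮ)
    (h : ‖b‖ = ‖b'‖) : ∃ B : OGroup n, U.map B.lin = U ∧ Uᗮ.map B.lin = Uᗮ ∧ B.lin b = b' := by
  -- the reflection in the hyperplane bisecting `b` and `b'`
  obtain ⟨B, hB⟩ := exists_lin_eq (Submodule.reflection (ℝ ∙ (b - b'))ᗮ)
  have hfix : ∀ u ∈ U, B.lin u = u := by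
    intro u hu
    rw [hB]
    refine Submodule.reflection_mem_subspace_eq_self ?_
    rw [Submodule.mem_orthogonal_singleton_iff_inner_right]
    exact Submodule.inner_left_of_mem_orthogonal hu (Submodule.sub_mem _ hb hb')
  have hU : U.map B.lin = U := by
    ext y
    constructor
    · rintro ⟨u, hu, rfl⟩
      rwa [hfix u hu]
    · intro hy
      exact ⟨y, hy, hfix y hy⟩
  have hle : Uᗮ.map B.lin ≤ Uᗮ := by
    rintro _ ⟨w, hw, rfl⟩
    refine (Submodule.mem_orthogonal _ _).2 fun u hu => ?_
    rw [← hfix u hu, inner_lin_lin]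
    exact Submodule.inner_right_of_mem_orthogonal hu hw
  have hUc : Uᗮ.map B.lin = Uᗮ :=
    Submodule.eq_of_le_of_finrank_eq hle
      (LinearEquiv.finrank_eq (B.isometryEquiv.submoduleMap Uᗮ).toLinearEquiv).symm
  exact ⟨B, hU, hUc, by rw [hB]; exact Submodule.reflection_sub h⟩

/-- The orthogonal group acts transitively on the subspaces of a given dimension. -/
theorem exists_map_eq {U U' : Submodule ℝ (Euc n)} (h : finrank ℝ U = finrank ℝ U') :
    ∃ B : OGroup n, U.map B.lin = U' := by
  let e : U ≃ₗᵢ[ℝ] U' := (stdOrthonormalBasis ℝ U).equiv (stdOrthonormalBasis ℝ U') (finCongr h)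
  let L : Euc n →ₗᵢ[ℝ] Euc n := (U'.subtypeₗᵢ.comp e.toLinearIsometry).extend
  obtain ⟨B, hB⟩ := exists_lin_eq (LinearIsometryEquiv.ofSurjective L
    (LinearMap.surjective_of_injective (f := L.toLinearMap) L.injective))
  refine ⟨B, Submodule.eq_of_le_of_finrank_eq ?_ ?_⟩
  · rintro _ ⟨u, hu, rfl⟩
    rw [hB]
    change L u ∈ U'
    rw [show L u = (e ⟨u, hu⟩ : Euc n) from LinearIsometry.extend_apply _ ⟨u, hu⟩]
    exact Subtype.property _
  · rw [← h]
    exact (LinearEquiv.finrank_eq (B.isometryEquiv.submoduleMap U).toLinearEquiv).symm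

end OGroup

theorem integrable_sumDet {n : ℕ} {U V : Submodule ℝ (Euc n)} (h : finrank ℝ U + finrank ℝ V = n) :
    Integrable (fun A : OGroup n => sumDet U V A) (OGroup.haar n) := by
  have := (continuous_sumDet h).continuousOn.integrableOn_compact (μ := OGroup.haar n)
    isCompact_univ
  rwa [integrableOn_univ] at this

/-- The integral of the determinant over the orthogonal group depends on the dimensions only. -/
theorem integral_sumDet_eq {n : ℕ} {U V U' V' : Submodule ℝ (Euc n)}
    (h₁ : finrank ℝ U = finrank ℝ U') (h₂ : finrank ℝ V = finrank ℝ V') :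
    ∫ A, sumDet U' V' A ∂(OGroup.haar n) = ∫ A, sumDet U V A ∂(OGroup.haar n) := by
  obtain ⟨B₁, hB₁⟩ := OGroup.exists_map_eq h₁
  obtain ⟨B₂, hB₂⟩ := OGroup.exists_map_eq h₂
  simp_rw [sumDet_map hB₁ hB₂]
  exact (integral_mul_left_eq_self (fun A => sumDet U V (A * B₂)) B₁⁻¹).trans
    (integral_mul_right_eq_self (fun A => sumDet U V A) B₂)

theorem finrank_coordSubspace {n : ℕ} (I : Finset (Fin n)) :
    finrank ℝ (coordSubspace (I : Set (Fin n))) = I.card := by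
  have hli : LinearIndependent ℝ fun i : Fin n => (EuclideanSpace.single i (1 : ℝ) : Euc n) := by
    have h := (EuclideanSpace.basisFun (Fin n) ℝ).toBasis.linearIndependent
    rw [OrthonormalBasis.coe_toBasis] at h
    have e : (fun i : Fin n => (EuclideanSpace.single i (1 : ℝ) : Euc n)) =
        EuclideanSpace.basisFun (Fin n) ℝ := by
      ext1 i
      simp
    rw [e]
    exact h
  have h := finrank_span_eq_card (hli.comp ((↑) : I → Fin n) Subtype.val_injective)
  rw [Fintype.card_coe] at h
  rw [coordSubspace, image_eq_range]
  exact h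

/-! ### Averaging over the orthogonal group -/

section Averaging

variable {n : ℕ} (U V : Submodule ℝ (Euc n))

/-- The density on `O(E) × (Uᗮ × Vᗮ)` that the averages over the unit ball of `E^n`, weighted with
the determinant of `U` and `V`, acquire in the coordinates of `Uᗮ × Vᗮ`. -/
noncomputable def ballKernel (A : OGroup n) (p : Uᗮ × Vᗮ) : ℝ :=
  sumDet U V A * sumDet Uᗮ Vᗮ A *
    (Metric.closedBall (0 : Euc n) 1).indicator (fun _ => 1) (sumMap Uᗮ Vᗮ A p)

/-- The average over the unit ball of `E^n` of the function that is `f₁ ⊗ f₂` in the coordinates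
`(b₁, b₂) ↦ b₁ + A b₂`. -/
noncomputable def coordAverage (f₁ : Uᗮ → ℝ) (f₂ : Vᗮ → ℝ) (A : OGroup n) : ℝ :=
  (volume.real (Metric.closedBall (0 : Euc n) 1))⁻¹ * (sumDet Uᗮ Vᗮ A *
    ∫ p : Uᗮ × Vᗮ, f₁ p.1 * f₂ p.2 *
      (Metric.closedBall (0 : Euc n) 1).indicator (fun _ => 1) (sumMap Uᗮ Vᗮ A p))

variable {U V}

theorem finrank_orthogonal_add_finrank_orthogonal (h : finrank ℝ U + finrank ℝ V = n) :
    finrank ℝ Uᗮ + finrank ℝ Vᗮ = n := by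
  have e1 := U.finrank_add_finrank_orthogonal
  have e2 := V.finrank_add_finrank_orthogonal
  rw [finrank_euclideanSpace_fin] at e1 e2
  omega

theorem continuous_sumMap_apply {W Z : Submodule ℝ (Euc n)} :
    Continuous fun q : OGroup n × (W × Z) => sumMap W Z q.1 q.2 := by
  have hp : Continuous fun q : OGroup n × (W × Z) => (q.1, (q.2.2 : Euc n)) :=
    continuous_fst.prodMk (continuous_subtype_val.comp (continuous_snd.comp continuous_snd))
  have h : Continuous fun q : OGroup n × (W × Z) => q.1.lin (q.2.2 : Euc n) :=
    OGroup.continuous_lin.comp hp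
  have h' : Continuous fun q : OGroup n × (W × Z) => (q.2.1 : Euc n) :=
    continuous_subtype_val.comp (continuous_fst.comp continuous_snd)
  simp only [sumMap_apply]
  exact h'.add h

theorem measurable_indicator_sumMap {W Z : Submodule ℝ (Euc n)} :
    Measurable fun q : OGroup n × (W × Z) =>
      (Metric.closedBall (0 : Euc n) 1).indicator (fun _ => (1 : ℝ)) (sumMap W Z q.1 q.2) :=
  (measurable_const.indicator Metric.isClosed_closedBall.measurableSet).comp
    continuous_sumMap_apply.measurable

theorem measurable_ballKernel (h : finrank ℝ U + finrank ℝ V = n) :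
    Measurable fun q : OGroup n × (Uᗮ × Vᗮ) => ballKernel U V q.1 q.2 := by
  have h1 : Measurable fun q : OGroup n × (Uᗮ × Vᗮ) => sumDet U V q.1 :=
    (continuous_sumDet h).measurable.comp measurable_fst
  have h2 : Measurable fun q : OGroup n × (Uᗮ × Vᗮ) => sumDet Uᗮ Vᗮ q.1 :=
    (continuous_sumDet (finrank_orthogonal_add_finrank_orthogonal h)).measurable.comp measurable_fst
  exact (h1.mul h2).mul measurable_indicator_sumMap

theorem ballKernel_nonneg (A : OGroup n) (p : Uᗮ × Vᗮ) : 0 ≤ ballKernel U V A p :=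
  mul_nonneg (mul_nonneg (sumDet_nonneg _ _ _) (sumDet_nonneg _ _ _))
    (indicator_nonneg (fun _ _ => zero_le_one) _)

/-- The integral in the coordinates `b₁ + A b₂` turns `sumDet Uᗮ Vᗮ A` into the volume of the unit
ball; if these are not coordinates, then `sumDet U V A = 0` and both sides vanish. -/
theorem integral_ballKernel (h : finrank ℝ U + finrank ℝ V = n) (A : OGroup n) :
    ∫ p, ballKernel U V A p = sumDet U V A * volume.real (Metric.closedBall (0 : Euc n) 1) := by
  by_cases hA : sumDet U V A = 0
  · simp [ballKernel, hA]
  · unfold ballKernel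
    rw [integral_const_mul, mul_assoc, ← integral_eq_sumDet_mul
      (finrank_orthogonal_add_finrank_orthogonal h) (bijective_sumMap_orthogonal h hA)
      ((Metric.closedBall (0 : Euc n) 1).indicator fun _ => 1),
      integral_indicator Metric.isClosed_closedBall.measurableSet]
    simp

theorem integrable_indicator_sumMap {W Z : Submodule ℝ (Euc n)} {A : OGroup n}
    (h : finrank ℝ W + finrank ℝ Z = n) (hb : Function.Bijective (sumMap W Z A)) :
    Integrable fun p : W × Z =>
      (Metric.closedBall (0 : Euc n) 1).indicator (fun _ => (1 : ℝ)) (sumMap W Z A p) := by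
  have hv := volume_eq_sumDet_mul_preimage h hb (Metric.closedBall (0 : Euc n) 1)
  have hfin : volume (sumMap W Z A ⁻¹' Metric.closedBall (0 : Euc n) 1) ≠ ⊤ := by
    intro htop
    rw [htop] at hv
    by_cases h0 : sumDet W Z A = 0
    · rw [h0, ENNReal.ofReal_zero, zero_mul] at hv
      exact (Metric.measure_closedBall_pos volume _ one_pos).ne' hv
    · rw [ENNReal.mul_top] at hv
      · exact measure_closedBall_lt_top.ne hv
      · exact (ENNReal.ofReal_pos.2 ((sumDet_nonneg _ _ _).lt_of_ne' h0)).ne'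
  have hm : MeasurableSet (sumMap W Z A ⁻¹' Metric.closedBall (0 : Euc n) 1) :=
    (sumHomeomorph hb).measurable Metric.isClosed_closedBall.measurableSet
  exact (integrable_indicator_iff hm).2 (integrableOn_const hfin)

theorem integrable_ballKernel (h : finrank ℝ U + finrank ℝ V = n) :
    Integrable (fun q : OGroup n × (Uᗮ × Vᗮ) => ballKernel U V q.1 q.2)
      ((OGroup.haar n).prod volume) := by
  refine (integrable_prod_iff (measurable_ballKernel h).aestronglyMeasurable).2 ⟨?_, ?_⟩
  · refine Eventually.of_forall fun A => ?_
    by_cases hA : sumDet U V A = 0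
    · simp [ballKernel, hA]
    · exact (integrable_indicator_sumMap (finrank_orthogonal_add_finrank_orthogonal h)
        (bijective_sumMap_orthogonal h hA)).const_mul (sumDet U V A * sumDet Uᗮ Vᗮ A)
  · simp only [Real.norm_of_nonneg (ballKernel_nonneg _ _), integral_ballKernel h]
    exact (integrable_sumDet h).mul_const _

/-- The mean of the kernel is radial in the first variable: substitute `B * A` for `A`, where `B`
preserves `U` and carries one vector of `Uᗮ` to the other. -/
theorem integral_ballKernel_left (p p' : Uᗮ × Vᗮ) (h₁ : ‖p.1‖ = ‖p'.1‖) (h₂ : p.2 = p'.2) :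
    ∫ A, ballKernel U V A p ∂(OGroup.haar n) = ∫ A, ballKernel U V A p' ∂(OGroup.haar n) := by
  obtain ⟨B, hU, hUc, hB⟩ := OGroup.exists_fixing U p.1.2 p'.1.2 h₁
  rw [← integral_mul_left_eq_self (fun A => ballKernel U V A p') B]
  congr 1 with A
  rw [ballKernel, ballKernel, sumDet_mul_left hU, sumDet_mul_left hUc]
  congr 1
  have : sumMap Uᗮ Vᗮ (B * A) p' = B.lin (sumMap Uᗮ Vᗮ A p) := by
    rw [sumMap_apply, sumMap_apply, OGroup.lin_mul, map_add, hB, h₂]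
  rw [this]
  simp [indicator]

/-- The mean of the kernel is radial in the second variable: substitute `A * B` for `A`, where `B`
preserves `V` and carries one vector of `Vᗮ` to the other. -/
theorem integral_ballKernel_right (p p' : Uᗮ × Vᗮ) (h₁ : p.1 = p'.1) (h₂ : ‖p.2‖ = ‖p'.2‖) :
    ∫ A, ballKernel U V A p ∂(OGroup.haar n) = ∫ A, ballKernel U V A p' ∂(OGroup.haar n) := by
  obtain ⟨B, hV, hVc, hB⟩ := OGroup.exists_fixing V p.2.2 p'.2.2 h₂
  rw [← integral_mul_right_eq_self (fun A => ballKernel U V A p) B]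
  congr 1 with A
  rw [ballKernel, ballKernel, sumDet_mul_right hV, sumDet_mul_right hVc]
  congr 2
  rw [sumMap_apply, sumMap_apply, OGroup.lin_mul, hB, h₁]

/-- The mean over the orthogonal group, weighted with the determinant, of the average of `f₁ ⊗ f₂`
is the product of the spherical averages, because the kernel obtained by integrating over the group
is radial in both variables. -/
theorem integral_sumDet_mul_coordAverage (h : finrank ℝ U + finrank ℝ V = n) {f₁ : Uᗮ → ℝ}
    {f₂ : Vᗮ → ℝ} (hf₁ : Measurable f₁) (hf₂ : Measurable f₂) {C₁ C₂ : ℝ}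
    (hC₁ : ∀ b, |f₁ b| ≤ C₁) (hC₂ : ∀ b, |f₂ b| ≤ C₂)
    (hs₁ : ∀ t : ℝ, 0 < t → ∀ b, f₁ (t • b) = f₁ b) (hs₂ : ∀ t : ℝ, 0 < t → ∀ b, f₂ (t • b) = f₂ b) :
    ∫ A, sumDet U V A * coordAverage U V f₁ f₂ A ∂(OGroup.haar n) =
      sphereAverage Uᗮ f₁ * sphereAverage Vᗮ f₂ * ∫ A, sumDet U V A ∂(OGroup.haar n) := by
  set μ := OGroup.haar n
  set β := volume.real (Metric.closedBall (0 : Euc n) 1) with hβ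
  have hβ0 : β ≠ 0 := by
    rw [hβ, measureReal_ne_zero_iff measure_closedBall_lt_top.ne]
    exact (Metric.measure_closedBall_pos volume _ one_pos).ne'
  have hG := integrable_ballKernel h
  have hm : Measurable fun q : OGroup n × (Uᗮ × Vᗮ) => f₁ q.2.1 * f₂ q.2.2 := by fun_prop
  have hH : Integrable (fun q : OGroup n × (Uᗮ × Vᗮ) => f₁ q.2.1 * f₂ q.2.2 * ballKernel U V q.1 q.2)
      (μ.prod volume) := by
    refine hG.bdd_mul (c := C₁ * C₂) hm.aestronglyMeasurable (Eventually.of_forall fun q => ?_)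
    rw [Real.norm_eq_abs, abs_mul]
    exact mul_le_mul (hC₁ _) (hC₂ _) (abs_nonneg _) ((abs_nonneg _).trans (hC₁ q.2.1))
  have e1 : ∀ A, sumDet U V A * coordAverage U V f₁ f₂ A =
      β⁻¹ * ∫ p : Uᗮ × Vᗮ, f₁ p.1 * f₂ p.2 * ballKernel U V A p := by
    intro A
    rw [coordAverage, mul_left_comm, ← hβ, ← mul_assoc (sumDet U V A), ← integral_const_mul]
    congr 2 with p
    rw [ballKernel]
    ring
  set K : Uᗮ × Vᗮ → ℝ := fun p => ∫ A, ballKernel U V A p ∂μ with hK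
  have hKint : Integrable K := hG.integral_prod_right
  have hHint : Integrable fun p : Uᗮ × Vᗮ => f₁ p.1 * f₂ p.2 * K p := by
    have := hH.integral_prod_right
    simpa only [integral_const_mul] using this
  have e2 : ∫ A, (∫ p : Uᗮ × Vᗮ, f₁ p.1 * f₂ p.2 * ballKernel U V A p) ∂μ =
      ∫ b₂, ∫ b₁, f₁ b₁ * f₂ b₂ * K (b₁, b₂) := by
    rw [integral_integral_swap hH]
    simp_rw [integral_const_mul]
    exact integral_prod_symm _ hHint
  have e3 : ∫ A, (∫ p : Uᗮ × Vᗮ, ballKernel U V A p) ∂μ = ∫ b₂, ∫ b₁, K (b₁, b₂) := by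
    rw [integral_integral_swap hG]
    exact integral_prod_symm _ hKint
  have e4 : ∀ b₂, ∫ b₁, f₁ b₁ * f₂ b₂ * K (b₁, b₂) =
      sphereAverage Uᗮ f₁ * (f₂ b₂ * ∫ b₁, K (b₁, b₂)) := by
    intro b₂
    have := integral_mul_radial_eq_sphereAverage hs₁ (K := fun b₁ => K (b₁, b₂))
      fun y z hyz => integral_ballKernel_left (y, b₂) (z, b₂) hyz rfl
    rw [mul_left_comm, ← this, ← integral_const_mul]
    congr 1 with b₁
    ring
  have e5 : ∫ b₂, f₂ b₂ * ∫ b₁, K (b₁, b₂) =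
      sphereAverage Vᗮ f₂ * ∫ b₂, ∫ b₁, K (b₁, b₂) := by
    refine integral_mul_radial_eq_sphereAverage hs₂ fun y z hyz => ?_
    congr 1 with b₁
    exact integral_ballKernel_right (b₁, y) (b₁, z) rfl hyz
  simp_rw [e1]
  rw [integral_const_mul, e2]
  simp_rw [e4]
  rw [integral_const_mul, e5, ← e3]
  simp_rw [integral_ballKernel h]
  rw [integral_mul_const, ← hβ]
  field_simp

theorem measurable_coordAverage (h : finrank ℝ U + finrank ℝ V = n) {f₁ : Uᗮ → ℝ}
    {f₂ : Vᗮ → ℝ} (hf₁ : Measurable f₁) (hf₂ : Measurable f₂) :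
    Measurable (coordAverage U V f₁ f₂) := by
  have hm : Measurable fun q : OGroup n × (Uᗮ × Vᗮ) => f₁ q.2.1 * f₂ q.2.2 *
      (Metric.closedBall (0 : Euc n) 1).indicator (fun _ => (1 : ℝ)) (sumMap Uᗮ Vᗮ q.1 q.2) :=
    Measurable.mul (by fun_prop) measurable_indicator_sumMap
  have h1 := (hm.stronglyMeasurable.integral_prod_right' (ν := volume)).measurable
  exact ((continuous_sumDet (finrank_orthogonal_add_finrank_orthogonal h)).measurable.mul
    h1).const_mul _

theorem abs_coordAverage_le (h : finrank ℝ U + finrank ℝ V = n) {f₁ : Uᗮ → ℝ}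
    {f₂ : Vᗮ → ℝ} {C₁ C₂ : ℝ} (hC₁ : ∀ b, |f₁ b| ≤ C₁) (hC₂ : ∀ b, |f₂ b| ≤ C₂) (A : OGroup n)
    (hA : sumDet U V A ≠ 0) : |coordAverage U V f₁ f₂ A| ≤ C₁ * C₂ := by
  set β := volume.real (Metric.closedBall (0 : Euc n) 1) with hβ
  have hβ0 : 0 < β := by
    rw [hβ, measureReal_def, ENNReal.toReal_pos_iff]
    exact ⟨Metric.measure_closedBall_pos volume _ one_pos, measure_closedBall_lt_top⟩
  have h' := finrank_orthogonal_add_finrank_orthogonal h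
  have hb := bijective_sumMap_orthogonal h hA
  have hi := integrable_indicator_sumMap h' hb
  have h1 : ‖∫ p : Uᗮ × Vᗮ, f₁ p.1 * f₂ p.2 *
      (Metric.closedBall (0 : Euc n) 1).indicator (fun _ => 1) (sumMap Uᗮ Vᗮ A p)‖ ≤
      ∫ p : Uᗮ × Vᗮ, C₁ * C₂ *
      (Metric.closedBall (0 : Euc n) 1).indicator (fun _ => 1) (sumMap Uᗮ Vᗮ A p) := by
    refine norm_integral_le_of_norm_le (hi.const_mul _) (Eventually.of_forall fun p => ?_)
    have hnn : 0 ≤ (Metric.closedBall (0 : Euc n) 1).indicator (fun _ => (1 : ℝ))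
      (sumMap Uᗮ Vᗮ A p) := indicator_nonneg (fun _ _ => zero_le_one) _
    rw [Real.norm_eq_abs, abs_mul, abs_mul, abs_of_nonneg hnn]
    exact mul_le_mul_of_nonneg_right
      (mul_le_mul (hC₁ _) (hC₂ _) (abs_nonneg _) ((abs_nonneg _).trans (hC₁ p.1))) hnn
  have h2 := integral_eq_sumDet_mul h' hb ((Metric.closedBall (0 : Euc n) 1).indicator fun _ => 1)
  rw [integral_indicator Metric.isClosed_closedBall.measurableSet] at h2
  simp only [integral_const, measureReal_restrict_apply_univ, smul_eq_mul, mul_one] at h2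
  rw [integral_const_mul, Real.norm_eq_abs] at h1
  rw [coordAverage, abs_mul, abs_mul, abs_of_nonneg (sumDet_nonneg _ _ _), ← hβ,
    abs_of_pos (inv_pos.2 hβ0), inv_mul_le_iff₀ hβ0]
  calc _ ≤ sumDet Uᗮ Vᗮ A * (C₁ * C₂ * _) :=
        mul_le_mul_of_nonneg_left h1 (sumDet_nonneg _ _ _)
    _ = β * (C₁ * C₂) := by rw [hβ, h2]; ring

/-- The spherical average of a function that is a product in the coordinates of `Uᗮ × Vᗮ`. -/
theorem sphereAverage_eq_coordAverage (h : finrank ℝ U + finrank ℝ V = n) {f₁ : Uᗮ → ℝ}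
    {f₂ : Vᗮ → ℝ} {A : OGroup n} (hA : sumDet U V A ≠ 0)
    (hs₁ : ∀ t : ℝ, 0 < t → ∀ b, f₁ (t • b) = f₁ b) (hs₂ : ∀ t : ℝ, 0 < t → ∀ b, f₂ (t • b) = f₂ b)
    {f : Euc n → ℝ} (hf : ∀ p : Uᗮ × Vᗮ, f (sumMap Uᗮ Vᗮ A p) = f₁ p.1 * f₂ p.2) :
    sphereAverage (Euc n) f = coordAverage U V f₁ f₂ A := by
  have hb := bijective_sumMap_orthogonal h hA
  rw [sphereAverage_eq_integral_ball, coordAverage,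
    ← integral_indicator Metric.isClosed_closedBall.measurableSet,
    integral_eq_sumDet_mul (finrank_orthogonal_add_finrank_orthogonal h) hb]
  · congr 3 with p
    by_cases hp : sumMap Uᗮ Vᗮ A p ∈ Metric.closedBall (0 : Euc n) 1
    · simp only [indicator_of_mem hp, hf, mul_one]
    · simp only [indicator_of_notMem hp, mul_zero]
  · intro t ht y
    obtain ⟨p, rfl⟩ := hb.2 y
    rw [← map_smul, hf, hf, Prod.smul_fst, Prod.smul_snd, hs₁ t ht, hs₂ t ht]

end Averaging

/-! ### Flat convex sets and their relative boundaries -/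

section FlatMeasure

variable {n : ℕ} {F : Set (Euc n)}

theorem euclideanHausdorffMeasure_image_val_affineSpan {x : Euc n} (hx : x ∈ F)
    (s : Set (affineSpan ℝ F)) :
    letI : Nonempty (affineSpan ℝ F) := ⟨⟨x, subset_affineSpan ℝ F hx⟩⟩
    (Measure.euclideanHausdorffMeasure (finrank ℝ (vectorSpan ℝ F)) : Measure (Euc n))
      (Subtype.val '' s) = (volume : Measure (affineSpan ℝ F).direction)
        (IsometryEquiv.vaddConst (⟨x, subset_affineSpan ℝ F hx⟩ : affineSpan ℝ F) ⁻¹' s) := by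
  have : Nonempty (affineSpan ℝ F) := ⟨⟨x, subset_affineSpan ℝ F hx⟩⟩
  rw [AffineSubspace.euclideanHausdorffMeasure_coe_image, ← direction_affineSpan,
    EuclideanGeometry.euclideanHausdorffMeasure_eq
      (⟨x, subset_affineSpan ℝ F hx⟩ : affineSpan ℝ F)]
  exact (IsometryEquiv.vaddConst _).toHomeomorph.toMeasurableEquiv.map_apply s

/-- The relative boundary of a convex set is a null set in the dimension of the set. -/
theorem euclideanHausdorffMeasure_intrinsicFrontier (hF : Convex ℝ F) :
    (Measure.euclideanHausdorffMeasure (finrank ℝ (vectorSpan ℝ F)) : Measure (Euc n))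
      (intrinsicFrontier ℝ F) = 0 := by
  rcases F.eq_empty_or_nonempty with rfl | ⟨x, hx⟩
  · simp
  have : Nonempty (affineSpan ℝ F) := ⟨⟨x, subset_affineSpan ℝ F hx⟩⟩
  rw [intrinsicFrontier, euclideanHausdorffMeasure_image_val_affineSpan hx]
  have h := (IsometryEquiv.vaddConst
    (⟨x, subset_affineSpan ℝ F hx⟩ : affineSpan ℝ F)).toHomeomorph.preimage_frontier
      ((↑) ⁻¹' F : Set (affineSpan ℝ F))
  refine (congrArg volume h).trans ?_
  refine Convex.addHaar_frontier volume ?_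
  intro u hu v hv a b ha hb hab
  have hc := hF hu hv ha hb hab
  simp only [mem_preimage] at hc ⊢
  convert hc using 1
  change ((a • u + b • v : (affineSpan ℝ F).direction) : Euc n) + x =
    a • ((u : Euc n) + x) + b • ((v : Euc n) + x)
  rw [smul_add, smul_add, add_add_add_comm, ← add_smul, hab, one_smul]
  rfl

theorem euclideanHausdorffMeasure_lt_top_of_isCompact (hF : IsCompact F) :
    (Measure.euclideanHausdorffMeasure (finrank ℝ (vectorSpan ℝ F)) : Measure (Euc n)) F < ⊤ := by
  rcases F.eq_empty_or_nonempty with rfl | ⟨x, hx⟩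
  · simp
  have : Nonempty (affineSpan ℝ F) := ⟨⟨x, subset_affineSpan ℝ F hx⟩⟩
  have hcl : IsClosed (affineSpan ℝ F : Set (Euc n)) :=
    AffineSubspace.closed_of_finiteDimensional _
  have h1 : IsCompact ((↑) ⁻¹' F : Set (affineSpan ℝ F)) :=
    hcl.isClosedEmbedding_subtypeVal.isCompact_preimage hF
  have h2 := euclideanHausdorffMeasure_image_val_affineSpan hx ((↑) ⁻¹' F : Set (affineSpan ℝ F))
  rw [image_preimage_eq_of_subset (by rw [Subtype.range_coe]; exact subset_affineSpan ℝ F)] at h2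
  rw [h2]
  exact ((IsometryEquiv.vaddConst _).toHomeomorph.isCompact_preimage.2 h1).measure_lt_top

end FlatMeasure

/-! ### Meeting of the faces -/

section Meeting

variable {n : ℕ}

/-- The motions `g` for which `F` meets `g G`. -/
def meetingSet (F G : Set (Euc n)) : Set (Motion n) :=
  {g | ∃ a ∈ F, ∃ b ∈ G, a = g.1.lin b + g.2}

theorem isClosed_meetingSet {F G : Set (Euc n)} (hF : IsCompact F) (hG : IsCompact G) :
    IsClosed (meetingSet F G) := by
  have h1 : Continuous fun q : (OGroup n × Euc n) × Euc n => (q.1.1, q.2 - q.1.1.lin q.1.2) := by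
    have : Continuous fun q : (OGroup n × Euc n) × Euc n => q.1.1.lin q.1.2 :=
      OGroup.continuous_lin.comp continuous_fst
    exact (continuous_fst.comp continuous_fst).prodMk (continuous_snd.sub this)
  have h2 : meetingSet F G = (fun q : (OGroup n × Euc n) × Euc n =>
      (q.1.1, q.2 - q.1.1.lin q.1.2)) '' ((univ ×ˢ G) ×ˢ F) := by
    ext g
    constructor
    · rintro ⟨a, ha, b, hb, hab⟩
      refine ⟨((g.1, b), a), ⟨⟨mem_univ _, hb⟩, ha⟩, ?_⟩
      rw [Prod.ext_iff]
      exact ⟨rfl, by simp [hab]⟩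
    · rintro ⟨⟨⟨A, b⟩, a⟩, ⟨⟨-, hb⟩, ha⟩, rfl⟩
      exact ⟨a, ha, b, hb, by simp⟩
  rw [h2]
  exact (((isCompact_univ.prod hG).prod hF).image h1).isClosed

theorem mem_meetingSet_iff {F G : Set (Euc n)} {g : Motion n} :
    g ∈ meetingSet F G ↔ (F ∩ g.image G).Nonempty := by
  constructor
  · rintro ⟨a, ha, b, hb, rfl⟩
    exact ⟨_, ha, b, hb, rfl⟩
  · rintro ⟨a, ha, b, hb, rfl⟩
    exact ⟨_, ha, b, hb, rfl⟩

/-- For a fixed rotation `A`, the translations for which `F` and the image of `G` meet are the sums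
`x - A y` with `x ∈ F` and `y ∈ G`, a linear image of the product of the faces. -/
theorem volume_fiber_meetingSet {F₁ F₂ F G : Set (Euc n)} (A : OGroup n)
    (h : finrank ℝ (vectorSpan ℝ F₁) + finrank ℝ (vectorSpan ℝ F₂) = n) (hF : F ⊆ F₁) (hG : G ⊆ F₂)
    (hne₁ : F₁.Nonempty) (hne₂ : F₂.Nonempty) :
    volume (Prod.mk A ⁻¹' meetingSet F G) =
      ENNReal.ofReal (sumDet (vectorSpan ℝ F₁) (vectorSpan ℝ F₂) A) *
        (Measure.euclideanHausdorffMeasure (finrank ℝ (vectorSpan ℝ F₁)) F *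
          Measure.euclideanHausdorffMeasure (finrank ℝ (vectorSpan ℝ F₂)) G) := by
  obtain ⟨x, hx⟩ := hne₁
  obtain ⟨y, hy⟩ := hne₂
  exact volume_translations A h (fun z hz => vsub_mem_vectorSpan ℝ (hF hz) hx)
    fun z hz => vsub_mem_vectorSpan ℝ (hG hz) hy

theorem inter_image_subsingleton {F₁ F₂ : Set (Euc n)} {g : Motion n}
    (hb : Function.Injective (sumMap (vectorSpan ℝ F₁) (vectorSpan ℝ F₂) g.1)) :
    (F₁ ∩ g.image F₂).Subsingleton := by
  rintro _ ⟨hx, a, ha, rfl⟩ _ ⟨hy, b, hb', rfl⟩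
  have h := @hb (⟨_ - _, vsub_mem_vectorSpan ℝ hx hy⟩, ⟨b - a, vsub_mem_vectorSpan ℝ hb' ha⟩) 0 (by
    rw [map_zero, sumMap_apply]
    simp)
  have := congrArg (fun p => ((p.1 : vectorSpan ℝ F₁) : Euc n)) h
  exact sub_eq_zero.1 this

/-- Almost every motion is either in general position, or the faces do not meet. -/
theorem ae_general_position {F₁ F₂ : Set (Euc n)} (hF₁ : IsCompact F₁) (hF₂ : IsCompact F₂)
    (hc₁ : Convex ℝ F₁) (hc₂ : Convex ℝ F₂) (hne₁ : F₁.Nonempty) (hne₂ : F₂.Nonempty)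
    (h : finrank ℝ (vectorSpan ℝ F₁) + finrank ℝ (vectorSpan ℝ F₂) = n) :
    ∀ᵐ g ∂(Motion.measure n), g ∈ meetingSet F₁ F₂ →
      sumDet (vectorSpan ℝ F₁) (vectorSpan ℝ F₂) g.1 ≠ 0 ∧
        F₁ ∩ g.image F₂ ⊆ intrinsicInterior ℝ F₁ ∩ g.image (intrinsicInterior ℝ F₂) := by
  have hcl₁ := isClosed_intrinsicFrontier (𝕜 := ℝ) (s := F₁)
    (AffineSubspace.closed_of_finiteDimensional _)
  have hcl₂ := isClosed_intrinsicFrontier (𝕜 := ℝ) (s := F₂)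
    (AffineSubspace.closed_of_finiteDimensional _)
  have hs₁ : intrinsicFrontier ℝ F₁ ⊆ F₁ := intrinsicFrontier_subset hF₁.isClosed
  have hs₂ : intrinsicFrontier ℝ F₂ ⊆ F₂ := intrinsicFrontier_subset hF₂.isClosed
  have hD : Measurable fun g : Motion n => sumDet (vectorSpan ℝ F₁) (vectorSpan ℝ F₂) g.1 :=
    (continuous_sumDet h).measurable.comp measurable_fst
  have n1 : ∀ᵐ g ∂(Motion.measure n), ¬ (g ∈ meetingSet F₁ F₂ ∧
      sumDet (vectorSpan ℝ F₁) (vectorSpan ℝ F₂) g.1 = 0) := by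
    rw [ae_iff]
    simp only [not_not]
    have hm : MeasurableSet {g : Motion n | g ∈ meetingSet F₁ F₂ ∧
        sumDet (vectorSpan ℝ F₁) (vectorSpan ℝ F₂) g.1 = 0} :=
      (isClosed_meetingSet hF₁ hF₂).measurableSet.inter (hD (measurableSet_singleton 0))
    refine (Measure.measure_prod_null hm).2 (Eventually.of_forall fun A => ?_)
    by_cases hA : sumDet (vectorSpan ℝ F₁) (vectorSpan ℝ F₂) A = 0
    · refine measure_mono_null (t := Prod.mk A ⁻¹' meetingSet F₁ F₂) (fun t ht => ht.1) ?_
      rw [volume_fiber_meetingSet A h Subset.rfl Subset.rfl hne₁ hne₂, hA, ENNReal.ofReal_zero,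
        zero_mul]
    · refine measure_mono_null (t := ∅) (fun t ht => hA ht.2) measure_empty
  have n2 : ∀ᵐ g ∂(Motion.measure n), g ∉ meetingSet (intrinsicFrontier ℝ F₁) F₂ := by
    rw [ae_iff]
    simp only [not_not]
    have hm := (isClosed_meetingSet (hF₁.of_isClosed_subset hcl₁ hs₁) hF₂).measurableSet
    refine (Measure.measure_prod_null hm).2 (Eventually.of_forall fun A => ?_)
    refine (volume_fiber_meetingSet A h hs₁ Subset.rfl hne₁ hne₂).trans ?_
    rw [euclideanHausdorffMeasure_intrinsicFrontier hc₁]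
    simp
  have n3 : ∀ᵐ g ∂(Motion.measure n), g ∉ meetingSet F₁ (intrinsicFrontier ℝ F₂) := by
    rw [ae_iff]
    simp only [not_not]
    have hm := (isClosed_meetingSet hF₁ (hF₂.of_isClosed_subset hcl₂ hs₂)).measurableSet
    refine (Measure.measure_prod_null hm).2 (Eventually.of_forall fun A => ?_)
    refine (volume_fiber_meetingSet A h Subset.rfl hs₂ hne₁ hne₂).trans ?_
    rw [euclideanHausdorffMeasure_intrinsicFrontier hc₂]
    simp
  filter_upwards [n1, n2, n3] with g h1 h2 h3 hg
  refine ⟨fun h0 => h1 ⟨hg, h0⟩, ?_⟩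
  rintro _ ⟨hx, b, hb, rfl⟩
  constructor
  · rw [← closure_sdiff_intrinsicFrontier, hF₁.isClosed.closure_eq]
    exact ⟨hx, fun hfr => h2 ⟨_, hfr, b, hb, rfl⟩⟩
  · refine ⟨b, ?_, rfl⟩
    rw [← closure_sdiff_intrinsicFrontier, hF₂.isClosed.closure_eq]
    exact ⟨hb, fun hfr => h3 ⟨_, hx, b, hfr, rfl⟩⟩

end Meeting

/-! ### The curvature at a transversal intersection point -/

/-- Near a transversal intersection point of relative interiors the set is a linear image of the
join of the two normal fans, so that its index is a product in the coordinates `b₁ + A b₂` and its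
curvature depends only on the rotational part of the motion. -/
theorem CurvatureMap.atPoint_inter_image (ρ : CurvatureMap) {n : ℕ} {X₁ X₂ F₁ F₂ : Set (Euc n)}
    {m₁ m₂ : ℕ} {u₁ : Fin m₁ → (vectorSpan ℝ F₁)ᗮ} {Δ₁ : Set (Finset (Fin m₁))}
    {u₂ : Fin m₂ → (vectorSpan ℝ F₂)ᗮ} {Δ₂ : Set (Finset (Fin m₂))}
    (h₁ : IsNormalFan X₁ F₁ u₁ Δ₁) (h₂ : IsNormalFan X₂ F₂ u₂ Δ₂) {g : Motion n}
    (h : finrank ℝ (vectorSpan ℝ F₁) + finrank ℝ (vectorSpan ℝ F₂) = n)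
    (hg : sumDet (vectorSpan ℝ F₁) (vectorSpan ℝ F₂) g.1 ≠ 0)
    {x : Euc n} (hx₁ : x ∈ intrinsicInterior ℝ F₁) (hx₂ : x ∈ g.image (intrinsicInterior ℝ F₂)) :
    ρ.atPoint (X₁ ∩ g.image X₂) x = coordAverage (vectorSpan ℝ F₁) (vectorSpan ℝ F₂)
      (ρ.fanVal u₁ Δ₁) (ρ.fanVal u₂ Δ₂) g.1 := by
  have hb := bijective_sumMap_orthogonal h hg
  let L : Euc n ≃ₗ[ℝ] (vectorSpan ℝ F₁)ᗮ × (vectorSpan ℝ F₂)ᗮ :=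
    LinearEquiv.ofBijective _ (bijective_projMap hb)
  let S : ((vectorSpan ℝ F₁)ᗮ × (vectorSpan ℝ F₂)ᗮ) ≃ₗ[ℝ] Euc n := LinearEquiv.ofBijective _ hb
  have hL : ∀ p q, inner ℝ (L.symm p) (sumMap _ _ g.1 q) = inner ℝ p.1 q.1 + inner ℝ p.2 q.2 := by
    intro p q
    have hp : projMap _ _ g.1 (L.symm p) = p := L.apply_symm_apply p
    rw [inner_sumMap, hp]
  let w : Fin (m₁ + m₂) → Euc n := Fin.append (fun i => L.symm (u₁ i, 0)) fun i => L.symm (0, u₂ i)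
  have hw : ∀ i, w i ≠ 0 := by
    intro i
    induction i using Fin.addCases with
    | left i => simpa [w, Prod.ext_iff] using h₁.ne_zero i
    | right i => simpa [w, Prod.ext_iff] using h₂.ne_zero i
  rw [← sphereAverage_eq_coordAverage h hg (fun t ht b => ρ.fanVal_smul u₁ Δ₁ ht b)
    (fun t ht b => ρ.fanVal_smul u₂ Δ₂ ht b)
    (f := fun a => ρ.fanVal u₁ Δ₁ (S.symm a).1 * ρ.fanVal u₂ Δ₂ (S.symm a).2)]
  · refine sphereAverage_congr hw fun a ha => ?_
    obtain ⟨b, rfl⟩ := hb.2 a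
    have hS : S.symm (sumMap _ _ g.1 b) = b := S.symm_apply_apply b
    rw [index_inter_image ρ h₁ h₂ hb hx₁ hx₂ (b := b), hS]
    · intro i
      have := ha (Fin.castAdd m₂ i)
      simpa [w, hL] using this
    · intro i
      have := ha (Fin.natAdd m₁ i)
      simpa [w, hL] using this
  · intro p
    have hS : S.symm (sumMap _ _ g.1 p) = p := S.symm_apply_apply p
    rw [hS]

/-! ### The local kinematic formula -/

/-- The kinematic constant, defined by coordinate subspaces, may be computed with any two subspaces
of complementary dimensions. -/
theorem kinematicConst_eq_integral_sumDet {n k : ℕ} (hk : k ≤ n) {U V : Submodule ℝ (Euc n)}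
    (hU : finrank ℝ U = k) (hV : finrank ℝ V = n - k) :
    kinematicConst n k = ∫ A, sumDet U V A ∂(OGroup.haar n) := by
  have e₁ : finrank ℝ (coordSubspace {i : Fin n | (i : ℕ) < k}) = k := by
    have := finrank_coordSubspace (Finset.univ.filter fun i : Fin n => (i : ℕ) < k)
    rw [show ((Finset.univ.filter fun i : Fin n => (i : ℕ) < k : Finset (Fin n)) : Set (Fin n)) =
      {i : Fin n | (i : ℕ) < k} by ext; simp] at this
    rw [this, Fin.card_filter_val_lt, min_eq_right hk]
  have e₂ : finrank ℝ (coordSubspace {i : Fin n | k ≤ (i : ℕ)}) = n - k := by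
    have := finrank_coordSubspace (Finset.univ.filter fun i : Fin n => k ≤ (i : ℕ))
    rw [show ((Finset.univ.filter fun i : Fin n => k ≤ (i : ℕ) : Finset (Fin n)) : Set (Fin n)) =
      {i : Fin n | k ≤ (i : ℕ)} by ext; simp] at this
    rw [this]
    have h := Finset.card_filter_add_card_filter_not (s := (Finset.univ : Finset (Fin n)))
      fun i : Fin n => (i : ℕ) < k
    simp only [not_lt, Fin.card_filter_val_lt, min_eq_right hk, Finset.card_univ,
      Fintype.card_fin] at h
    omega
  rw [kinematicConst]
  simp_rw [subspaceDet_map (show finrank ℝ (coordSubspace {i : Fin n | (i : ℕ) < k}) +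
    finrank ℝ (coordSubspace {i : Fin n | k ≤ (i : ℕ)}) = n by omega)]
  exact integral_sumDet_eq (hU.trans e₁.symm) (hV.trans e₂.symm)

theorem proposition3p6 (ρ : CurvatureMap) (n k : ℕ) (hk : k ≤ n) (K₁ K₂ : PolyComplex n)
    (F₁ F₂ : Set (Euc n)) (hF₁ : K₁.IsFace k F₁) (hF₂ : K₂.IsFace (n - k) F₂) :
    (∀ᵐ g ∂(Motion.measure n), (F₁ ∩ g.image F₂).Subsingleton) ∧
    Integrable (localIntegrand ρ K₁.space F₁ K₂.space F₂) (Motion.measure n) ∧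
    ∫ g, localIntegrand ρ K₁.space F₁ K₂.space F₂ g ∂(Motion.measure n) =
      kVolume k F₁ * kVolume (n - k) F₂ * kinematicConst n k *
        ρ.atFace K₁.space F₁ * ρ.atFace K₂.space F₂ ∧
    kVolume k F₁ * kVolume (n - k) F₂ * kinematicConst n k *
        ρ.atFace K₁.space F₁ * ρ.atFace K₂.space F₂ =
      kinematicConst n k * ρ.W k K₁.space F₁ * ρ.W (n - k) K₂.space F₂ ∧
    Integrable (fun A : OGroup n =>
      subspaceDet (vectorSpan ℝ F₁) ((vectorSpan ℝ F₂).map A.lin)) (OGroup.haar n) ∧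
    kinematicConst n k =
      ∫ A : OGroup n, subspaceDet (vectorSpan ℝ F₁) ((vectorSpan ℝ F₂).map A.lin)
        ∂(OGroup.haar n) := by
  obtain ⟨hc₁, hd₁⟩ := hF₁
  obtain ⟨hc₂, hd₂⟩ := hF₂
  have h : finrank ℝ (vectorSpan ℝ F₁) + finrank ℝ (vectorSpan ℝ F₂) = n := by omega
  have hcomp₁ := (K₁.polytope F₁ hc₁).isCompact
  have hcomp₂ := (K₂.polytope F₂ hc₂).isCompact
  have hne₁ := K₁.nonempty F₁ hc₁
  have hne₂ := K₂.nonempty F₂ hc₂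
  have hgen := ae_general_position hcomp₁ hcomp₂ (K₁.polytope F₁ hc₁).convex
    (K₂.polytope F₂ hc₂).convex hne₁ hne₂ h
  obtain ⟨m₁, u₁, Δ₁, hfan₁, hat₁⟩ := K₁.exists_isNormalFan_atFace ρ hc₁
  obtain ⟨m₂, u₂, Δ₂, hfan₂, hat₂⟩ := K₂.exists_isNormalFan_atFace ρ hc₂
  obtain ⟨C₁, hC₁⟩ := ρ.exists_fanVal_bound u₁ Δ₁
  obtain ⟨C₂, hC₂⟩ := ρ.exists_fanVal_bound u₂ Δ₂
  have hm₁ := ρ.measurable_fanVal u₁ Δ₁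
  have hm₂ := ρ.measurable_fanVal u₂ Δ₂
  let D : OGroup n → ℝ := fun A => sumDet (vectorSpan ℝ F₁) (vectorSpan ℝ F₂) A
  let Ψ : OGroup n → ℝ := coordAverage (vectorSpan ℝ F₁) (vectorSpan ℝ F₂) (ρ.fanVal u₁ Δ₁)
    (ρ.fanVal u₂ Δ₂)
  have hDm : Measurable D := (continuous_sumDet h).measurable
  have hΨm : Measurable Ψ := measurable_coordAverage h hm₁ hm₂
  -- the motions for which the faces meet and their directions are complementary; almost everywhere
  -- the integrand is `Ψ` of the rotational part there and `0` elsewhere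
  let N : Set (Motion n) := {g | g ∈ meetingSet F₁ F₂ ∧ D g.1 ≠ 0}
  have hN : MeasurableSet N := (isClosed_meetingSet hcomp₁ hcomp₂).measurableSet.inter
    ((hDm.comp measurable_fst) (measurableSet_singleton 0).compl)
  have hsub : ∀ᵐ g ∂(Motion.measure n), (F₁ ∩ g.image F₂).Subsingleton := by
    filter_upwards [hgen] with g hg
    by_cases hgm : g ∈ meetingSet F₁ F₂
    · exact inter_image_subsingleton (bijective_sumMap h (hg hgm).1).1
    · rw [mem_meetingSet_iff, not_nonempty_iff_eq_empty] at hgm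
      rw [hgm]
      exact subsingleton_empty
  have hae : localIntegrand ρ K₁.space F₁ K₂.space F₂ =ᵐ[Motion.measure n]
      N.indicator fun g => Ψ g.1 := by
    filter_upwards [hgen, hsub] with g hg hs
    by_cases hgm : g ∈ meetingSet F₁ F₂
    · obtain ⟨hD, hint⟩ := hg hgm
      rw [indicator_of_mem (show g ∈ N from ⟨hgm, hD⟩)]
      obtain ⟨x, hx⟩ := mem_meetingSet_iff.1 hgm
      rw [localIntegrand, hs.eq_singleton_of_mem hx, finsum_mem_singleton]
      exact ρ.atPoint_inter_image hfan₁ hfan₂ h hD (hint hx).1 (hint hx).2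
    · rw [indicator_of_notMem fun hgN => hgm hgN.1]
      rw [mem_meetingSet_iff, not_nonempty_iff_eq_empty] at hgm
      rw [localIntegrand, hgm, finsum_mem_empty]
  have hvol : ∀ A, volume (Prod.mk A ⁻¹' meetingSet F₁ F₂) = ENNReal.ofReal (D A) *
      (Measure.euclideanHausdorffMeasure k F₁ * Measure.euclideanHausdorffMeasure (n - k) F₂) := by
    intro A
    rw [volume_fiber_meetingSet A h Subset.rfl Subset.rfl hne₁ hne₂, hd₁, hd₂]
  have hfin₁ := euclideanHausdorffMeasure_lt_top_of_isCompact hcomp₁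
  have hfin₂ := euclideanHausdorffMeasure_lt_top_of_isCompact hcomp₂
  rw [hd₁] at hfin₁
  rw [hd₂] at hfin₂
  have hNfin : Motion.measure n N < ⊤ := by
    have hmeas := (isClosed_meetingSet hcomp₁ hcomp₂).measurableSet
    refine (measure_mono (t := meetingSet F₁ F₂) fun g hg => hg.1).trans_lt ?_
    rw [Motion.measure, Measure.prod_apply hmeas]
    simp_rw [hvol]
    rw [lintegral_mul_const _ hDm.ennreal_ofReal]
    refine ENNReal.mul_lt_top ?_ (ENNReal.mul_lt_top hfin₁ hfin₂)
    exact (integrable_sumDet h).lintegral_lt_top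
  have hint : Integrable (N.indicator fun g => Ψ g.1) (Motion.measure n) := by
    rw [integrable_indicator_iff hN]
    refine Measure.integrableOn_of_bounded (M := C₁ * C₂) hNfin.ne
      (hΨm.comp measurable_fst).aestronglyMeasurable ?_
    filter_upwards [ae_restrict_mem hN] with g hg
    exact abs_coordAverage_le h hC₁ hC₂ g.1 hg.2
  have hfiber : ∀ A, ∫ t, N.indicator (fun g => Ψ g.1) (A, t) =
      kVolume k F₁ * kVolume (n - k) F₂ * (D A * Ψ A) := by
    intro A
    by_cases hA : D A = 0
    · have : ∀ t, N.indicator (fun g => Ψ g.1) (A, t) = 0 := fun t =>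
        indicator_of_notMem (fun ht => ht.2 hA) _
      simp [this, hA]
    · have hset : ∀ t, N.indicator (fun g => Ψ g.1) (A, t) =
          (Prod.mk A ⁻¹' meetingSet F₁ F₂).indicator (fun _ => Ψ A) t := by
        intro t
        by_cases ht : (A, t) ∈ meetingSet F₁ F₂
        · rw [indicator_of_mem (show (A, t) ∈ N from ⟨ht, hA⟩),
            indicator_of_mem (show t ∈ Prod.mk A ⁻¹' meetingSet F₁ F₂ from ht)]
        · rw [indicator_of_notMem fun h => ht h.1,
            indicator_of_notMem (show t ∉ Prod.mk A ⁻¹' meetingSet F₁ F₂ from ht)]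
      have hmeas : MeasurableSet (Prod.mk A ⁻¹' meetingSet F₁ F₂) :=
        measurable_prodMk_left (isClosed_meetingSet hcomp₁ hcomp₂).measurableSet
      simp_rw [hset]
      rw [integral_indicator_const _ hmeas, measureReal_def, hvol, ENNReal.toReal_mul,
        ENNReal.toReal_mul, ENNReal.toReal_ofReal (sumDet_nonneg _ _ _), smul_eq_mul]
      simp only [kVolume]
      ring
  have hc := kinematicConst_eq_integral_sumDet hk hd₁ hd₂
  refine ⟨hsub, hint.congr hae.symm, ?_, ?_, ?_, ?_⟩
  · rw [integral_congr_ae hae, Motion.measure, integral_prod _ hint]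
    simp_rw [hfiber]
    rw [integral_const_mul, integral_sumDet_mul_coordAverage h hm₁ hm₂ hC₁ hC₂
      (fun t ht b => ρ.fanVal_smul u₁ Δ₁ ht b) (fun t ht b => ρ.fanVal_smul u₂ Δ₂ ht b), ← hc,
      ← hat₁, ← hat₂]
    ring
  · simp only [CurvatureMap.W]
    ring
  · simp_rw [subspaceDet_map h]
    exact integrable_sumDet h
  · simp_rw [subspaceDet_map h]
    exact hc
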